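/- Let $a>0$, $\Omega=(-a,a)\times(-1,1)$, and let $L^1$ spaces be complex. For $i=1,2$ let $\alpha_i,\beta_i\ge 0$ with $\alpha_i+\beta_i=1$. Let $K_1:L^1((-1,0);dv)\to L^1((0,1);dv)$ and $K_2:L^1((0,1);dv)\to L^1((-1,0);dv)$ be stochastic (positive, and norm preserving on the positive cone) integral operators, $(K_i\varphi)(v)=\int k_i(v,v')\varphi(v')\,dv'$, whose kernels $k_1,k_2$ are continuous on the closed squares $[0,1]\times[-1,0]$ and $[-1,0]\times[0,1]$ respectively. Put $O_i=\alpha_iR_i+\beta_iK_i$ with the specular reflections $(R_i\varphi)(v)=\varphi(-v)$, and assume that $O_1=K_1$ or $O_2=K_2$. Let $T_O$ be the transport operator $T_Of=-v\,\partial f/\partial x$ (in the sense of distributions) in $L^1(\Omega)$, whose domain $D(T_O)$ consists of all $f\in L^1(\Omega)$ with $v\,\partial f/\partial x\in L^1(\Omega)$ whose boundary fluxes $h^{\pm}_{-a}$, $h^{\pm}_{a}$, i.e. the restrictions of $|v|f(-a,v)$ and $|v|f(a,v)$ to $v>0$ (sign $+$) and $v<0$ (sign $-$), satisfy $h^+_{-a}=O_1h^-_{-a}$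 and $h^-_a=O_2h^+_a$. Let $k\ge 0$ be an integer and assume that the following operators, in which $|v|^m$ denotes multiplication by $|v|^m$, are (everywhere defined and) bounded between the corresponding spaces $L^1(dv)$: $$|v|^{-(k+1)}O_1O_2,\qquad |v|^{-(k+1)}O_1|v|^{k+1},\qquad |v|^{-(k+1-p)}O_2|v|^{k+1-p}\quad(0\le p\le k).$$ Let $Z=\{g\in L^1(\Omega):\ g/|v|^{k+1}\in L^1(\Omega)\}$ with $\|g\|_Z=\|g/|v|^{k+1}\|_{L^1(\Omega)}$. Then the resolvent $(\lambda-T_O)^{-1}$ exists as a bounded operator on $L^1(\Omega)$ for every $\lambda$ with $\mathrm{Re}\,\lambda>0$, and there is a constant $C>0$ such that for every $g\in Z$ the following holds. For every real $s\ne 0$ the limit $$F_g(s)=\lim_{\lambda\to is,\ \mathrm{Re}\,\lambda>0}(\lambda-T_O)^{-1}g$$ exists in $L^1(\Omega)$ (so that $\lambda\mapsto(\lambda-T_O)^{-1}g$ extends continuously to $i\mathbb R\setminus\{0\}$), the map $F_g$ belongs to $C^k(\mathbb R\setminus\{0\};L^1(\Omega))$, and $$\sup_{|s|\ge1}\|F_g^{(j)}(s)\|<\infty\quad(0\le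 j\le k),\qquad \|F_g^{(j)}(s)\|\le\frac{C}{s^{2(j+1)}}\,\|g\|_Z\quad(0\le j\le k,\ 0<|s|\le1).$$ -/

import Mathlib

open MeasureTheory Set Filter Topology
open scoped ContDiff NNReal ENNReal

noncomputable section

namespace Slab

/-- Lebesgue measure on the outgoing velocities `(0, 1)`. -/
abbrev velPos : Measure ℝ := volume.restrict (Ioo 0 1)

/-- Lebesgue measure on the velocities `(-1, 0)`. -/
abbrev velNeg : Measure ℝ := volume.restrict (Ioo (-1) 0)

/-- Lebesgue measure on the phase space `Ω = (-a, a) × (-1, 1)`, with points `(x, v)`. -/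
abbrev phase (a : ℝ) : Measure (ℝ × ℝ) := volume.restrict (Ioo (-a) a ×ˢ Ioo (-1) 1)

/-- Complex `L¹((0, 1); dv)`. -/
abbrev L1Pos : Type := Lp ℂ 1 velPos

/-- Complex `L¹((-1, 0); dv)`. -/
abbrev L1Neg : Type := Lp ℂ 1 velNeg

/-- Complex `L¹(Ω)`. -/
abbrev L1Phase (a : ℝ) : Type := Lp ℂ 1 (phase a)

theorem measurePreserving_neg_pos : MeasurePreserving (fun v : ℝ => -v) velPos velNeg := by
  have h := (Measure.measurePreserving_neg (volume : Measure ℝ)).restrict_preimage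
    (s := Ioo (-1 : ℝ) 0) measurableSet_Ioo
  simpa [velPos, velNeg] using h

theorem measurePreserving_neg_neg : MeasurePreserving (fun v : ℝ => -v) velNeg velPos := by
  have h := (Measure.measurePreserving_neg (volume : Measure ℝ)).restrict_preimage
    (s := Ioo (0 : ℝ) 1) measurableSet_Ioo
  simpa [velPos, velNeg] using h

/-- The specular reflection `R₁ : L¹(-1, 0) → L¹(0, 1)`, `(R₁ φ)(v) = φ(-v)`. -/
def reflect₁ : L1Neg →L[ℂ] L1Pos :=
  (Lp.compMeasurePreservingₗᵢ ℂ (fun v : ℝ => -v) measurePreserving_neg_pos).toContinuousLinearMap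

/-- The specular reflection `R₂ : L¹(0, 1) → L¹(-1, 0)`, `(R₂ φ)(v) = φ(-v)`. -/
def reflect₂ : L1Pos →L[ℂ] L1Neg :=
  (Lp.compMeasurePreservingₗᵢ ℂ (fun v : ℝ => -v) measurePreserving_neg_neg).toContinuousLinearMap

section Operators

variable {μ ν ρ : Measure ℝ}

/-- The positive cone of complex `L¹(μ)`: real and nonnegative almost everywhere. -/
def IsNonneg (f : Lp ℂ 1 μ) : Prop := ∀ᵐ v ∂μ, 0 ≤ (f v).re ∧ (f v).im = 0

/-- A stochastic operator: positive, and norm preserving on the positive cone. -/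
def IsStochastic (K : Lp ℂ 1 μ →L[ℂ] Lp ℂ 1 ν) : Prop :=
  ∀ f : Lp ℂ 1 μ, IsNonneg f → IsNonneg (K f) ∧ ‖K f‖ = ‖f‖

/-- `K` is the integral operator `(K f)(v) = ∫ k(v, v') f(v') dv'`. -/
def HasKernel (K : Lp ℂ 1 μ →L[ℂ] Lp ℂ 1 ν) (k : ℝ → ℝ → ℝ) : Prop :=
  ∀ f : Lp ℂ 1 μ, K f =ᵐ[ν] fun v => ∫ v', (k v v' : ℂ) * f v' ∂μ

/-- The operator `|v|^{-m} A |v|^n` is everywhere defined and bounded from `L¹(μ)` to `L¹(ν)`,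
where `|v|^{-m}` and `|v|^n` are multiplication operators. In the second line `g` stands for the
product `|v|^n f`. -/
def IsBoundedWeighted (m : ℕ) (A : Lp ℂ 1 μ →L[ℂ] Lp ℂ 1 ν) (n : ℕ) : Prop :=
  ∃ C : ℝ≥0, ∀ f g : Lp ℂ 1 μ, (g =ᵐ[μ] fun v => ((|v| ^ n : ℝ) : ℂ) * f v) →
    ∫⁻ v, ENNReal.ofReal ((|v| ^ m)⁻¹) * ‖A g v‖ₑ ∂ν ≤ C * ‖f‖ₑ

end Operators

/-- `w = -v ∂f/∂x` on `Ω` in the sense of distributions. -/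
def IsWeakTransport (a : ℝ) (f w : L1Phase a) : Prop :=
  ∀ φ : ℝ × ℝ → ℝ, ContDiff ℝ ∞ φ → HasCompactSupport φ →
    tsupport φ ⊆ Ioo (-a) a ×ˢ Ioo (-1) 1 →
    ∫ z, ((z.2 * fderiv ℝ φ z (1, 0) : ℝ) : ℂ) * f z ∂(phase a) =
      ∫ z, (φ z : ℂ) * w z ∂(phase a)

/-- The boundary fluxes `|v| f(∓a, v)` of `f`, on `v > 0` and on `v < 0`, are the given integrable
functions. The boundary values are those of the representative `F` of `f` that is continuous in
`x ∈ [-a, a]` for almost every `v`; such a representative determines them for almost every `v`. -/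
def HasFluxes (a : ℝ) (f : L1Phase a) (hLeftPos : L1Pos) (hLeftNeg : L1Neg)
    (hRightPos : L1Pos) (hRightNeg : L1Neg) : Prop :=
  ∃ F : ℝ × ℝ → ℂ, f =ᵐ[phase a] F ∧
    (∀ᵐ v ∂(volume.restrict (Ioo (-1 : ℝ) 1)),
      ContinuousOn (fun x => F (x, v)) (Icc (-a) a)) ∧
    (hLeftPos =ᵐ[velPos] fun v => ((|v| : ℝ) : ℂ) * F (-a, v)) ∧
    (hLeftNeg =ᵐ[velNeg] fun v => ((|v| : ℝ) : ℂ) * F (-a, v)) ∧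
    (hRightPos =ᵐ[velPos] fun v => ((|v| : ℝ) : ℂ) * F (a, v)) ∧
    (hRightNeg =ᵐ[velNeg] fun v => ((|v| : ℝ) : ℂ) * F (a, v))

/-- The graph of the transport operator `T_O`: `f ∈ D(T_O)` and `T_O f = w`, that is,
`w = -v ∂f/∂x ∈ L¹(Ω)` and the fluxes satisfy `h_{-a}^+ = O₁ h_{-a}^-`, `h_a^- = O₂ h_a^+`. -/
def TransportGraph (a : ℝ) (O₁ : L1Neg →L[ℂ] L1Pos) (O₂ : L1Pos →L[ℂ] L1Neg)
    (f w : L1Phase a) : Prop :=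
  IsWeakTransport a f w ∧
    ∃ (hLeftPos : L1Pos) (hLeftNeg : L1Neg) (hRightPos : L1Pos) (hRightNeg : L1Neg),
      HasFluxes a f hLeftPos hLeftNeg hRightPos hRightNeg ∧
      hLeftPos = O₁ hLeftNeg ∧ hRightNeg = O₂ hRightPos

/-- `R = (z - T_O)⁻¹`: for all `f, g`, one has `f ∈ D(T_O)` and `z f - T_O f = g` if and only if
`f = R g`. -/
def IsResolventAt (a : ℝ) (O₁ : L1Neg →L[ℂ] L1Pos) (O₂ : L1Pos →L[ℂ] L1Neg) (z : ℂ)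
    (R : L1Phase a →L[ℂ] L1Phase a) : Prop :=
  ∀ f g : L1Phase a, (∃ w, TransportGraph a O₁ O₂ f w ∧ z • f - w = g) ↔ f = R g

/-- `g ∈ Z`, i.e. `g / |v|^{k+1} ∈ L¹(Ω)`. -/
def MemZ (k : ℕ) {a : ℝ} (g : L1Phase a) : Prop :=
  Integrable (fun z : ℝ × ℝ => ‖g z‖ / |z.2| ^ (k + 1)) (phase a)

/-- The norm `‖g‖_Z = ‖g / |v|^{k+1}‖` of `g ∈ Z`. -/
def normZ (k : ℕ) {a : ℝ} (g : L1Phase a) : ℝ :=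
  ∫ z, ‖g z‖ / |z.2| ^ (k + 1) ∂(phase a)

end Slab

end

/-! Write i for the flux entering the slab through the walls and o for the flux leaving it, both as
functions of v in (-1, 1). Solving the transport equation along characteristics gives o = E i +
collect g, where E = E(z) multiplies by exp(-2az/|v|), and the boundary conditions say i = H o,
where H is built from O₁ and O₂. Hence i = (1 - A)⁻¹ H (collect g) with A = H E, and f is obtained
by transporting i and g through the slab (`isResolventAt_transportResolvent`). For Re z > 0 this is
unproblematic since ‖A‖ < 1. On the imaginary axis only ‖A‖ ≤ 1 is immediate.

There the contraction comes from oscillation. Between two collisions with continuous stochastic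
kernels, the factor exp(-isc/|w|) varies with the intermediate velocity w, so integrating over w
loses at least κ min(1, s²) of the mass (`exists_contraction_const`). As one wall is purely diffuse,
every block of A⁴ contains diffuse collisions separated by flights (`exists_norm_diffuse_le`,
`norm_crossing_pow_four_le`). This yields ‖(1 - A)⁻¹‖ ≤ C ω(s) with ω(s) = max(1, s⁻²), uniformly
for Re z ≥ 0 and Im z = s.

Each s-derivative of exp(-isc/|v|) produces an unbounded factor 1/|v|. Let J be multiplication by
|v| and write g = J^(k+1) g'. One power of J cancels the 1/|v| that turns fluxes into densities; the
other k pay for k derivatives. To move powers of J through the formula one needs bounded versions of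
J⁻ᵐ H Jᵐ and J⁻ᵐ (1 - A)⁻¹ Jᵐ for m ≤ k + 1. The former come from the weighted hypotheses
(`exists_levels`), where the lower orders for O₁ are interpolated (`IsBoundedWeighted.of_le`). For
the latter, (1 - A)⁻¹ = 1 + A + A² + A³ (1 - A)⁻¹, and each block of A³ contains O₁ E O₂, which is
divisible by |v|^(k+1) because it is dominated by O₁O₂ (`exists_smoothing`, `weighted_inverse`,
`exists_wallResolvent`).

`Graded` keeps the accounts. Differentiating (1 - A)⁻¹ inserts a second copy of it, so each
derivative costs one more factor ω (`Graded.resolvent`). Starting from one resolvent, the j-th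
derivative is of order ω^(j+1) (`graded_profile`), which is s^(-2(j+1)) near 0 and bounded for |s| ≥
1. The families are indexed by the source itself, with its norm as N, so that the constants do not
depend on g. -/

noncomputable section

namespace Slab

/-! ### Operators on L¹: weighted compositions, marginals, dominated convergence. -/

section Builders

variable {α β : Type*} [MeasurableSpace α] [MeasurableSpace β]

theorem enorm_L1 {μ : Measure α} (f : Lp ℂ 1 μ) : ‖f‖ₑ = ∫⁻ x, ‖f x‖ₑ ∂μ := by
  rw [Lp.enorm_def, eLpNorm_one_eq_lintegral_enorm]

theorem norm_L1 {μ : Measure α} (f : Lp ℂ 1 μ) : ‖f‖ = ∫ x, ‖f x‖ ∂μ :=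
  L1.norm_eq_integral_norm f

theorem norm_le_of_enorm_le {E F : Type*} [SeminormedAddCommGroup E] [SeminormedAddCommGroup F]
    {x : E} {y : F} {C : ℝ≥0} (h : ‖x‖ₑ ≤ C * ‖y‖ₑ) : ‖x‖ ≤ C * ‖y‖ := by
  have h' : ‖x‖₊ ≤ C * ‖y‖₊ := by
    rw [enorm_eq_nnnorm, enorm_eq_nnnorm] at h
    exact_mod_cast h
  exact_mod_cast h'

theorem enorm_le_of_norm_le {E F : Type*} [SeminormedAddCommGroup E] [SeminormedAddCommGroup F]
    {x : E} {y : F} {C : ℝ≥0} (h : ‖x‖ ≤ C * ‖y‖) : ‖x‖ₑ ≤ C * ‖y‖ₑ := by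
  have h' : ‖x‖₊ ≤ C * ‖y‖₊ := by exact_mod_cast h
  rw [enorm_eq_nnnorm, enorm_eq_nnnorm]
  exact_mod_cast h'

/-- The operator `f ↦ κ · (f ∘ π)` is bounded by `C` from `L¹(μ)` to `L¹(ρ)`. -/
structure WComp (π : β → α) (κ : β → ℂ) (μ : Measure α) (ρ : Measure β) (C : ℝ≥0) : Prop where
  measurable_map : Measurable π
  measurable_weight : Measurable κ
  bound : ∀ F : α → ℝ≥0∞, Measurable F →
    ∫⁻ y, ‖κ y‖ₑ * F (π y) ∂ρ ≤ C * ∫⁻ x, F x ∂μ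

variable {π : β → α} {κ : β → ℂ} {μ : Measure α} {ρ : Measure β} {C : ℝ≥0}

/-- `bound`, applied to the indicator of a null set, shows that the preimage under `π` is null away
from the zeros of `κ`. So `κ · (f ∘ π)` does not depend on the representative of `f`, although `π`
alone need not preserve null sets. -/
theorem WComp.ae_of_ae (h : WComp π κ μ ρ C) {p : α → Prop} (hp : ∀ᵐ x ∂μ, p x) :
    ∀ᵐ y ∂ρ, κ y = 0 ∨ p (π y) := by
  obtain ⟨N, hN, hNm, hN0⟩ := exists_measurable_superset_of_null (ae_iff.1 hp)
  have hb := h.bound (N.indicator 1) (measurable_one.indicator hNm)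
  rw [lintegral_indicator_one hNm, hN0, mul_zero, nonpos_iff_eq_zero,
    lintegral_eq_zero_iff] at hb
  · filter_upwards [hb] with y hy
    by_cases hyN : π y ∈ N
    · left
      simpa [hyN] using hy
    · right
      by_contra hpy
      exact hyN (hN hpy)
  · exact h.measurable_weight.enorm.mul
      ((measurable_one.indicator hNm).comp h.measurable_map)

theorem WComp.ae_congr (h : WComp π κ μ ρ C) {f g : α → ℂ} (hfg : f =ᵐ[μ] g) :
    (fun y => κ y * f (π y)) =ᵐ[ρ] fun y => κ y * g (π y) := by
  filter_upwards [h.ae_of_ae hfg] with y hy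
  rcases hy with hy | hy
  · simp [hy]
  · simp [hy]

theorem WComp.integrable (h : WComp π κ μ ρ C) (f : Lp ℂ 1 μ) :
    Integrable (fun y => κ y * f (π y)) ρ := by
  have hf : Measurable f := (Lp.stronglyMeasurable f).measurable
  refine ⟨(h.measurable_weight.mul (hf.comp h.measurable_map)).aestronglyMeasurable, ?_⟩
  have hb := h.bound (fun x => ‖f x‖ₑ) hf.enorm
  rw [hasFiniteIntegral_iff_enorm]
  simp only [enorm_mul]
  refine hb.trans_lt ?_
  rw [← enorm_L1]
  exact ENNReal.mul_lt_top ENNReal.coe_lt_top enorm_lt_top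

/-- The operator `f ↦ κ · (f ∘ π)`. -/
def wcomp (h : WComp π κ μ ρ C) : Lp ℂ 1 μ →L[ℂ] Lp ℂ 1 ρ :=
  LinearMap.mkContinuous
    { toFun := fun f => (h.integrable f).toL1 _
      map_add' := fun f g => by
        rw [← Integrable.toL1_add, Integrable.toL1_eq_toL1_iff]
        filter_upwards [h.ae_congr (Lp.coeFn_add f g)] with y hy
        simp only [Pi.add_apply] at hy ⊢
        rw [hy, mul_add]
      map_smul' := fun c f => by
        rw [RingHom.id_apply, ← Integrable.toL1_smul, Integrable.toL1_eq_toL1_iff]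
        filter_upwards [h.ae_congr (Lp.coeFn_smul c f)] with y hy
        simp only [Pi.smul_apply, smul_eq_mul] at hy ⊢
        rw [hy]
        ring }
    C fun f => by
      refine norm_le_of_enorm_le ?_
      simp only [LinearMap.coe_mk, AddHom.coe_mk]
      rw [Integrable.enorm_toL1, enorm_L1]
      simp only [enorm_mul]
      exact h.bound (fun x => ‖f x‖ₑ) (Lp.stronglyMeasurable f).measurable.enorm

theorem wcomp_coe (h : WComp π κ μ ρ C) (f : Lp ℂ 1 μ) :
    wcomp h f =ᵐ[ρ] fun y => κ y * f (π y) :=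
  Integrable.coeFn_toL1 (h.integrable f)

theorem norm_wcomp_le (h : WComp π κ μ ρ C) : ‖wcomp h‖ ≤ C :=
  LinearMap.mkContinuous_norm_le _ C.2 _

/-- Multiplication by a bounded measurable function. -/
theorem WComp.mul {m : α → ℂ} (hm : Measurable m) (hC : ∀ᵐ x ∂μ, ‖m x‖ ≤ C) :
    WComp id m μ μ C where
  measurable_map := measurable_id
  measurable_weight := hm
  bound F hF := by
    rw [← lintegral_const_mul _ hF]
    refine lintegral_mono_ae ?_
    filter_upwards [hC] with x hx
    gcongr
    · rw [enorm_eq_nnnorm]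
      exact_mod_cast hx
    · rfl

/-- The product structure is carried as an equation because `phase a`, a restricted volume, equals a
product measure only propositionally. -/
theorem integrable_of_prod_eq {σ : Measure α} {P : Measure (β × α)} (hP : P = ρ.prod σ)
    {φ : β × α → ℂ} (h : Integrable φ P) : Integrable φ (ρ.prod σ) := hP ▸ h

variable [SFinite ρ]

theorem ae_snd_of_prod_eq {σ : Measure α} [SFinite σ] {P : Measure (β × α)} (hP : P = ρ.prod σ)
    {p : β × α → Prop} (h : ∀ᵐ z ∂P, p z) : ∀ᵐ z ∂σ, ∀ᵐ a ∂ρ, p (a, z) := by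
  subst hP
  exact Measure.ae_ae_of_ae_prod
    (Measure.measurePreserving_swap.quasiMeasurePreserving.ae h : ∀ᵐ z ∂(σ.prod ρ), p z.swap)

theorem integrable_proj {σ : Measure α} [SFinite σ] {P : Measure (β × α)} (hP : P = ρ.prod σ)
    (f : Lp ℂ 1 P) : Integrable (fun z => ∫ a, f (a, z) ∂ρ) σ := by
  exact (integrable_of_prod_eq hP (L1.integrable_coeFn f)).integral_prod_right

/-- Integration over the first variable. -/
def proj {σ : Measure α} [SFinite σ] {P : Measure (β × α)} (hP : P = ρ.prod σ) :
    Lp ℂ 1 P →L[ℂ] Lp ℂ 1 σ :=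
  LinearMap.mkContinuous
    { toFun := fun f => (integrable_proj hP f).toL1 _
      map_add' := fun f g => by
        rw [← Integrable.toL1_add, Integrable.toL1_eq_toL1_iff]
        have hf := integrable_of_prod_eq hP (L1.integrable_coeFn f)
        have hg := integrable_of_prod_eq hP (L1.integrable_coeFn g)
        have h2 := ae_snd_of_prod_eq hP (Lp.coeFn_add f g)
        filter_upwards [h2, hf.prod_left_ae, hg.prod_left_ae] with z h2 hf hg
        rw [Pi.add_apply, ← integral_add hf hg]
        exact integral_congr_ae h2
      map_smul' := fun c f => by
        rw [RingHom.id_apply, ← Integrable.toL1_smul, Integrable.toL1_eq_toL1_iff]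
        have h2 := ae_snd_of_prod_eq hP (Lp.coeFn_smul c f)
        filter_upwards [h2] with z h2
        rw [← integral_smul]
        exact integral_congr_ae h2 }
    1 fun f => by
      refine norm_le_of_enorm_le (C := 1) ?_
      simp only [LinearMap.coe_mk, AddHom.coe_mk]
      rw [Integrable.enorm_toL1, enorm_L1, ENNReal.coe_one, one_mul]
      have hf := (Lp.stronglyMeasurable f).measurable.enorm
      calc ∫⁻ z, ‖∫ a, f (a, z) ∂ρ‖ₑ ∂σ ≤ ∫⁻ z, ∫⁻ a, ‖f (a, z)‖ₑ ∂ρ ∂σ :=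
            lintegral_mono fun z => enorm_integral_le_lintegral_enorm _
        _ = ∫⁻ x, ‖f x‖ₑ ∂P := by
            generalize hφ : (fun x => ‖f x‖ₑ) = φ at hf
            simp only [funext_iff] at hφ
            simp only [hφ, hP]
            rw [lintegral_prod_symm _ hf.aemeasurable]

theorem proj_coe {σ : Measure α} [SFinite σ] {P : Measure (β × α)} (hP : P = ρ.prod σ)
    (f : Lp ℂ 1 P) : proj hP f =ᵐ[σ] fun z => ∫ a, f (a, z) ∂ρ :=
  Integrable.coeFn_toL1 (integrable_proj hP f)

/-- Dominated convergence in `L¹`. -/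
theorem tendsto_L1_of_dominated {ι : Type*} {l : Filter ι} [l.IsCountablyGenerated]
    {f : ι → Lp ℂ 1 μ} {f₀ : Lp ℂ 1 μ} (φ : ι → α → ℂ) (φ₀ : α → ℂ)
    (hf : ∀ i, f i =ᵐ[μ] φ i) (hf₀ : f₀ =ᵐ[μ] φ₀) (B : α → ℝ) (hB : Integrable B μ)
    (hbound : ∀ᶠ i in l, ∀ᵐ x ∂μ, ‖φ i x‖ ≤ B x)
    (hlim : ∀ᵐ x ∂μ, Tendsto (fun i => φ i x) l (𝓝 (φ₀ x))) :
    Tendsto f l (𝓝 f₀) := by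
  rw [tendsto_iff_norm_sub_tendsto_zero]
  have h1 : ∀ i, ‖f i - f₀‖ = ∫ x, ‖φ i x - φ₀ x‖ ∂μ := fun i => by
    rw [norm_L1]
    refine integral_congr_ae ?_
    filter_upwards [Lp.coeFn_sub (f i) f₀, hf i, hf₀] with x h1 h2 h3
    rw [h1, Pi.sub_apply, h2, h3]
  simp only [h1]
  have hi₀ : Integrable φ₀ μ := (L1.integrable_coeFn f₀).congr hf₀
  have h0 : ∫ x, (0 : ℝ) ∂μ = 0 := by simp
  rw [← h0]
  refine tendsto_integral_filter_of_dominated_convergence (fun x => B x + ‖φ₀ x‖) ?_ ?_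
    (hB.add hi₀.norm) ?_
  · refine Eventually.of_forall fun i => ?_
    exact (((L1.integrable_coeFn (f i)).congr (hf i)).sub hi₀).norm.aestronglyMeasurable
  · filter_upwards [hbound] with i hi
    filter_upwards [hi] with x hx
    rw [norm_norm]
    exact (norm_sub_le _ _).trans (by gcongr)
  · filter_upwards [hlim] with x hx
    exact tendsto_iff_norm_sub_tendsto_zero.1 hx

end Builders


/-! ### A calculus of derivatives where each one costs a weight `J` and a power of ω. -/

section Graded

set_option linter.unusedSectionVars false

variable {Y Y' : Type*} [NormedAddCommGroup Y] [NormedSpace ℂ Y] [NormedSpace ℝ Y]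
  [IsScalarTower ℝ ℂ Y] [NormedAddCommGroup Y'] [NormedSpace ℂ Y'] [NormedSpace ℝ Y']
  [IsScalarTower ℝ ℂ Y'] {ι : Type*}

theorem tendsto_apply_of_bounded {τ : Type*} {l : Filter τ} {T : τ → Y →L[ℂ] Y'} {ξ : τ → Y}
    {x : Y} {y : Y'} {C : ℝ} (hb : ∀ᶠ t in l, ‖T t‖ ≤ C)
    (hT : Tendsto (fun t => T t x) l (𝓝 y)) (hξ : Tendsto ξ l (𝓝 x)) :
    Tendsto (fun t => T t (ξ t)) l (𝓝 y) := by
  have h1 : Tendsto (fun t => T t (ξ t - x)) l (𝓝 0) := by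
    have h2 : Tendsto (fun t => C * ‖ξ t - x‖) l (𝓝 0) := by
      simpa using (tendsto_iff_norm_sub_tendsto_zero.1 hξ).const_mul C
    refine squeeze_zero_norm' ?_ h2
    filter_upwards [hb] with t ht
    exact (T t).le_of_opNorm_le ht _
  simpa using h1.add hT

/-- A product rule for families that are differentiable only strongly, not in norm. Split `T t (ζ t)
= T t (ζ t - ζ s) + T t (ζ s)`: for the first term local boundedness absorbs the remainder of `ζ`,
and strong continuity is needed at the single vector `ζ'`; the second term is a hypothesis at the
single vector `ζ s`. -/
theorem hasDerivAt_apply_of_bounded {T : ℝ → Y →L[ℂ] Y'} {ζ : ℝ → Y} {ζ' : Y} {d : Y'} {s C : ℝ}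
    (hb : ∀ᶠ t in 𝓝 s, ‖T t‖ ≤ C) (hc : ContinuousAt (fun t => T t ζ') s)
    (hζ : HasDerivAt ζ ζ' s) (hT : HasDerivAt (fun t => T t (ζ s)) d s) :
    HasDerivAt (fun t => T t (ζ t)) (T s ζ' + d) s := by
  have key : HasDerivAt (fun t => T t (ζ t - ζ s)) (T s ζ') s := by
    rw [hasDerivAt_iff_isLittleO] at hζ ⊢
    have e : ∀ t, T t (ζ t - ζ s) - T s (ζ s - ζ s) - (t - s) • T s ζ' =
        T t (ζ t - ζ s - (t - s) • ζ') + (t - s) • (T t ζ' - T s ζ') := fun t => by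
      rw [map_sub (T t) (ζ t - ζ s), (T t).map_smul_of_tower]
      simp only [sub_self, map_zero, smul_sub, sub_zero]
      abel
    simp only [e]
    refine Asymptotics.IsLittleO.add ?_ ?_
    · refine Asymptotics.IsBigO.trans_isLittleO ?_ hζ
      refine Asymptotics.IsBigO.of_bound C ?_
      filter_upwards [hb] with t ht
      exact (T t).le_of_opNorm_le ht _
    · have h0 : Tendsto (fun t => T t ζ' - T s ζ') (𝓝 s) (𝓝 0) := by
        simpa using hc.tendsto.sub_const (T s ζ')
      simpa using (Asymptotics.isBigO_refl (fun t => t - s) (𝓝 s)).smul_isLittleO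
        ((Asymptotics.isLittleO_one_iff ℝ).2 h0)
  refine (key.add hT).congr_of_eventuallyEq (Eventually.of_forall fun t => ?_)
  simp

/-- The weight `max (1, s⁻²)`. -/
def omega (s : ℝ) : ℝ := max 1 (s ^ 2)⁻¹

theorem one_le_omega (s : ℝ) : 1 ≤ omega s := le_max_left _ _

theorem omega_pos (s : ℝ) : 0 < omega s := zero_lt_one.trans_le (one_le_omega s)

theorem continuousAt_omega {s : ℝ} (hs : s ≠ 0) : ContinuousAt omega s := by
  unfold omega
  fun_prop (disch := positivity)

theorem eventually_omega_le {s : ℝ} (hs : s ≠ 0) : ∀ᶠ t in 𝓝 s, omega t ≤ omega s + 1 :=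
  ((continuousAt_omega hs).eventually (gt_mem_nhds (lt_add_one (omega s)))).mono fun _ h => h.le

variable (J : Y →L[ℂ] Y) (J' : Y' →L[ℂ] Y') (N : ι → ℝ)

/-- A family of continuous functions on `s ≠ 0`, bounded by multiples of `ω(s)^q N`. -/
def OmegaBounded (q : ℕ) (ξ : ι → ℝ → Y) : Prop :=
  (∀ i, ContinuousOn (ξ i) {0}ᶜ) ∧
    ∃ C : ℝ, 0 ≤ C ∧ ∀ i s, s ≠ 0 → ‖ξ i s‖ ≤ C * omega s ^ q * N i

/-- The family `ξ` is continuous and, if `n > 0`, `J ξ` is differentiable with a derivative that has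
the same property with `n - 1` in place of `n`; each derivative costs a power of `ω`. -/
def Graded : ℕ → ℕ → (ι → ℝ → Y) → Prop
  | 0, q, ξ => OmegaBounded N q ξ
  | n + 1, q, ξ => OmegaBounded N q ξ ∧ ∃ η, Graded n (q + 1) η ∧
      ∀ i s, s ≠ 0 → HasDerivAt (fun t => J (ξ i t)) (η i s) s

variable {J J' N}

theorem OmegaBounded.mono (hN : ∀ i, 0 ≤ N i) {q q' : ℕ} (hq : q ≤ q') {ξ : ι → ℝ → Y}
    (h : OmegaBounded N q ξ) : OmegaBounded N q' ξ := by
  obtain ⟨h1, C, hC, h2⟩ := h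
  refine ⟨h1, C, hC, fun i s hs => (h2 i s hs).trans ?_⟩
  have := one_le_omega s
  have := hN i
  gcongr

theorem Graded.mono (hN : ∀ i, 0 ≤ N i) {n q q' : ℕ} (hq : q ≤ q') {ξ : ι → ℝ → Y}
    (h : Graded J N n q ξ) : Graded J N n q' ξ := by
  induction n generalizing q q' ξ with
  | zero => exact OmegaBounded.mono hN hq h
  | succ n ih =>
    obtain ⟨h1, η, h2, h3⟩ := h
    exact ⟨h1.mono hN hq, η, ih (by omega) h2, h3⟩

theorem Graded.pred {n q : ℕ} {ξ : ι → ℝ → Y}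
    (h : Graded J N (n + 1) q ξ) : Graded J N n q ξ := by
  induction n generalizing q ξ with
  | zero => exact h.1
  | succ n ih =>
    obtain ⟨h1, η, h2, h3⟩ := h
    exact ⟨h1, η, ih h2, h3⟩

theorem OmegaBounded.add {q : ℕ} {ξ η : ι → ℝ → Y} (h : OmegaBounded N q ξ)
    (h' : OmegaBounded N q η) : OmegaBounded N q (fun i s => ξ i s + η i s) := by
  obtain ⟨h1, C, hC, h2⟩ := h
  obtain ⟨h1', C', hC', h2'⟩ := h'
  refine ⟨fun i => (h1 i).add (h1' i), C + C', by positivity, fun i s hs => ?_⟩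
  calc _ ≤ ‖ξ i s‖ + ‖η i s‖ := norm_add_le _ _
    _ ≤ C * omega s ^ q * N i + C' * omega s ^ q * N i := add_le_add (h2 i s hs) (h2' i s hs)
    _ = _ := by ring

theorem Graded.add {n q : ℕ} {ξ η : ι → ℝ → Y} (h : Graded J N n q ξ)
    (h' : Graded J N n q η) : Graded J N n q (fun i s => ξ i s + η i s) := by
  induction n generalizing q ξ η with
  | zero => exact OmegaBounded.add h h'
  | succ n ih =>
    obtain ⟨h1, ξ', h2, h3⟩ := h
    obtain ⟨h1', η', h2', h3'⟩ := h'
    refine ⟨h1.add h1', _, ih h2 h2', fun i s hs => ?_⟩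
    simp only [map_add]
    exact (h3 i s hs).add (h3' i s hs)

theorem OmegaBounded.apply {p q : ℕ} {ξ : ι → ℝ → Y}
    (h : OmegaBounded N q ξ) {T : ℝ → Y →L[ℂ] Y'} {C : ℝ}
    (hb : ∀ s, s ≠ 0 → ‖T s‖ ≤ C * omega s ^ p)
    (hT : ∀ x s, s ≠ 0 → ContinuousAt (fun t => T t x) s) :
    OmegaBounded N (q + p) (fun i s => T s (ξ i s)) := by
  obtain ⟨h1, D, hD, h2⟩ := h
  have hC : 0 ≤ C := by
    have := (norm_nonneg (T 1)).trans (hb 1 one_ne_zero)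
    exact nonneg_of_mul_nonneg_left this (pow_pos (omega_pos 1) p)
  refine ⟨fun i s hs => ?_, C * D, by positivity, fun i s hs => ?_⟩
  · have hs' : s ≠ 0 := hs
    refine ContinuousAt.continuousWithinAt ?_
    refine tendsto_apply_of_bounded (C := C * (omega s + 1) ^ p) ?_ (hT (ξ i s) s hs') ?_
    · filter_upwards [eventually_omega_le hs', isOpen_ne.mem_nhds hs'] with t ht ht0
      refine (hb t ht0).trans ?_
      have := (omega_pos t).le
      gcongr
    · exact ((h1 i).continuousAt (isOpen_ne.mem_nhds hs')).tendsto
  · calc ‖T s (ξ i s)‖ ≤ ‖T s‖ * ‖ξ i s‖ := (T s).le_opNorm _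
      _ ≤ (C * omega s ^ p) * (D * omega s ^ q * N i) := by
        gcongr
        · exact (norm_nonneg _).trans (hb s hs)
        · exact hb s hs
        · exact h2 i s hs
      _ = _ := by ring

/-- Each differentiation moves `J` past `L (m + 1)` and turns it into `L m`; so a stock of `n ≤ m`
levels suffices for `n` derivatives. -/
theorem Graded.level {K : ℕ} {L : ℕ → Y →L[ℂ] Y'}
    (hL : ∀ m, m < K → J'.comp (L (m + 1)) = (L m).comp J) {n m q : ℕ} (hnm : n ≤ m) (hmK : m ≤ K)
    {ξ : ι → ℝ → Y} (h : Graded J N n q ξ) : Graded J' N n q (fun i s => L m (ξ i s)) := by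
  induction n generalizing m q ξ with
  | zero =>
    refine OmegaBounded.apply (p := 0) h (T := fun _ => L m) (C := ‖L m‖) ?_ ?_
    · simp
    · exact fun _ _ _ => continuousAt_const
  | succ n ih =>
    obtain ⟨h1, η, h2, h3⟩ := h
    obtain ⟨m, rfl⟩ : ∃ m', m = m' + 1 := ⟨m - 1, by omega⟩
    refine ⟨?_, _, ih (m := m) (by omega) (by omega) h2, fun i s hs => ?_⟩
    · refine OmegaBounded.apply (p := 0) h1 (T := fun _ => L (m + 1)) (C := ‖L (m + 1)‖) ?_ ?_
      · simp
      · exact fun _ _ _ => continuousAt_const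
    · have e : (fun t => J' (L (m + 1) (ξ i t))) = fun t => L m (J (ξ i t)) := by
        ext t
        exact DFunLike.congr_fun (hL m (by omega)) _
      rw [e]
      have := hasDerivAt_apply_of_bounded (T := fun _ => L m) (C := ‖L m‖) (d := 0)
        (Eventually.of_forall fun _ => le_rfl) continuousAt_const (h3 i s hs)
        (hasDerivAt_const _ _)
      simpa using this

theorem Graded.map {L : Y →L[ℂ] Y'} (hL : J'.comp L = L.comp J) {n q : ℕ}
    {ξ : ι → ℝ → Y} (h : Graded J N n q ξ) : Graded J' N n q (fun i s => L (ξ i s)) :=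
  Graded.level (K := n) (L := fun _ => L) (fun _ _ => hL) le_rfl le_rfl h

/-- A bounded strongly continuous family commuting with `J` such that `J M` is strongly
differentiable with derivative `B M`. -/
structure StrongFamily (J : Y →L[ℂ] Y) (M : ℝ → Y →L[ℂ] Y) (B : Y →L[ℂ] Y) : Prop where
  norm_le : ∀ s, ‖M s‖ ≤ 1
  continuous : ∀ x, Continuous fun s => M s x
  comm : ∀ s, J.comp (M s) = (M s).comp J
  comm' : J.comp B = B.comp J
  hasDerivAt : ∀ x s, HasDerivAt (fun t => J (M t x)) (B (M s x)) s

/-- If `J ξ` has derivative `η`, then `J M ξ = M J ξ` has derivative `M η + B M ξ`. No power of ω is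
lost, since `M` and `B` are bounded; the second term even has a power to spare. -/
theorem Graded.strongFamily (hN : ∀ i, 0 ≤ N i) {M : ℝ → Y →L[ℂ] Y} {B : Y →L[ℂ] Y}
    (hM : StrongFamily J M B) {n q : ℕ} {ξ : ι → ℝ → Y} (h : Graded J N n q ξ) :
    Graded J N n q (fun i s => M s (ξ i s)) := by
  have base : ∀ {q} {ξ : ι → ℝ → Y}, OmegaBounded N q ξ →
      OmegaBounded N q (fun i s => M s (ξ i s)) := fun h =>
    OmegaBounded.apply (p := 0) h (C := 1) (fun s _ => by simpa using hM.norm_le s)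
      fun x s _ => (hM.continuous x).continuousAt
  induction n generalizing q ξ with
  | zero => exact base h
  | succ n ih =>
    have hp := h.pred
    obtain ⟨h1, η, h2, h3⟩ := h
    refine ⟨base h1, _, (ih h2).add (((ih hp).map hM.comm').mono hN (Nat.le_succ q)),
      fun i s hs => ?_⟩
    have e : ∀ x t, J (M t x) = M t (J x) := fun x t => DFunLike.congr_fun (hM.comm t) x
    simp only [e]
    refine hasDerivAt_apply_of_bounded (Eventually.of_forall hM.norm_le)
      (hM.continuous _).continuousAt (h3 i s hs) ?_
    simp only [← e]
    exact hM.hasDerivAt _ _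

/-- The inverses of `1 - H m ∘ M s`, with a bound. -/
structure ResolventFamily (J : Y →L[ℂ] Y) (K : ℕ) (H : ℕ → Y →L[ℂ] Y) (M : ℝ → Y →L[ℂ] Y)
    (R : ℕ → ℝ → Y →L[ℂ] Y) (C : ℝ) : Prop where
  norm_le : ∀ m s, m ≤ K → s ≠ 0 → ‖R m s‖ ≤ C * omega s
  comm : ∀ m s, m < K → s ≠ 0 → J.comp (R (m + 1) s) = (R m s).comp J
  left_inv : ∀ m s x, m ≤ K → s ≠ 0 → R m s (x - H m (M s x)) = x
  right_inv : ∀ m s x, m ≤ K → s ≠ 0 → R m s x - H m (M s (R m s x)) = x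

/-- The second resolvent identity, R(t) = R(s) + R(t) H (M(t) - M(s)) R(s), applied to a vector. It
transfers regularity in `s` from `M` to `R`. -/
theorem ResolventFamily.sub_eq {K : ℕ} {H : ℕ → Y →L[ℂ] Y} {M : ℝ → Y →L[ℂ] Y}
    {R : ℕ → ℝ → Y →L[ℂ] Y} {C : ℝ} (hR : ResolventFamily J K H M R C) {m : ℕ} (hm : m ≤ K)
    {s t : ℝ} (hs : s ≠ 0) (ht : t ≠ 0) (x : Y) :
    R m t x = R m s x + R m t (H m (M t (R m s x) - M s (R m s x))) := by
  have h1 := hR.left_inv m t (R m s x) hm ht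
  have h2 := hR.right_inv m s x hm hs
  calc R m t x = R m t ((R m s x - H m (M t (R m s x))) +
        H m (M t (R m s x) - M s (R m s x))) := by
        congr 1
        nth_rewrite 1 [← h2]
        rw [map_sub]
        abel
    _ = _ := by rw [map_add, h1]

theorem ResolventFamily.continuousAt {K : ℕ} {H : ℕ → Y →L[ℂ] Y} {M : ℝ → Y →L[ℂ] Y}
    {B : Y →L[ℂ] Y} (hM : StrongFamily J M B)
    {R : ℕ → ℝ → Y →L[ℂ] Y} {C : ℝ} (hR : ResolventFamily J K H M R C) {m : ℕ} (hm : m ≤ K)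
    {s : ℝ} (hs : s ≠ 0) (x : Y) : ContinuousAt (fun t => R m t x) s := by
  have hC : 0 ≤ C :=
    nonneg_of_mul_nonneg_left ((norm_nonneg _).trans (hR.norm_le m s hm hs)) (omega_pos s)
  have h1 : Tendsto (fun t => H m (M t (R m s x) - M s (R m s x))) (𝓝 s) (𝓝 0) := by
    have : Continuous fun t => H m (M t (R m s x) - M s (R m s x)) :=
      (H m).continuous.comp ((hM.continuous _).sub continuous_const)
    simpa using this.tendsto s
  have h2 : Tendsto (fun t => R m t (H m (M t (R m s x) - M s (R m s x)))) (𝓝 s) (𝓝 0) := by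
    refine tendsto_apply_of_bounded (C := C * (omega s + 1)) ?_ (by simp) h1
    filter_upwards [eventually_omega_le hs, isOpen_ne.mem_nhds hs] with t ht ht0
    exact (hR.norm_le m t hm ht0).trans (by gcongr)
  have h3 := h2.const_add (R m s x)
  rw [add_zero] at h3
  refine h3.congr' ?_
  filter_upwards [isOpen_ne.mem_nhds hs] with t ht
  exact (hR.sub_eq hm hs ht x).symm

/-- In the second resolvent identity `J` is pushed to the right, through `R (m + 1) t` and `H (m +
1)`, until it meets `M t - M s`. There it makes the difference quotient converge; on the way both
operators drop to level `m`. -/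
theorem ResolventFamily.hasDerivAt {K : ℕ} {H : ℕ → Y →L[ℂ] Y} {M : ℝ → Y →L[ℂ] Y}
    {B : Y →L[ℂ] Y} (hM : StrongFamily J M B)
    (hH : ∀ m, m < K → J.comp (H (m + 1)) = (H m).comp J)
    {R : ℕ → ℝ → Y →L[ℂ] Y} {C : ℝ} (hR : ResolventFamily J K H M R C) {m : ℕ} (hm : m < K)
    {s : ℝ} (hs : s ≠ 0) (x : Y) :
    HasDerivAt (fun t => J (R (m + 1) t x)) (R m s (H m (B (M s (R (m + 1) s x))))) s := by
  have hC : 0 ≤ C :=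
    nonneg_of_mul_nonneg_left ((norm_nonneg _).trans (hR.norm_le m s hm.le hs)) (omega_pos s)
  set y := R (m + 1) s x with hy
  have hζ : HasDerivAt (fun t => H m (J (M t y) - J (M s y))) (H m (B (M s y))) s := by
    have := hasDerivAt_apply_of_bounded (T := fun _ => H m) (C := ‖H m‖) (d := 0)
        (Eventually.of_forall fun _ => le_rfl) continuousAt_const
        ((hM.hasDerivAt y s).sub_const (J (M s y))) (hasDerivAt_const _ _)
    simpa using this
  have h2 := hasDerivAt_apply_of_bounded (T := fun t => R m t) (C := C * (omega s + 1)) (d := 0) ?_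
    (hR.continuousAt hM hm.le hs _) hζ ?_
  · rw [add_zero] at h2
    have h3 := h2.const_add (J y)
    refine h3.congr_of_eventuallyEq ?_
    filter_upwards [isOpen_ne.mem_nhds hs] with t ht
    have e1 : ∀ x, J (R (m + 1) t x) = R m t (J x) := fun x =>
      DFunLike.congr_fun (hR.comm m t hm ht) x
    have e2 : ∀ x, J (H (m + 1) x) = H m (J x) := fun x => DFunLike.congr_fun (hH m hm) x
    rw [hR.sub_eq hm hs ht x, map_add, e1, e2, ← hy, map_sub J]
  · filter_upwards [eventually_omega_le hs, isOpen_ne.mem_nhds hs] with t ht ht0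
    exact (hR.norm_le m t hm.le ht0).trans (by gcongr)
  · simpa using hasDerivAt_const s (0 : Y)

/-- The derivative of `J R (m + 1) ξ` is `R m η + R m H m B M R (m + 1) ξ`. Here `η` already carries
the exponent `q + 1`, and the second term contains two resolvents; both terms are therefore of
exponent `q + 2`, as `Graded` requires. -/
theorem Graded.resolvent (hN : ∀ i, 0 ≤ N i) {K : ℕ} {H : ℕ → Y →L[ℂ] Y} {M : ℝ → Y →L[ℂ] Y}
    {B : Y →L[ℂ] Y} (hM : StrongFamily J M B)
    (hH : ∀ m, m < K → J.comp (H (m + 1)) = (H m).comp J)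
    {R : ℕ → ℝ → Y →L[ℂ] Y} {C : ℝ} (hR : ResolventFamily J K H M R C) {n m q : ℕ} (hnm : n ≤ m)
    (hm : m ≤ K) {ξ : ι → ℝ → Y} (h : Graded J N n q ξ) :
    Graded J N n (q + 1) (fun i s => R m s (ξ i s)) := by
  have base : ∀ {m}, m ≤ K → ∀ {q} {ξ : ι → ℝ → Y}, OmegaBounded N q ξ →
      OmegaBounded N (q + 1) (fun i s => R m s (ξ i s)) := fun {m} hm {q} {ξ} h =>
    OmegaBounded.apply (p := 1) h (C := C)
      (fun s hs => by simpa using hR.norm_le m s hm hs)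
      fun x s hs => hR.continuousAt hM hm hs x
  induction n generalizing m q ξ with
  | zero => exact base hm h
  | succ n ih =>
    obtain ⟨m, rfl⟩ : ∃ m', m = m' + 1 := ⟨m - 1, by omega⟩
    have hp := h.pred
    obtain ⟨h1, η, h2, h3⟩ := h
    have g1 := (ih (m := m + 1) (by omega) hm hp).strongFamily hN hM
    have g2 := ih (m := m) (by omega) (by omega)
      ((g1.map hM.comm').level hH (m := m) (by omega) (by omega))
    refine ⟨base hm h1, _, (ih (m := m) (by omega) (by omega) h2).add g2, fun i s hs => ?_⟩
    have hm' : m < K := by omega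
    have e : ∀ᶠ t in 𝓝 s, J (R (m + 1) t (ξ i t)) = R m t (J (ξ i t)) := by
      filter_upwards [isOpen_ne.mem_nhds hs] with t ht
      exact DFunLike.congr_fun (hR.comm m t hm' ht) _
    refine HasDerivAt.congr_of_eventuallyEq ?_ e
    have hC : 0 ≤ C :=
      nonneg_of_mul_nonneg_left ((norm_nonneg _).trans (hR.norm_le m s hm'.le hs)) (omega_pos s)
    refine hasDerivAt_apply_of_bounded (C := C * (omega s + 1)) ?_
      (hR.continuousAt hM hm'.le hs _) (h3 i s hs) ?_
    · filter_upwards [eventually_omega_le hs, isOpen_ne.mem_nhds hs] with t ht ht0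
      exact (hR.norm_le m t hm'.le ht0).trans (by gcongr)
    · refine (hR.hasDerivAt hM hH hm' hs (ξ i s)).congr_of_eventuallyEq ?_
      filter_upwards [isOpen_ne.mem_nhds hs] with t ht
      exact (DFunLike.congr_fun (hR.comm m t hm' ht) _).symm

/-- Reading off honest derivatives: `J ^ n ξ` is differentiable `n` times, one factor `J` being used
up each time. The sequence `D` is built by prepending `J ^ (n + 1) ξ` to the sequence of the
derivative `η`. -/
theorem Graded.exists_derivs {n q : ℕ} {ξ : ι → ℝ → Y} (h : Graded J N n q ξ) :
    ∃ D : ℕ → ι → ℝ → Y, (D 0 = fun i s => (J ^ n) (ξ i s)) ∧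
      (∀ j, j < n → ∀ i s, s ≠ 0 → HasDerivAt (D j i) (D (j + 1) i s) s) ∧
      ∀ j, j ≤ n → OmegaBounded N (q + j) (D j) := by
  have bdd : ∀ {n q} {ξ : ι → ℝ → Y}, OmegaBounded N q ξ →
      OmegaBounded N q (fun i s => (J ^ n) (ξ i s)) := fun {n q ξ} h => by
    obtain ⟨h1, C, hC, h2⟩ := h
    refine ⟨fun i => (J ^ n).continuous.comp_continuousOn (h1 i), ‖J ^ n‖ * C, by positivity,
      fun i s hs => ((J ^ n).le_opNorm _).trans ?_⟩
    rw [mul_assoc, mul_assoc, ← mul_assoc C]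
    gcongr
    exact h2 i s hs
  induction n generalizing q ξ with
  | zero =>
    refine ⟨fun _ => ξ, by simp, by simp, fun j hj => ?_⟩
    obtain rfl : j = 0 := by omega
    exact h
  | succ n ih =>
    obtain ⟨h1, η, h2, h3⟩ := h
    obtain ⟨D, hD0, hD1, hD2⟩ := ih h2
    refine ⟨fun j => Nat.casesOn j (fun i s => (J ^ (n + 1)) (ξ i s)) D, rfl, fun j hj i s hs => ?_,
      fun j hj => ?_⟩
    · cases j with
      | zero =>
        simp only [hD0, pow_succ, mul_apply_eq_comp]
        have := hasDerivAt_apply_of_bounded (T := fun _ => J ^ n) (C := ‖J ^ n‖) (d := 0)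
          (Eventually.of_forall fun _ => le_rfl) continuousAt_const (h3 i s hs)
          (hasDerivAt_const _ _)
        simpa using this
      | succ j => exact hD1 j (by omega) i s hs
    · cases j with
      | zero => exact bdd h1
      | succ j =>
        have := hD2 j (by omega)
        rwa [show q + 1 + j = q + (j + 1) by ring] at this

theorem iteratedDeriv_eq_of_hasDerivAt {n : ℕ} {D : ℕ → ℝ → Y} {U : Set ℝ} (hU : IsOpen U)
    (hD : ∀ j, j < n → ∀ s ∈ U, HasDerivAt (D j) (D (j + 1) s) s) :
    ∀ j, j ≤ n → ∀ s ∈ U, iteratedDeriv j (D 0) s = D j s := by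
  intro j
  induction j with
  | zero => simp
  | succ j ih =>
    intro hj s hs
    rw [iteratedDeriv_succ]
    have : iteratedDeriv j (D 0) =ᶠ[𝓝 s] D j := by
      filter_upwards [hU.mem_nhds hs] with t ht
      exact ih (by omega) t ht
    rw [this.deriv_eq]
    exact (hD j (by omega) s hs).deriv

theorem contDiffOn_of_hasDerivAt {n : ℕ} {D : ℕ → ℝ → Y} {U : Set ℝ} (hU : IsOpen U)
    (hD : ∀ j, j < n → ∀ s ∈ U, HasDerivAt (D j) (D (j + 1) s) s)
    (hc : ContinuousOn (D n) U) : ContDiffOn ℝ n (D 0) U := by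
  induction n generalizing D with
  | zero => simpa using hc
  | succ n ih =>
    have h0 : ContDiffOn ℝ n (D 1) U :=
      ih (D := fun j => D (j + 1)) (fun j hj s hs => hD (j + 1) (by omega) s hs) hc
    push_cast
    rw [contDiffOn_succ_iff_deriv_of_isOpen hU]
    refine ⟨fun s hs => (hD 0 (by omega) s hs).differentiableAt.differentiableWithinAt, by simp,
      h0.congr fun s hs => (hD 0 (by omega) s hs).deriv⟩

end Graded


/-! ### Lower bounds for integrals of 1 - cos(s c/|w| + θ), uniform in the phase θ. -/

section Oscillation

/-- For `x ≤ 2` the Taylor bound is used at `x / 2`, within its range of validity: `|sin x| ≤ 2 sin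
(x / 2) ≤ x - x ^ 3 / 40`, which is the origin of 40. For `x ≥ 2` the trivial bound `|sin x| ≤ 1` is
enough. -/
theorem mul_min_le_sub_abs_sin {x : ℝ} (hx : 0 ≤ x) :
    x / 40 * min 1 (x ^ 2) ≤ x - |Real.sin x| := by
  have key : ∀ y : ℝ, 0 ≤ y → y ≤ 1 → Real.sin y ≤ y - y ^ 3 / 10 := fun y h0 h1 => by
    have h := (abs_le.1 (Real.sin_bound (x := y) (by rwa [abs_of_nonneg h0]))).2
    rw [abs_of_nonneg h0] at h
    have : y ^ 5 ≤ y ^ 3 := pow_le_pow_of_le_one h0 h1 (by norm_num)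
    have : 0 ≤ y ^ 3 := by positivity
    linarith
  rcases le_total x 2 with h2 | h2
  · have h := key (x / 2) (by linarith) (by linarith)
    have hs : 0 ≤ Real.sin (x / 2) :=
      Real.sin_nonneg_of_nonneg_of_le_pi (by linarith) (by linarith [Real.pi_gt_three])
    have e : |Real.sin x| ≤ 2 * Real.sin (x / 2) := by
      have : Real.sin x = 2 * Real.sin (x / 2) * Real.cos (x / 2) := by
        rw [← Real.sin_two_mul]; congr 1; ring
      rw [this, abs_mul, abs_of_nonneg (by linarith : 0 ≤ 2 * Real.sin (x / 2))]
      exact mul_le_of_le_one_right (by linarith) (Real.abs_cos_le_one _)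
    have : x / 40 * min 1 (x ^ 2) ≤ x / 40 * x ^ 2 := by gcongr; exact min_le_right _ _
    nlinarith
  · have : x / 40 * min 1 (x ^ 2) ≤ x / 40 * 1 := by gcongr; exact min_le_left _ _
    have := Real.abs_sin_le_one x
    linarith

theorem min_mul_min_le {a b : ℝ} (ha : 0 ≤ a) (hb : 0 ≤ b) :
    min 1 a * min 1 b ≤ min 1 (a * b) := by
  refine le_min ?_ ?_
  · exact mul_le_one₀ (min_le_left _ _) (le_min zero_le_one hb) (min_le_left _ _)
  · exact mul_le_mul (min_le_right _ _) (min_le_right _ _) (le_min zero_le_one hb) ha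

/-- Integration gives at least `L - 2 |sin x| / |s|` with `x = |s| L / 2`, wherever the interval
lies and whatever the phase is; this equals `(2 / |s|) (x - |sin x|)`. -/
theorem le_integral_one_sub_cos {L : ℝ} (hL : 0 < L) (s θ y : ℝ) :
    L / 40 * min 1 (L ^ 2 / 4) * min 1 (s ^ 2) ≤
      ∫ t in y..(y + L), (1 - Real.cos (s * t + θ)) := by
  rcases eq_or_ne s 0 with rfl | hs
  · have h0 : (0 : ℝ) ≤ ∫ t in y..(y + L), (1 - Real.cos (0 * t + θ)) :=
      intervalIntegral.integral_nonneg (by linarith)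
        fun t _ => sub_nonneg.2 (Real.cos_le_one _)
    simpa using h0
  have e : ∫ t in y..(y + L), (1 - Real.cos (s * t + θ)) =
      L - (Real.sin (s * (y + L) + θ) - Real.sin (s * y + θ)) / s := by
    have hd : ∀ t ∈ uIcc y (y + L), HasDerivAt (fun t => t - Real.sin (s * t + θ) / s)
        (1 - Real.cos (s * t + θ)) t := fun t _ => by
      have h1 : HasDerivAt (fun t => s * t + θ) s t := by
        simpa using ((hasDerivAt_id t).const_mul s).add_const θ
      have h2 := (h1.sin.div_const s)
      refine ((hasDerivAt_id' t).sub h2).congr_deriv ?_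
      field_simp
    rw [intervalIntegral.integral_eq_sub_of_hasDerivAt hd
      (Continuous.intervalIntegrable (by fun_prop) _ _)]
    ring
  rw [e]
  have hs' : 0 < |s| := abs_pos.2 hs
  set x := |s| * L / 2 with hx
  have hx0 : 0 ≤ x := by positivity
  have hsin : |Real.sin (s * (y + L) + θ) - Real.sin (s * y + θ)| ≤ 2 * |Real.sin x| := by
    rw [Real.sin_sub_sin, abs_mul, abs_mul, abs_two]
    have e1 : (s * (y + L) + θ - (s * y + θ)) / 2 = s * L / 2 := by ring
    have e2 : |Real.sin (s * L / 2)| = |Real.sin x| := by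
      rcases abs_choice s with h | h
      · rw [hx, h]
      · rw [hx, h, show -s * L / 2 = -(s * L / 2) by ring, Real.sin_neg, abs_neg]
    rw [e1, e2]
    exact mul_le_of_le_one_right (by positivity) (Real.abs_cos_le_one _)
  have h1 : (Real.sin (s * (y + L) + θ) - Real.sin (s * y + θ)) / s ≤ 2 * |Real.sin x| / |s| := by
    refine (le_abs_self _).trans ?_
    rw [abs_div]
    gcongr
  have h2 := mul_min_le_sub_abs_sin hx0
  have h3 : L - 2 * |Real.sin x| / |s| = 2 / |s| * (x - |Real.sin x|) := by
    rw [hx]; field_simp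
  have h4 : min 1 (L ^ 2 / 4) * min 1 (s ^ 2) ≤ min 1 (x ^ 2) := by
    refine (min_mul_min_le (by positivity) (by positivity)).trans_eq ?_
    congr 1
    rw [hx, div_pow, mul_pow, sq_abs]
    ring
  calc L / 40 * min 1 (L ^ 2 / 4) * min 1 (s ^ 2)
      ≤ L / 40 * min 1 (x ^ 2) := by rw [mul_assoc]; gcongr
    _ = 2 / |s| * (x / 40 * min 1 (x ^ 2)) := by rw [hx]; field_simp
    _ ≤ 2 / |s| * (x - |Real.sin x|) := by gcongr
    _ = L - 2 * |Real.sin x| / |s| := h3.symm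
    _ ≤ _ := by linarith

/-- Substitute `t = c / w`. The left half of the interval is discarded to stay away from `w = 0`,
where the substitution is singular. `κ` must not depend on `α`, because the interval will follow the
kernel. -/
theorem exists_le_integral_one_sub_cos_inv {ℓ c : ℝ} (hℓ : 0 < ℓ) (hc : 0 < c) :
    ∃ κ : ℝ, 0 < κ ∧ ∀ α, 0 ≤ α → α + ℓ ≤ 1 → ∀ s θ : ℝ,
      κ * min 1 (s ^ 2) ≤ ∫ w in α..(α + ℓ), (1 - Real.cos (s * (c / |w|) + θ)) := by
  set L := c * (ℓ / 2) with hL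
  have hL0 : 0 < L := by positivity
  refine ⟨ℓ ^ 2 / 4 / c * (L / 40 * min 1 (L ^ 2 / 4)), by positivity, fun α hα hα1 s θ => ?_⟩
  set α' := α + ℓ / 2 with hα'
  set β := α + ℓ with hβ
  have hα'0 : 0 < α' := by positivity
  have hα'β : α' ≤ β := by linarith
  have hmeas : Measurable fun w : ℝ => 1 - Real.cos (s * (c / |w|) + θ) := by fun_prop
  have hnn : ∀ w : ℝ, 0 ≤ 1 - Real.cos (s * (c / |w|) + θ) :=
    fun w => sub_nonneg.2 (Real.cos_le_one _)
  have hint : ∀ x y : ℝ, IntervalIntegrable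
      (fun w : ℝ => 1 - Real.cos (s * (c / |w|) + θ)) volume x y := fun x y => by
    refine (intervalIntegrable_const (c := (2 : ℝ))).mono_fun hmeas.aestronglyMeasurable
      (Eventually.of_forall fun w => ?_)
    simp only [Real.norm_of_nonneg (hnn w), Real.norm_ofNat]
    linarith [Real.neg_one_le_cos (s * (c / |w|) + θ)]
  have hpos : ∀ w ∈ uIcc α' β, 0 < w := fun w hw => by
    rw [uIcc_of_le hα'β] at hw; exact hα'0.trans_le hw.1
  have hd : ∀ w ∈ uIcc α' β, HasDerivAt (fun w : ℝ => c / w) (-c / w ^ 2) w := fun w hw => by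
    have := (hasDerivAt_inv (hpos w hw).ne').const_mul c
    refine (this.congr_deriv ?_).congr_of_eventuallyEq (Eventually.of_forall fun w => ?_)
    · ring
    · exact div_eq_mul_inv _ _
  have hcd : ContinuousOn (fun w : ℝ => -c / w ^ 2) (uIcc α' β) :=
    continuousOn_const.div (by fun_prop) fun w hw => (pow_pos (hpos w hw) 2).ne'
  have hsub := intervalIntegral.integral_comp_mul_deriv (g := fun t => 1 - Real.cos (s * t + θ))
    hd hcd (by fun_prop)
  have hcont : ContinuousOn (fun w : ℝ => (1 - Real.cos (s * (c / w) + θ)) * (c / w ^ 2))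
      (uIcc α' β) := by
    have hne : ∀ w ∈ uIcc α' β, w ≠ 0 := fun w hw => (hpos w hw).ne'
    have h1 : ContinuousOn (fun w : ℝ => c / w) (uIcc α' β) :=
      continuousOn_const.div continuousOn_id hne
    have h2 : ContinuousOn (fun w : ℝ => c / w ^ 2) (uIcc α' β) :=
      continuousOn_const.div (by fun_prop) fun w hw => (pow_pos (hpos w hw) 2).ne'
    refine ContinuousOn.mul ?_ h2
    exact continuousOn_const.sub (Real.continuous_cos.comp_continuousOn
      ((continuousOn_const.mul h1).add continuousOn_const))
  -- On the remaining half `w ≥ ℓ / 2`, so the Jacobian `c / w ^ 2` is at most `4 c / ℓ ^ 2`.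
  have hlow : ℓ ^ 2 / 4 / c * ∫ w in α'..β, (1 - Real.cos (s * (c / w) + θ)) * (c / w ^ 2) ≤
      ∫ w in α'..β, (1 - Real.cos (s * (c / |w|) + θ)) := by
    rw [← intervalIntegral.integral_const_mul]
    refine intervalIntegral.integral_mono_on hα'β (hcont.intervalIntegrable.const_mul _)
      (hint _ _) fun w hw => ?_
    have hw0 : 0 < w := hα'0.trans_le hw.1
    have := hnn w
    rw [abs_of_pos hw0] at this ⊢
    have h1 : ℓ ^ 2 / 4 / c * (c / w ^ 2) ≤ 1 := by
      have : ℓ ^ 2 / 4 / c * (c / w ^ 2) = (ℓ / 2) ^ 2 / w ^ 2 := by field_simp; ring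
      rw [this]
      refine div_le_one_of_le₀ ?_ (by positivity)
      have : ℓ / 2 ≤ w := by linarith [hw.1]
      gcongr
    calc _ = (1 - Real.cos (s * (c / w) + θ)) * (ℓ ^ 2 / 4 / c * (c / w ^ 2)) := by ring
      _ ≤ _ := mul_le_of_le_one_right this h1
  -- The image of the half interval has length at least `L`, as `α' β ≤ 1`.
  have hL1 : c / β + L ≤ c / α' := by
    have hβ0 : 0 < β := hα'0.trans_le hα'β
    have h1 : c / α' - c / β = c * (ℓ / 2) / (α' * β) := by
      have : ℓ / 2 = β - α' := by rw [hβ, hα']; ring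
      rw [this]; field_simp
    have h2 : c * (ℓ / 2) ≤ c * (ℓ / 2) / (α' * β) := by
      refine le_div_self (by positivity) (by positivity) ?_
      exact mul_le_one₀ (by linarith) hβ0.le hα1
    linarith
  have hmid : L / 40 * min 1 (L ^ 2 / 4) * min 1 (s ^ 2) ≤
      ∫ w in α'..β, (1 - Real.cos (s * (c / w) + θ)) * (c / w ^ 2) := by
    have e : ∫ w in α'..β, (1 - Real.cos (s * (c / w) + θ)) * (c / w ^ 2) =
        ∫ t in (c / β)..(c / α'), (1 - Real.cos (s * t + θ)) := by
      rw [intervalIntegral.integral_symm (c / α') (c / β), ← hsub,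
        ← intervalIntegral.integral_neg]
      refine intervalIntegral.integral_congr fun w _ => ?_
      simp only [Function.comp]
      ring
    rw [e]
    refine (le_integral_one_sub_cos hL0 s θ (c / β)).trans ?_
    refine intervalIntegral.integral_mono_interval le_rfl (by linarith) hL1
      (Eventually.of_forall fun t => sub_nonneg.2 (Real.cos_le_one _))
      (Continuous.intervalIntegrable (by fun_prop) _ _)
  calc ℓ ^ 2 / 4 / c * (L / 40 * min 1 (L ^ 2 / 4)) * min 1 (s ^ 2)
      = ℓ ^ 2 / 4 / c * (L / 40 * min 1 (L ^ 2 / 4) * min 1 (s ^ 2)) := by ring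
    _ ≤ ℓ ^ 2 / 4 / c * ∫ w in α'..β, (1 - Real.cos (s * (c / w) + θ)) * (c / w ^ 2) := by gcongr
    _ ≤ _ := hlow
    _ ≤ _ := intervalIntegral.integral_mono_interval (by linarith) hα'β le_rfl
      (Eventually.of_forall hnn) (hint _ _)

theorem exists_le_integral_one_sub_cos_inv_abs {p : ℝ} (hp : p = 0 ∨ p = -1) {ℓ c : ℝ}
    (hℓ : 0 < ℓ) (hc : 0 < c) :
    ∃ κ : ℝ, 0 < κ ∧ ∀ α, p ≤ α → α + ℓ ≤ p + 1 → ∀ s θ : ℝ,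
      κ * min 1 (s ^ 2) ≤ ∫ w in α..(α + ℓ), (1 - Real.cos (s * (c / |w|) + θ)) := by
  obtain ⟨κ, hκ, h⟩ := exists_le_integral_one_sub_cos_inv hℓ hc
  refine ⟨κ, hκ, fun α h1 h2 s θ => ?_⟩
  rcases hp with rfl | rfl
  · exact h α h1 (by linarith) s θ
  · refine (h (-(α + ℓ)) (by linarith) (by linarith) s θ).trans_eq ?_
    have := intervalIntegral.integral_comp_neg (a := α) (b := α + ℓ)
      (f := fun w => 1 - Real.cos (s * (c / |w|) + θ))
    simp only [abs_neg] at this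
    rw [this]
    congr 1
    ring

end Oscillation


/-! ### Contraction by two stochastic kernels separated by an oscillating factor. -/

section Kernels

/-- A bounded, uniformly continuous, nonnegative kernel whose columns are probability densities. -/
structure StochKernel (ν : Measure ℝ) (k : ℝ → ℝ → ℝ) : Prop where
  uniformContinuous : UniformContinuous (Function.uncurry k)
  bounded : ∃ B, ∀ v w, k v w ≤ B
  nonneg : ∀ v w, 0 ≤ k v w
  mass : ∀ w, ∫ v, k v w ∂ν = 1

variable {μ ν ρ : Measure ℝ} {k ka kb : ℝ → ℝ → ℝ}

theorem StochKernel.continuous (h : StochKernel ν k) : Continuous (Function.uncurry k) :=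
  h.uniformContinuous.continuous

theorem StochKernel.exists_near (h : StochKernel ν k) :
    ∃ δ > 0, ∀ v w v' w', |v' - v| < δ → |w' - w| < δ → 1 ≤ k v w → 1 / 2 ≤ k v' w' := by
  obtain ⟨δ, hδ, H⟩ := Metric.uniformContinuous_iff.1 h.uniformContinuous (1 / 2) (by norm_num)
  refine ⟨δ, hδ, fun v w v' w' h1 h2 h3 => ?_⟩
  have := H (a := (v', w')) (b := (v, w)) (by
    rw [Prod.dist_eq, max_lt_iff]
    exact ⟨by rwa [Real.dist_eq], by rwa [Real.dist_eq]⟩)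
  rw [Real.dist_eq] at this
  have := (abs_lt.1 this).1
  simp only [Function.uncurry] at this
  linarith

/-- The damped phase factor `exp (-z c / |w|)`. -/
def phaseFactor (c : ℝ) (z : ℂ) (w : ℝ) : ℂ := Complex.exp (-(z * ((c / |w| : ℝ) : ℂ)))

theorem norm_phaseFactor_le {c : ℝ} (hc : 0 ≤ c) {z : ℂ} (hz : 0 ≤ z.re) (w : ℝ) :
    ‖phaseFactor c z w‖ ≤ 1 := by
  rw [phaseFactor, Complex.norm_exp]
  simp only [Complex.neg_re, Complex.mul_re, Complex.ofReal_re, Complex.ofReal_im, mul_zero,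
    sub_zero]
  exact Real.exp_le_one_iff.2 (neg_nonpos.2 (by positivity))

theorem measurable_phaseFactor (c : ℝ) (z : ℂ) : Measurable (phaseFactor c z) := by
  unfold phaseFactor
  fun_prop

/-- The real part is `r cos` with `0 ≤ r ≤ 1`: damping cannot undo the gain from oscillation, up to
the factor 1/2. Hence the final estimate depends on `z.im` only. -/
theorem half_one_sub_cos_le {c : ℝ} (hc : 0 ≤ c) {z : ℂ} (hz : 0 ≤ z.re) (w θ : ℝ) :
    (1 - Real.cos (z.im * (c / |w|) + θ)) / 2 ≤
      1 - (Complex.exp (-(θ * Complex.I)) * phaseFactor c z w).re := by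
  have e : (Complex.exp (-(θ * Complex.I)) * phaseFactor c z w).re =
      Real.exp (-(z.re * (c / |w|))) * Real.cos (z.im * (c / |w|) + θ) := by
    rw [phaseFactor, ← Complex.exp_add, Complex.exp_re]
    simp only [Complex.add_re, Complex.neg_re, Complex.mul_re, Complex.ofReal_re, Complex.I_re,
      mul_zero, Complex.ofReal_im, Complex.I_im, mul_one, sub_self, neg_zero, sub_zero, zero_add,
      Complex.add_im, Complex.neg_im, Complex.mul_im, add_zero]
    congr 1
    rw [← Real.cos_neg]
    congr 1
    ring
  rw [e]
  set r := Real.exp (-(z.re * (c / |w|)))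
  have hr0 : 0 ≤ r := (Real.exp_pos _).le
  have hr1 : r ≤ 1 := Real.exp_le_one_iff.2 (neg_nonpos.2 (by positivity))
  set y := Real.cos (z.im * (c / |w|) + θ)
  have h1 : y ≤ 1 := Real.cos_le_one _
  have h2 : -1 ≤ y := Real.neg_one_le_cos _
  rcases le_total y 0 with h | h
  · nlinarith
  · nlinarith

theorem exists_subinterval {p : ℝ} {w : ℝ} (hw : w ∈ Ioo p (p + 1)) {d : ℝ} (hd0 : 0 ≤ d)
    (hd : d ≤ 1 / 2) :
    ∃ α, p ≤ α ∧ α + d ≤ p + 1 ∧ ∀ x ∈ Icc α (α + d), |x - w| ≤ d := by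
  rcases le_total w (p + 1 / 2) with h | h
  · refine ⟨w, hw.1.le, by linarith, fun x hx => ?_⟩
    rw [abs_le]; constructor <;> linarith [hx.1, hx.2]
  · refine ⟨w - d, by linarith, by linarith [hw.2], fun x hx => ?_⟩
    rw [abs_le]; constructor <;> linarith [hx.1, hx.2]

instance isProbabilityMeasure_unit (p : ℝ) :
    IsProbabilityMeasure (volume.restrict (Ioo p (p + 1))) :=
  ⟨by simp⟩

/-- A function of mean 1 on an interval of length 1 takes a value at least 1. With uniform
continuity this gives a lower bound for the kernel on an interval whose length does not depend on
the column. -/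
theorem StochKernel.exists_one_le {q : ℝ} (h : StochKernel (volume.restrict (Ioo q (q + 1))) k)
    (w : ℝ) : ∃ v ∈ Ioo q (q + 1), 1 ≤ k v w := by
  have hi : Integrable (fun v => k v w) (volume.restrict (Ioo q (q + 1))) := by
    by_contra hn
    have := h.mass w
    rw [integral_undef hn] at this
    norm_num at this
  obtain ⟨x, hx, hx1⟩ := exists_notMem_null_integral_le (N := (Ioo q (q + 1))ᶜ) hi
    (by rw [Measure.restrict_apply measurableSet_Ioo.compl]; simp)
  exact ⟨x, by simpa using hx, by rwa [h.mass] at hx1⟩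

theorem integrable_of_norm_le {α : Type*} [MeasurableSpace α] {μ : Measure α} [IsFiniteMeasure μ]
    {E : Type*} [NormedAddCommGroup E] {f : α → E} (hf : AEStronglyMeasurable f μ) {B : ℝ}
    (hB : ∀ x, ‖f x‖ ≤ B) : Integrable f μ :=
  (integrable_const B).mono' hf (Eventually.of_forall hB)

theorem setIntegral_le_of_nonneg {μ : Measure ℝ} {f g : ℝ → ℝ} (hf : Integrable f μ) {s : Set ℝ}
    (hs : MeasurableSet s) (h0 : ∀ x, 0 ≤ f x) (hg : IntegrableOn g s μ)
    (hgf : ∀ x ∈ s, g x ≤ f x) : ∫ x in s, g x ∂μ ≤ ∫ x, f x ∂μ :=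
  (setIntegral_mono_on hg hf.integrableOn hs hgf).trans
    (setIntegral_le_integral hf (Eventually.of_forall h0))

theorem restrict_restrict_Ioc {p α d : ℝ} (h1 : p ≤ α) (h2 : α + d ≤ p + 1) :
    (volume.restrict (Ioo p (p + 1))).restrict (Ioc α (α + d)) =
      volume.restrict (Ioc α (α + d)) := by
  rw [Measure.restrict_restrict measurableSet_Ioc, ← Measure.restrict_congr_set
    (Ioo_ae_eq_Ioc (μ := volume) (a := α) (b := α + d))]
  refine Measure.restrict_congr_set ?_
  have h3 : (Ioc α (α + d) ∩ Ioo p (p + 1) : Set ℝ) =ᵐ[volume]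
      (Ioo α (α + d) ∩ Ioo p (p + 1) : Set ℝ) :=
    ae_eq_set_inter Ioo_ae_eq_Ioc.symm (ae_eq_refl (Ioo p (p + 1)))
  rw [inter_eq_left.2 (Ioo_subset_Ioo h1 h2)] at h3
  exact h3

/-- Without the phase factor the integral would be 1. The loss is made visible on a small rectangle
of pairs `(v, w)` on which both kernels are at least 1/2. Its position depends on `x`, but its side
`d` does not, and the oscillation bound is uniform in the position. -/
theorem exists_contraction_const {p q : ℝ} (hp : p = 0 ∨ p = -1)
    (ha : StochKernel (volume.restrict (Ioo q (q + 1))) ka)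
    (hb : StochKernel (volume.restrict (Ioo p (p + 1))) kb) {c : ℝ} (hc : 0 < c) :
    ∃ κ : ℝ, 0 < κ ∧ ∀ z : ℂ, 0 ≤ z.re → ∀ x : ℝ,
      ∫ v in Ioo q (q + 1), ‖∫ w in Ioo p (p + 1), (ka v w : ℂ) * phaseFactor c z w * kb w x‖ ≤
        1 - κ * min 1 (z.im ^ 2) := by
  obtain ⟨δa, hδa, Ha⟩ := ha.exists_near
  obtain ⟨δb, hδb, Hb⟩ := hb.exists_near
  obtain ⟨Ba, hBa⟩ := ha.bounded
  obtain ⟨Bb, hBb⟩ := hb.bounded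
  have hca := ha.continuous
  have hcb := hb.continuous
  -- `d` is smaller than both radii of continuity, and at most 1/2 so that an interval of length `d`
  -- fits into the unit interval on one side of any point.
  set d := min (1 / 2) (min (δa / 2) (δb / 2)) with hd
  have hd0 : 0 < d := by positivity
  have hd1 : d ≤ 1 / 2 := min_le_left _ _
  have hda : d < δa := ((min_le_right _ _).trans (min_le_left _ _)).trans_lt (by linarith)
  have hdb : d < δb := ((min_le_right _ _).trans (min_le_right _ _)).trans_lt (by linarith)
  obtain ⟨κ, hκ, Hκ⟩ := exists_le_integral_one_sub_cos_inv_abs hp hd0 hc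
  refine ⟨d * (κ / 8), by positivity, fun z hz x => ?_⟩
  obtain ⟨w₀, hw₀, hw₀1⟩ := hb.exists_one_le x
  obtain ⟨α, hα1, hα2, hα⟩ := exists_subinterval hw₀ hd0.le hd1
  -- The column of `ka` is chosen at `α`, an end of the interval just found, so that `ka` stays
  -- large for every `w` in that interval.
  obtain ⟨v₀, hv₀, hv₀1⟩ := ha.exists_one_le α
  obtain ⟨γ, hγ1, hγ2, hγ⟩ := exists_subinterval hv₀ hd0.le hd1
  set μ := volume.restrict (Ioo p (p + 1)) with hμ
  set ν := volume.restrict (Ioo q (q + 1)) with hν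
  set P : ℝ → ℝ → ℝ := fun v w => ka v w * kb w x with hP
  have hPc : Continuous (Function.uncurry P) := by
    have h1 : Continuous fun y : ℝ × ℝ => kb y.2 x :=
      hcb.comp (continuous_snd.prodMk continuous_const)
    exact hca.mul h1
  have hP0 : ∀ v w, 0 ≤ P v w := fun v w => mul_nonneg (ha.nonneg v w) (hb.nonneg w x)
  have hPB : ∀ v w, P v w ≤ Ba * Bb := fun v w =>
    mul_le_mul (hBa v w) (hBb w x) (hb.nonneg w x) ((ha.nonneg v w).trans (hBa v w))
  have hPv : ∀ v, Continuous (P v) := fun v => hPc.comp (Continuous.prodMk_right v)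
  have hPi : ∀ v, Integrable (P v) μ := fun v =>
    integrable_of_norm_le (hPv v).aestronglyMeasurable (B := Ba * Bb) fun w => by
      rw [Real.norm_of_nonneg (hP0 v w)]; exact hPB v w
  set Q : ℝ → ℝ := fun v => ∫ w, P v w ∂μ with hQ
  have hPprod : Integrable (Function.uncurry P) (ν.prod μ) :=
    integrable_of_norm_le hPc.aestronglyMeasurable (B := Ba * Bb) fun y => by
      rw [Function.uncurry, Real.norm_of_nonneg (hP0 _ _)]; exact hPB _ _
  have hQi : Integrable Q ν := hPprod.integral_prod_left
  have hQ1 : ∫ v, Q v ∂ν = 1 := by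
    rw [hQ, integral_integral_swap hPprod]
    simp only [hP, integral_mul_const, ha.mass, one_mul]
    exact hb.mass x
  set I : ℝ → ℂ := fun v => ∫ w, (ka v w : ℂ) * phaseFactor c z w * kb w x ∂μ with hI
  have hIm : Measurable fun y : ℝ × ℝ => (ka y.1 y.2 : ℂ) * phaseFactor c z y.2 * kb y.2 x := by
    have h1 : Measurable fun y : ℝ × ℝ => ka y.1 y.2 := hca.measurable
    have h2 : Measurable fun y : ℝ × ℝ => kb y.2 x :=
      hcb.measurable.comp (measurable_snd.prodMk measurable_const)
    have h3 : Measurable fun y : ℝ × ℝ => phaseFactor c z y.2 :=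
      (measurable_phaseFactor c z).comp measurable_snd
    exact ((Complex.measurable_ofReal.comp h1).mul h3).mul (Complex.measurable_ofReal.comp h2)
  have hIB : ∀ v w, ‖(ka v w : ℂ) * phaseFactor c z w * kb w x‖ ≤ Ba * Bb := fun v w => by
    refine le_trans ?_ (hPB v w)
    rw [norm_mul, norm_mul, Complex.norm_real, Complex.norm_real,
      Real.norm_of_nonneg (ha.nonneg _ _), Real.norm_of_nonneg (hb.nonneg _ _)]
    have h1 := ha.nonneg v w
    have h2 := hb.nonneg w x
    exact mul_le_mul_of_nonneg_right
      (mul_le_of_le_one_right h1 (norm_phaseFactor_le hc.le hz w)) h2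
  have hIi : ∀ v, Integrable (fun w => (ka v w : ℂ) * phaseFactor c z w * kb w x) μ := fun v =>
    integrable_of_norm_le (hIm.comp measurable_prodMk_left).aestronglyMeasurable (hIB v)
  have hIn : Integrable I ν :=
    (integrable_of_norm_le (μ := ν.prod μ) hIm.aestronglyMeasurable
      fun y => hIB y.1 y.2).integral_prod_left
  have hfac : ∀ θ : ℝ,
      Measurable fun w => (Complex.exp (-(θ * Complex.I)) * phaseFactor c z w).re := fun θ =>
    Complex.measurable_re.comp (measurable_const.mul (measurable_phaseFactor c z))
  have hfac1 : ∀ θ w : ℝ, |(Complex.exp (-(θ * Complex.I)) * phaseFactor c z w).re| ≤ 1 :=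
    fun θ w => by
      refine (Complex.abs_re_le_norm _).trans ?_
      rw [norm_mul, ← neg_mul, ← Complex.ofReal_neg, Complex.norm_exp_ofReal_mul_I, one_mul]
      exact norm_phaseFactor_le hc.le hz w
  have hPfac : ∀ v θ : ℝ, Integrable
      (fun w => P v w * (Complex.exp (-(θ * Complex.I)) * phaseFactor c z w).re) μ := fun v θ =>
    (hPi v).mul_bdd (c := 1) (hfac θ).aestronglyMeasurable (Eventually.of_forall (hfac1 θ))
  -- The modulus of `I v` is its product with `exp (-i arg (I v))`. This rotation depends on `v` but
  -- not on `w`, so it can be taken under the integral over `w` and plays the part of the phase θ.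
  have hIre : ∀ v, Q v - ‖I v‖ = ∫ w, P v w * (1 -
      (Complex.exp (-((I v).arg * Complex.I)) * phaseFactor c z w).re) ∂μ := fun v => by
    have e1 : (‖I v‖ : ℂ) = ∫ w, Complex.exp (-((I v).arg * Complex.I)) *
        ((ka v w : ℂ) * phaseFactor c z w * kb w x) ∂μ := by
      rw [integral_const_mul]
      change (‖I v‖ : ℂ) = Complex.exp (-((I v).arg * Complex.I)) * I v
      nth_rewrite 3 [← Complex.norm_mul_exp_arg_mul_I (I v)]
      rw [mul_left_comm, ← Complex.exp_add]
      simp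
    have e2 : ‖I v‖ = ∫ w, P v w *
        (Complex.exp (-((I v).arg * Complex.I)) * phaseFactor c z w).re ∂μ := by
      have := congrArg Complex.re e1
      rw [Complex.ofReal_re, ← RCLike.re_eq_complex_re, ← integral_re ((hIi v).const_mul _)] at this
      rw [this]
      refine integral_congr_ae (Eventually.of_forall fun w => ?_)
      simp only [hP, RCLike.re_eq_complex_re]
      rw [← Complex.re_ofReal_mul]
      congr 1
      push_cast
      ring
    rw [e2, hQ, ← integral_sub (hPi v)]
    · refine integral_congr_ae (Eventually.of_forall fun w => ?_)
      simp only
      ring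
    · exact hPfac v _
  have hfac0 : ∀ θ w : ℝ, 0 ≤ 1 - (Complex.exp (-(θ * Complex.I)) * phaseFactor c z w).re :=
    fun θ w => le_trans (by linarith [Real.cos_le_one (z.im * (c / |w|) + θ)])
      (half_one_sub_cos_le hc.le hz w θ)
  have hle : ∀ v, ‖I v‖ ≤ Q v := fun v => by
    rw [← sub_nonneg, hIre]
    exact integral_nonneg fun w => mul_nonneg (hP0 v w) (hfac0 _ _)
  have hgood : ∀ v ∈ Ioc γ (γ + d), κ / 8 * min 1 (z.im ^ 2) ≤ Q v - ‖I v‖ := fun v hv => by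
    rw [hIre]
    have hlow : ∫ w in Ioc α (α + d), 1 / 8 * (1 - Real.cos (z.im * (c / |w|) + (I v).arg)) ∂μ ≤
        ∫ w, P v w * (1 -
          (Complex.exp (-((I v).arg * Complex.I)) * phaseFactor c z w).re) ∂μ := by
      refine setIntegral_le_of_nonneg ?_ measurableSet_Ioc
        (fun w => mul_nonneg (hP0 v w) (hfac0 _ _)) ?_ fun w hw => ?_
      · simp only [mul_sub, mul_one]
        exact (hPi v).sub (hPfac v _)
      · refine Integrable.integrableOn (integrable_of_norm_le (B := 1) ?_ fun w => ?_)
        · exact (by fun_prop : Measurable fun w : ℝ =>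
            1 / 8 * (1 - Real.cos (z.im * (c / |w|) + (I v).arg))).aestronglyMeasurable
        · rw [Real.norm_eq_abs, abs_le]
          have h1 := Real.cos_le_one (z.im * (c / |w|) + (I v).arg)
          have h2 := Real.neg_one_le_cos (z.im * (c / |w|) + (I v).arg)
          constructor <;> linarith
      · have hw' : w ∈ Icc α (α + d) := ⟨hw.1.le, hw.2⟩
        have hv' : v ∈ Icc γ (γ + d) := ⟨hv.1.le, hv.2⟩
        have h1 : 1 / 2 ≤ kb w x := Hb w₀ x w x ((hα w hw').trans_lt hdb) (by simpa) hw₀1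
        have h2 : 1 / 2 ≤ ka v w := by
          refine Ha v₀ α v w ((hγ v hv').trans_lt hda) ?_ hv₀1
          refine lt_of_le_of_lt ?_ hda
          rw [abs_le]; constructor <;> linarith [hw'.1, hw'.2]
        have h3 : 1 / 4 ≤ P v w := by
          simp only [hP]; nlinarith
        have h4 := half_one_sub_cos_le hc.le hz w (I v).arg
        have h5 := hfac0 (I v).arg w
        nlinarith
    refine le_trans ?_ hlow
    rw [hμ, restrict_restrict_Ioc hα1 hα2, integral_const_mul,
      ← intervalIntegral.integral_of_le (by linarith)]
    have := Hκ α hα1 hα2 z.im (I v).arg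
    linarith
  have hfin : ∫ v in Ioc γ (γ + d), κ / 8 * min 1 (z.im ^ 2) ∂ν ≤ ∫ v, (Q v - ‖I v‖) ∂ν :=
    setIntegral_le_of_nonneg (hQi.sub hIn.norm) measurableSet_Ioc
      (fun v => sub_nonneg.2 (hle v)) (integrable_const _) hgood
  rw [integral_sub hQi hIn.norm, hQ1, hν, restrict_restrict_Ioc hγ1 hγ2, setIntegral_const,
    measureReal_def, Real.volume_Ioc, add_sub_cancel_left, ENNReal.toReal_ofReal hd0.le,
    smul_eq_mul] at hfin
  linarith

end Kernels


/-! ### Multiplication operators: damping factors, truncated weights, division by weights. -/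

section Multipliers

set_option linter.unusedSectionVars false

variable {α β : Type*} [MeasurableSpace α] [MeasurableSpace β]

/-- The projection of `ℂ` onto the closed right half plane. -/
def rightHalf (z : ℂ) : ℂ := ⟨max z.re 0, z.im⟩

theorem rightHalf_of_nonneg {z : ℂ} (hz : 0 ≤ z.re) : rightHalf z = z := by
  simp [rightHalf, hz]

theorem rightHalf_re_nonneg (z : ℂ) : 0 ≤ (rightHalf z).re := le_max_right _ _

theorem continuous_rightHalf : Continuous rightHalf := by
  have : rightHalf = fun z : ℂ => ((max z.re 0 : ℝ) : ℂ) + z.im * Complex.I := by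
    ext z
    apply Complex.ext <;> simp [rightHalf]
  rw [this]
  fun_prop

/-- The damped oscillation `exp (-z |y| / |r|)`, with `z` in the closed right half plane. -/
def dampSymbol (y r : α → ℝ) (z : ℂ) (x : α) : ℂ :=
  Complex.exp (-(rightHalf z * ((|y x| / |r x| : ℝ) : ℂ)))

theorem norm_dampSymbol (y r : α → ℝ) (z : ℂ) (x : α) :
    ‖dampSymbol y r z x‖ = Real.exp (-((rightHalf z).re * (|y x| / |r x|))) := by
  rw [dampSymbol, Complex.norm_exp]
  simp only [Complex.neg_re, Complex.mul_re, Complex.ofReal_re, Complex.ofReal_im, mul_zero,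
    sub_zero]

theorem norm_dampSymbol_le (y r : α → ℝ) (z : ℂ) (x : α) : ‖dampSymbol y r z x‖ ≤ 1 := by
  rw [norm_dampSymbol]
  have := rightHalf_re_nonneg z
  exact Real.exp_le_one_iff.2 (neg_nonpos.2 (by positivity))

theorem measurable_dampSymbol {y r : α → ℝ} (hy : Measurable y) (hr : Measurable r) (z : ℂ) :
    Measurable (dampSymbol y r z) := by
  unfold dampSymbol
  fun_prop

theorem continuous_dampSymbol (y r : α → ℝ) (x : α) : Continuous fun z => dampSymbol y r z x := by
  have := continuous_rightHalf
  unfold dampSymbol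
  fun_prop

variable {μ : Measure α} {y r : α → ℝ} (hy : Measurable y) (hr : Measurable r)

variable (μ) in
theorem wcomp_dampSymbol (hy : Measurable y) (hr : Measurable r) (z : ℂ) :
    WComp id (dampSymbol y r z) μ μ 1 :=
  WComp.mul (measurable_dampSymbol hy hr z) (Eventually.of_forall (norm_dampSymbol_le y r z))

variable (μ) in
/-- Multiplication by `exp (-z |y| / |r|)`. -/
def damp (z : ℂ) : Lp ℂ 1 μ →L[ℂ] Lp ℂ 1 μ := wcomp (wcomp_dampSymbol μ hy hr z)

theorem damp_coe (z : ℂ) (f : Lp ℂ 1 μ) :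
    damp μ hy hr z f =ᵐ[μ] fun x => dampSymbol y r z x * f x := wcomp_coe _ _

theorem norm_damp_le (z : ℂ) : ‖damp μ hy hr z‖ ≤ 1 := norm_wcomp_le _

theorem continuous_damp (f : Lp ℂ 1 μ) : Continuous fun z => damp μ hy hr z f := by
  rw [continuous_iff_continuousAt]
  intro z
  refine tendsto_L1_of_dominated (fun z x => dampSymbol y r z x * f x) _
    (fun z => damp_coe hy hr z f) (damp_coe hy hr z f) (fun x => ‖f x‖)
    (L1.integrable_coeFn f).norm ?_ ?_
  · refine Eventually.of_forall fun z => Eventually.of_forall fun x => ?_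
    rw [norm_mul]
    exact mul_le_of_le_one_left (norm_nonneg _) (norm_dampSymbol_le y r z x)
  · exact Eventually.of_forall fun x =>
      ((continuous_dampSymbol y r x).mul continuous_const).tendsto z

variable (μ) in
theorem wcomp_min (hr : Measurable r) (Y : ℝ≥0) :
    WComp id (fun x => ((min |r x| Y : ℝ) : ℂ)) μ μ Y :=
  WComp.mul (by fun_prop) (Eventually.of_forall fun x => by
    rw [Complex.norm_real, Real.norm_of_nonneg (by positivity)]
    exact min_le_right _ _)

variable (μ) in
/-- Multiplication by `min |r| Y`. -/
def clip (Y : ℝ≥0) : Lp ℂ 1 μ →L[ℂ] Lp ℂ 1 μ := wcomp (wcomp_min μ hr Y)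

theorem clip_coe (Y : ℝ≥0) (f : Lp ℂ 1 μ) :
    clip μ hr Y f =ᵐ[μ] fun x => ((min |r x| Y : ℝ) : ℂ) * f x := wcomp_coe _ _

theorem wcomp_congr_apply {π : β → α} {κ : β → ℂ} {ρ : Measure β} {C : ℝ≥0}
    (h : WComp π κ μ ρ C) {f : Lp ℂ 1 μ} {φ : α → ℂ} (hφ : f =ᵐ[μ] φ) :
    wcomp h f =ᵐ[ρ] fun y => κ y * φ (π y) :=
  (wcomp_coe h f).trans (h.ae_congr hφ)

theorem wcomp_mul_comm {m m' : α → ℂ} {C C' : ℝ≥0} (h : WComp id m μ μ C)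
    (h' : WComp id m' μ μ C') : (wcomp h).comp (wcomp h') = (wcomp h').comp (wcomp h) := by
  ext1 f
  refine Lp.ext ?_
  simp only [ContinuousLinearMap.comp_apply]
  filter_upwards [wcomp_congr_apply h (wcomp_coe h' f), wcomp_congr_apply h' (wcomp_coe h f)]
    with x h1 h2
  rw [h1, h2]
  simp only [id]
  ring

/-- Intertwining of multiplication operators by a weighted composition. -/
theorem wcomp_intertwine {π : β → α} {κ : β → ℂ} {ρ : Measure β} {C D D' : ℝ≥0}
    (h : WComp π κ μ ρ C) {m : α → ℂ} {m' : β → ℂ} (hm : WComp id m μ μ D)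
    (hm' : WComp id m' ρ ρ D') (hmm : ∀ x, m' x = m (π x)) :
    (wcomp hm').comp (wcomp h) = (wcomp h).comp (wcomp hm) := by
  ext1 f
  refine Lp.ext ?_
  simp only [ContinuousLinearMap.comp_apply]
  filter_upwards [wcomp_congr_apply hm' (wcomp_coe h f), wcomp_congr_apply h (wcomp_coe hm f)]
    with x h1 h2
  rw [h1, h2, id, hmm]
  simp only [id]
  ring

theorem clip_comp_wcomp {π : β → α} {κ : β → ℂ} {ρ : Measure β} {C : ℝ≥0} (h : WComp π κ μ ρ C)
    {r' : β → ℝ} (hr' : Measurable r') (hrr : ∀ x, r' x = r (π x)) (Y : ℝ≥0) :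
    (clip ρ hr' Y).comp (wcomp h) = (wcomp h).comp (clip μ hr Y) :=
  wcomp_intertwine h (wcomp_min μ hr Y) (wcomp_min ρ hr' Y) fun x => by rw [hrr]

theorem damp_comp_wcomp {π : β → α} {κ : β → ℂ} {ρ : Measure β} {C : ℝ≥0} (h : WComp π κ μ ρ C)
    {y' r' : β → ℝ} (hy' : Measurable y') (hr' : Measurable r') (hyy : ∀ x, y' x = y (π x))
    (hrr : ∀ x, r' x = r (π x)) (z : ℂ) :
    (damp ρ hy' hr' z).comp (wcomp h) = (wcomp h).comp (damp μ hy hr z) :=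
  wcomp_intertwine h (wcomp_dampSymbol μ hy hr z) (wcomp_dampSymbol ρ hy' hr' z) fun x => by
    rw [dampSymbol, dampSymbol, hyy, hrr]

theorem clip_comp_damp (Y : ℝ≥0) (z : ℂ) :
    (clip μ hr Y).comp (damp μ hy hr z) = (damp μ hy hr z).comp (clip μ hr Y) :=
  wcomp_mul_comm (wcomp_min μ hr Y) (wcomp_dampSymbol μ hy hr z)

/-- The difference quotient of `exp (-is|y|/|r|)` is bounded only by `|y|/|r|`; multiplied by `|r|`
it is bounded by `|y| ≤ Y`, and dominated convergence applies. The derivative is then multiplication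
by `-i|y|` times the same exponential, so `B` is bounded. As `|r| ≤ 1` and `|y| ≤ Y` almost
everywhere, the truncations in `clip` have no effect. -/
theorem strongFamily_damp {Y : ℝ≥0} (hY : ∀ᵐ x ∂μ, |y x| ≤ Y)
    (hr1 : ∀ᵐ x ∂μ, 0 < |r x| ∧ |r x| ≤ 1) :
    StrongFamily (clip μ hr 1) (fun s : ℝ => damp μ hy hr (s * Complex.I))
      ((-Complex.I) • clip μ hy Y) where
  norm_le s := norm_damp_le hy hr _
  continuous x := (continuous_damp hy hr x).comp (by fun_prop)
  comm s := clip_comp_damp hy hr _ _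
  comm' := by
    rw [ContinuousLinearMap.comp_smul, ContinuousLinearMap.smul_comp]
    congr 1
    exact wcomp_mul_comm (wcomp_min μ hr 1) (wcomp_min μ hy Y)
  hasDerivAt f s := by
    have hcoe : ∀ t : ℝ, clip μ hr 1 (damp μ hy hr (t * Complex.I) f) =ᵐ[μ]
        fun x => ((min |r x| 1 : ℝ) : ℂ) *
          (Complex.exp (-(t * Complex.I * ((|y x| / |r x| : ℝ) : ℂ))) * f x) := fun t => by
      refine (wcomp_congr_apply _ (damp_coe hy hr (t * Complex.I) f)).trans
        (Eventually.of_forall fun x => ?_)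
      simp only [id, dampSymbol]
      rw [rightHalf_of_nonneg (by simp)]
      simp
    rw [hasDerivAt_iff_tendsto_slope]
    have hslope : ∀ t : ℝ, slope (fun t : ℝ => clip μ hr 1 (damp μ hy hr (t * Complex.I) f)) s t
        =ᵐ[μ] fun x => (((t - s)⁻¹ : ℝ) : ℂ) * (((min |r x| 1 : ℝ) : ℂ) *
          (Complex.exp (-(t * Complex.I * ((|y x| / |r x| : ℝ) : ℂ))) * f x) -
          ((min |r x| 1 : ℝ) : ℂ) *
          (Complex.exp (-(s * Complex.I * ((|y x| / |r x| : ℝ) : ℂ))) * f x)) := fun t => by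
      rw [slope_def_module]
      filter_upwards [Lp.coeFn_smul ((t - s)⁻¹) (clip μ hr 1 (damp μ hy hr (t * Complex.I) f) -
        clip μ hr 1 (damp μ hy hr (s * Complex.I) f)), Lp.coeFn_sub
        (clip μ hr 1 (damp μ hy hr (t * Complex.I) f))
        (clip μ hr 1 (damp μ hy hr (s * Complex.I) f)), hcoe t, hcoe s] with x h1 h2 h3 h4
      rw [h1, Pi.smul_apply, h2, Pi.sub_apply, h3, h4, Complex.real_smul]
    have hd : ((-Complex.I) • clip μ hy Y) (damp μ hy hr (s * Complex.I) f) =ᵐ[μ]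
        fun x => -Complex.I * (((min |y x| Y : ℝ) : ℂ) *
          (Complex.exp (-(s * Complex.I * ((|y x| / |r x| : ℝ) : ℂ))) * f x)) := by
      rw [smul_apply]
      filter_upwards [Lp.coeFn_smul (-Complex.I) (clip μ hy Y (damp μ hy hr (s * Complex.I) f)),
        wcomp_congr_apply (wcomp_min μ hy Y) (damp_coe hy hr (s * Complex.I) f)] with x h1 h2
      rw [h1, Pi.smul_apply, smul_eq_mul, clip, h2]
      simp only [id, dampSymbol]
      rw [rightHalf_of_nonneg (by simp)]
    refine tendsto_L1_of_dominated _ _ hslope hd (fun x => Y * ‖f x‖)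
      ((L1.integrable_coeFn f).norm.const_mul _) ?_ ?_
    · refine Eventually.of_forall fun t => ?_
      filter_upwards [hY, hr1] with x hYx hrx
      set q := |y x| / |r x| with hq
      have e : ((min |r x| 1 : ℝ) : ℂ) * (Complex.exp (-(t * Complex.I * (q : ℂ))) * f x) -
          ((min |r x| 1 : ℝ) : ℂ) * (Complex.exp (-(s * Complex.I * (q : ℂ))) * f x) =
          ((|r x| : ℝ) : ℂ) * ((Complex.exp (Complex.I * ((-((t - s) * q) : ℝ) : ℂ)) - 1) *
            (Complex.exp (((-(s * q) : ℝ) : ℂ) * Complex.I) * f x)) := by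
        rw [min_eq_left hrx.2, sub_mul, ← mul_assoc (Complex.exp _), ← Complex.exp_add]
        push_cast
        ring_nf
      rw [e, norm_mul, norm_mul, norm_mul, norm_mul, Complex.norm_exp_ofReal_mul_I, one_mul,
        Complex.norm_real, Complex.norm_real, norm_inv, Real.norm_eq_abs, Real.norm_eq_abs,
        abs_abs]
      have h1 := Real.norm_exp_I_mul_ofReal_sub_one_le (x := -((t - s) * q))
      rw [norm_neg, norm_mul, Real.norm_eq_abs, Real.norm_eq_abs] at h1
      have hq0 : 0 ≤ q := by positivity
      rw [abs_of_nonneg hq0] at h1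
      have hrq : |r x| * q = |y x| := by rw [hq]; field_simp [hrx.1.ne']
      calc _ ≤ |t - s|⁻¹ * (|r x| * (|t - s| * q * ‖f x‖)) := by gcongr
        _ = (|t - s|⁻¹ * |t - s|) * (|r x| * q) * ‖f x‖ := by ring
        _ ≤ 1 * Y * ‖f x‖ := by
          rw [hrq]
          gcongr
          exact inv_mul_le_one
        _ = _ := by rw [one_mul]
    · filter_upwards [hY, hr1] with x hYx hrx
      set q := |y x| / |r x| with hq
      have hE : HasDerivAt (fun t : ℝ => ((min |r x| 1 : ℝ) : ℂ) *
          (Complex.exp (-(t * Complex.I * (q : ℂ))) * f x))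
          (-Complex.I * (((min |y x| Y : ℝ) : ℂ) *
          (Complex.exp (-(s * Complex.I * (q : ℂ))) * f x))) s := by
        have h1 : HasDerivAt (fun t : ℝ => -((t : ℂ) * Complex.I * (q : ℂ)))
            (-(1 * Complex.I * (q : ℂ))) s :=
          (((hasDerivAt_id s).ofReal_comp.mul_const Complex.I).mul_const (q : ℂ)).neg
        refine ((h1.cexp.mul_const (f x)).const_mul _).congr_deriv ?_
        rw [min_eq_left hYx, min_eq_left hrx.2]
        have hrq : ((|y x| : ℝ) : ℂ) = ((|r x| : ℝ) : ℂ) * (q : ℂ) := by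
          rw [← Complex.ofReal_mul, hq]
          congr 1
          field_simp [hrx.1.ne']
        rw [hrq]
        ring
      have := hasDerivAt_iff_tendsto_slope.1 hE
      refine this.congr fun t => ?_
      rw [slope_def_module, Complex.real_smul]

theorem clip_injective {Y : ℝ≥0} (hY : 0 < Y) (hr0 : ∀ᵐ x ∂μ, 0 < |r x|) :
    Function.Injective (clip μ hr Y) := by
  intro f g hfg
  refine Lp.ext ?_
  filter_upwards [clip_coe hr Y f, clip_coe hr Y g, hr0] with x h1 h2 h3
  rw [hfg, h2] at h1
  have : ((min |r x| Y : ℝ) : ℂ) ≠ 0 := by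
    have : 0 < min |r x| Y := lt_min h3 (by exact_mod_cast hY)
    exact_mod_cast this.ne'
  exact (mul_left_cancel₀ this h1).symm

theorem clip_pow_coe (hr1 : ∀ᵐ x ∂μ, |r x| ≤ 1) (n : ℕ) (f : Lp ℂ 1 μ) :
    (clip μ hr 1 ^ n) f =ᵐ[μ] fun x => ((|r x| ^ n : ℝ) : ℂ) * f x := by
  induction n with
  | zero => simp
  | succ n ih =>
    rw [pow_succ', mul_apply_eq_comp]
    filter_upwards [clip_coe hr 1 ((clip μ hr 1 ^ n) f), ih, hr1] with x h1 h2 h3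
    rw [h1, h2, NNReal.coe_one, min_eq_left h3, pow_succ']
    push_cast
    ring

/-- An operator with values in the functions divisible by `|r|^n` factors through `clip ^ n`. -/
theorem exists_clip_pow_factor (hr1 : ∀ᵐ x ∂μ, 0 < |r x| ∧ |r x| ≤ 1) (n : ℕ)
    {E : Type*} [NormedAddCommGroup E] [NormedSpace ℂ E] (T : E →L[ℂ] Lp ℂ 1 μ) (C : ℝ≥0)
    (hT : ∀ e, ∫⁻ x, ENNReal.ofReal ((|r x| ^ n)⁻¹) * ‖T e x‖ₑ ∂μ ≤ C * ‖e‖ₑ) :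
    ∃ S : E →L[ℂ] Lp ℂ 1 μ, (clip μ hr 1 ^ n).comp S = T ∧ ‖S‖ ≤ C := by
  have hen : ∀ x e, ‖(((|r x| ^ n)⁻¹ : ℝ) : ℂ) * T e x‖ₑ =
      ENNReal.ofReal ((|r x| ^ n)⁻¹) * ‖T e x‖ₑ := fun x e => by
    rw [enorm_mul, ← ofReal_norm, Complex.norm_real, Real.norm_of_nonneg (by positivity)]
  have hi : ∀ e, Integrable (fun x => (((|r x| ^ n)⁻¹ : ℝ) : ℂ) * T e x) μ := fun e => by
    refine ⟨Measurable.aestronglyMeasurable ?_, ?_⟩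
    · have : Measurable (T e) := (Lp.stronglyMeasurable (T e)).measurable
      fun_prop
    · rw [hasFiniteIntegral_iff_enorm]
      simp only [hen]
      exact (hT e).trans_lt (ENNReal.mul_lt_top ENNReal.coe_lt_top enorm_lt_top)
  let S : E →L[ℂ] Lp ℂ 1 μ := LinearMap.mkContinuous
    { toFun := fun e => (hi e).toL1 _
      map_add' := fun e e' => by
        rw [← Integrable.toL1_add, Integrable.toL1_eq_toL1_iff, map_add]
        filter_upwards [Lp.coeFn_add (T e) (T e')] with x hx
        rw [hx, Pi.add_apply, Pi.add_apply, mul_add]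
      map_smul' := fun c e => by
        rw [RingHom.id_apply, ← Integrable.toL1_smul, Integrable.toL1_eq_toL1_iff, map_smul]
        filter_upwards [Lp.coeFn_smul c (T e)] with x hx
        rw [hx, Pi.smul_apply, smul_eq_mul, smul_eq_mul]
        ring }
    C fun e => by
      refine norm_le_of_enorm_le ?_
      simp only [LinearMap.coe_mk, AddHom.coe_mk]
      rw [Integrable.enorm_toL1]
      simp only [hen]
      exact hT e
  refine ⟨S, ?_, LinearMap.mkContinuous_norm_le _ C.2 _⟩
  ext1 e
  refine Lp.ext ?_
  rw [ContinuousLinearMap.comp_apply]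
  have hS : S e =ᵐ[μ] fun x => (((|r x| ^ n)⁻¹ : ℝ) : ℂ) * T e x := Integrable.coeFn_toL1 (hi e)
  filter_upwards [clip_pow_coe hr (hr1.mono fun _ h => h.2) n (S e), hS, hr1] with x h1 h2 h3
  rw [h1, h2, ← mul_assoc, ← Complex.ofReal_mul, mul_inv_cancel₀ (pow_pos h3.1 n).ne']
  simp

end Multipliers


/-! ### From stochastic operators to stochastic kernels, and norms of kernel operators. -/

section KernelOperators

theorem Icc_subset_of_ae_mem {p : ℝ} {S : Set ℝ} (hS : IsClosed S)
    (h : ∀ᵐ v ∂(volume.restrict (Ioo p (p + 1))), v ∈ S) : Icc p (p + 1) ⊆ S := by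
  have h1 : Ioo p (p + 1) ⊆ S := by
    intro x hx
    by_contra hxS
    have h2 : volume (Ioo p (p + 1) ∩ Sᶜ) = 0 := by
      rw [ae_restrict_iff' measurableSet_Ioo] at h
      refine measure_mono_null ?_ (ae_iff.1 h)
      rintro y ⟨hy1, hy2⟩ hy
      exact hy2 (hy hy1)
    exact (IsOpen.measure_pos volume (isOpen_Ioo.inter hS.isOpen_compl) ⟨x, hx, hxS⟩).ne' h2
  rw [← closure_Ioo (by linarith : p ≠ p + 1)]
  exact hS.closure_subset_iff.2 h1

variable {p q : ℝ}

/-- Lebesgue measure on the interval `(p, p + 1)`. -/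
abbrev unitVel (p : ℝ) : Measure ℝ := volume.restrict (Ioo p (p + 1))

/-- The extension of a kernel from a square, constant in the normal directions. -/
def clampKernel (p q : ℝ) (k : ℝ → ℝ → ℝ) (v w : ℝ) : ℝ :=
  k (projIcc q (q + 1) (by linarith) v) (projIcc p (p + 1) (by linarith) w)

theorem clampKernel_of_mem {k : ℝ → ℝ → ℝ} {v w : ℝ} (hv : v ∈ Icc q (q + 1))
    (hw : w ∈ Icc p (p + 1)) : clampKernel p q k v w = k v w := by
  simp [clampKernel, projIcc_of_mem _ hv, projIcc_of_mem _ hw]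

theorem clampKernel_proj (k : ℝ → ℝ → ℝ) (v w : ℝ) :
    clampKernel p q k (projIcc q (q + 1) (by linarith) v : ℝ)
      (projIcc p (p + 1) (by linarith) w : ℝ) = clampKernel p q k v w := by
  simp [clampKernel]

theorem uniformContinuous_clampKernel {k : ℝ → ℝ → ℝ}
    (hk : ContinuousOn (Function.uncurry k) (Icc q (q + 1) ×ˢ Icc p (p + 1))) :
    UniformContinuous (Function.uncurry (clampKernel p q k)) := by
  have h1 : Continuous fun y : Icc q (q + 1) × Icc p (p + 1) => k y.1 y.2 :=
    hk.comp_continuous (f := fun y : Icc q (q + 1) × Icc p (p + 1) => ((y.1 : ℝ), (y.2 : ℝ)))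
      (by fun_prop) fun y => ⟨y.1.2, y.2.2⟩
  have h2 := CompactSpace.uniformContinuous_of_continuous h1
  have h3 : UniformContinuous (Prod.map (projIcc q (q + 1) (by linarith))
      (projIcc p (p + 1) (by linarith))) :=
    (LipschitzWith.projIcc _).uniformContinuous.prodMap (LipschitzWith.projIcc _).uniformContinuous
  exact h2.comp h3

theorem exists_clampKernel_le {k : ℝ → ℝ → ℝ}
    (hk : ContinuousOn (Function.uncurry k) (Icc q (q + 1) ×ˢ Icc p (p + 1))) :
    ∃ B, ∀ v w, |clampKernel p q k v w| ≤ B := by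
  obtain ⟨B, hB⟩ := (isCompact_Icc.prod isCompact_Icc).exists_bound_of_continuousOn hk
  exact ⟨B, fun v w => hB (_, _) ⟨Subtype.coe_prop _, Subtype.coe_prop _⟩⟩

theorem hasKernel_clampKernel {K : Lp ℂ 1 (unitVel p) →L[ℂ] Lp ℂ 1 (unitVel q)} {k : ℝ → ℝ → ℝ}
    (hK : HasKernel K k) : HasKernel K (clampKernel p q k) := by
  intro f
  filter_upwards [hK f, ae_restrict_mem measurableSet_Ioo] with v hv hv'
  rw [hv]
  refine setIntegral_congr_fun measurableSet_Ioo fun w hw => ?_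
  rw [clampKernel_of_mem (Ioo_subset_Icc_self hv') (Ioo_subset_Icc_self hw)]

/-- Test the operator on indicators of sets `s`. Positivity makes the integrals of each row over `s`
nonnegative, hence the kernel; preservation of the norm gives the column masses the same integrals
over `s` as the constant 1. These facts hold almost everywhere at first and extend to all points by
continuity; clamping carries them outside the square. -/
theorem stochKernel_clampKernel {K : Lp ℂ 1 (unitVel p) →L[ℂ] Lp ℂ 1 (unitVel q)} {k : ℝ → ℝ → ℝ}
    (hS : IsStochastic K) (hK : HasKernel K k)
    (hk : ContinuousOn (Function.uncurry k) (Icc q (q + 1) ×ˢ Icc p (p + 1))) :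
    StochKernel (unitVel q) (clampKernel p q k) := by
  have huc := uniformContinuous_clampKernel hk
  obtain ⟨B, hB⟩ := exists_clampKernel_le hk
  have hK' := hasKernel_clampKernel hK
  set κ := clampKernel p q k with hκ
  have hc : Continuous (Function.uncurry κ) := huc.continuous
  have hcv : ∀ v, Continuous (κ v) := fun v => hc.comp (Continuous.prodMk_right v)
  have hcw : ∀ w, Continuous fun v => κ v w := fun w =>
    hc.comp (continuous_id.prodMk continuous_const)
  have hiv : ∀ v, Integrable (κ v) (unitVel p) := fun v =>
    integrable_of_norm_le (hcv v).aestronglyMeasurable (hB v)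
  have hiprod : Integrable (Function.uncurry κ) ((unitVel q).prod (unitVel p)) :=
    integrable_of_norm_le hc.aestronglyMeasurable fun y => hB y.1 y.2
  have hind : ∀ s : Set ℝ, MeasurableSet s → ∃ f : Lp ℂ 1 (unitVel p), IsNonneg f ∧
      ‖f‖ = (unitVel p).real s ∧
      K f =ᵐ[(unitVel q)] fun v => ((∫ w in s, κ v w ∂(unitVel p) : ℝ) : ℂ) :=
      fun s hs => by
    refine ⟨indicatorConstLp 1 hs (measure_ne_top _ _) 1, ?_, ?_, ?_⟩
    · filter_upwards [indicatorConstLp_coeFn (p := 1) (hs := hs)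
        (hμs := measure_ne_top (unitVel p) s) (c := (1 : ℂ))] with v hv
      rw [hv]
      by_cases h : v ∈ s <;> simp [h]
    · rw [norm_indicatorConstLp one_ne_zero ENNReal.one_ne_top]
      simp
    · filter_upwards [hK' (indicatorConstLp 1 hs (measure_ne_top _ _) 1)] with v hv
      rw [hv, ← integral_indicator hs, ← integral_complex_ofReal]
      refine integral_congr_ae ?_
      filter_upwards [indicatorConstLp_coeFn (p := 1) (hs := hs)
        (hμs := measure_ne_top (unitVel p) s) (c := (1 : ℂ))] with w hw
      rw [hw]
      by_cases h : w ∈ s <;> simp [h]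
  have hcs : ∀ s : Set ℝ, Continuous fun v => ∫ w in s, κ v w ∂(unitVel p) := fun s =>
    continuous_of_dominated (fun v => (hcv v).aestronglyMeasurable)
      (fun v => Eventually.of_forall (hB v)) (integrable_const B) (Eventually.of_forall hcw)
  have hnn' : ∀ s, MeasurableSet s → ∀ v ∈ Icc q (q + 1), 0 ≤ ∫ w in s, κ v w ∂(unitVel p) :=
      fun s hs => by
    obtain ⟨f, hf, -, hKf⟩ := hind s hs
    refine Icc_subset_of_ae_mem (isClosed_Ici.preimage (hcs s)) ?_
    filter_upwards [(hS f hf).1, hKf] with v h1 h2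
    rw [h2, Complex.ofReal_re] at h1
    exact h1.1
  have hnn : ∀ v ∈ Icc q (q + 1), ∀ w ∈ Icc p (p + 1), 0 ≤ κ v w := fun v hv => by
    refine Icc_subset_of_ae_mem (isClosed_Ici.preimage (hcv v)) ?_
    exact ae_nonneg_of_forall_setIntegral_nonneg (hiv v) fun s hs _ => hnn' s hs v hv
  have hmc : Continuous fun w => ∫ v, κ v w ∂(unitVel q) :=
    continuous_of_dominated (fun w => (hcw w).aestronglyMeasurable)
      (fun w => Eventually.of_forall fun v => hB v w) (integrable_const B)
      (Eventually.of_forall hcv)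
  have hmass : ∀ w ∈ Icc p (p + 1), ∫ v, κ v w ∂(unitVel q) = 1 := by
    refine Icc_subset_of_ae_mem (isClosed_singleton.preimage hmc) ?_
    refine Integrable.ae_eq_of_forall_setIntegral_eq _ (fun _ => (1 : ℝ))
      hiprod.integral_prod_right (integrable_const 1) fun s hs _ => ?_
    obtain ⟨f, hf, hfn, hKf⟩ := hind s hs
    have h1 := (hS f hf).2
    rw [hfn, norm_L1] at h1
    have h2 : ∫ v, ‖K f v‖ ∂(unitVel q) = ∫ v, ∫ w in s, κ v w ∂(unitVel p) ∂(unitVel q) := by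
      refine integral_congr_ae ?_
      filter_upwards [hKf, ae_restrict_mem measurableSet_Ioo] with v hv hv'
      rw [hv, Complex.norm_real, Real.norm_of_nonneg (hnn' s hs v (Ioo_subset_Icc_self hv'))]
    rw [h2, integral_integral_swap] at h1
    · rw [h1]
      simp
    · exact integrable_of_norm_le hc.aestronglyMeasurable fun y => hB y.1 y.2
  refine ⟨huc, ⟨B, fun v w => (le_abs_self _).trans (hB v w)⟩, fun v w => ?_, fun w => ?_⟩
  · rw [hκ, ← clampKernel_proj]
    exact hnn _ (Subtype.coe_prop _) _ (Subtype.coe_prop _)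
  · refine Eq.trans ?_ (hmass (projIcc p (p + 1) (by linarith) w) (Subtype.coe_prop _))
    refine integral_congr_ae (Eventually.of_forall fun v => ?_)
    simp [hκ, clampKernel]

theorem lintegral_ofReal_stochKernel {ν : Measure ℝ} {k : ℝ → ℝ → ℝ} (h : StochKernel ν k) (w : ℝ) :
    ∫⁻ v, ENNReal.ofReal (k v w) ∂ν = 1 := by
  have hi : Integrable (fun v => k v w) ν := by
    by_contra hn
    have := h.mass w
    rw [integral_undef hn] at this
    norm_num at this
  rw [← ofReal_integral_eq_lintegral_ofReal hi (Eventually.of_forall fun v => h.nonneg v w),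
    h.mass, ENNReal.ofReal_one]

variable {μ ν ρ : Measure ℝ}

theorem enorm_kernel_le {K : Lp ℂ 1 μ →L[ℂ] Lp ℂ 1 ν} {k : ℝ → ℝ → ℝ} (hK : HasKernel K k)
    (hk : StochKernel ν k) (f : Lp ℂ 1 μ) :
    ∀ᵐ v ∂ν, ‖K f v‖ₑ ≤ ∫⁻ w, ENNReal.ofReal (k v w) * ‖f w‖ₑ ∂μ := by
  filter_upwards [hK f] with v hv
  rw [hv]
  refine (enorm_integral_le_lintegral_enorm _).trans (lintegral_mono fun w => ?_)
  rw [enorm_mul, ← ofReal_norm, Complex.norm_real, Real.norm_of_nonneg (hk.nonneg v w)]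

/-- Tonelli: a weight on the values becomes a weighted mass of the columns. The weight 1 gives the
norm bound; powers of `1 / |v|` give the weighted bounds. -/
theorem lintegral_mul_enorm_kernel_le [SFinite μ] [SFinite ν] {K : Lp ℂ 1 μ →L[ℂ] Lp ℂ 1 ν}
    {k : ℝ → ℝ → ℝ} (hK : HasKernel K k) (hk : StochKernel ν k) {ϖ : ℝ → ℝ≥0∞} (hϖ : Measurable ϖ)
    (f : Lp ℂ 1 μ) : ∫⁻ v, ϖ v * ‖K f v‖ₑ ∂ν ≤
      ∫⁻ w, (∫⁻ v, ϖ v * ENNReal.ofReal (k v w) ∂ν) * ‖f w‖ₑ ∂μ := by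
  have hf : Measurable f := (Lp.stronglyMeasurable f).measurable
  have hkm : Measurable (Function.uncurry k) := hk.continuous.measurable
  calc ∫⁻ v, ϖ v * ‖K f v‖ₑ ∂ν
      ≤ ∫⁻ v, ∫⁻ w, ϖ v * (ENNReal.ofReal (k v w) * ‖f w‖ₑ) ∂μ ∂ν := by
        refine lintegral_mono_ae ?_
        filter_upwards [enorm_kernel_le hK hk f] with v hv
        rw [lintegral_const_mul]
        · gcongr
        · exact (ENNReal.measurable_ofReal.comp (hkm.comp measurable_prodMk_left)).mul hf.enorm
    _ = ∫⁻ w, ∫⁻ v, ϖ v * (ENNReal.ofReal (k v w) * ‖f w‖ₑ) ∂ν ∂μ := by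
        refine lintegral_lintegral_swap (Measurable.aemeasurable ?_)
        exact (hϖ.comp measurable_fst).mul ((ENNReal.measurable_ofReal.comp hkm).mul
          (hf.enorm.comp measurable_snd))
    _ = _ := by
        refine lintegral_congr fun w => ?_
        rw [← lintegral_mul_const]
        · simp only [mul_assoc]
        · exact hϖ.mul (ENNReal.measurable_ofReal.comp (hkm.comp measurable_prodMk_right))

theorem norm_kernel_le [SFinite μ] [SFinite ν] {K : Lp ℂ 1 μ →L[ℂ] Lp ℂ 1 ν}
    {k : ℝ → ℝ → ℝ} (hK : HasKernel K k) (hk : StochKernel ν k) : ‖K‖ ≤ 1 := by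
  refine ContinuousLinearMap.opNorm_le_bound _ zero_le_one fun f => ?_
  refine norm_le_of_enorm_le (C := 1) ?_
  have := lintegral_mul_enorm_kernel_le hK hk (ϖ := fun _ => 1) measurable_const f
  simp only [one_mul, lintegral_ofReal_stochKernel hk, ← enorm_L1] at this
  simpa using this

/-- Two kernel operators separated by a multiplication contract as much as their joint kernel. -/
theorem norm_kernel_mul_kernel_le [IsFiniteMeasure μ] [IsFiniteMeasure ν] [IsFiniteMeasure ρ]
    {Ka : Lp ℂ 1 μ →L[ℂ] Lp ℂ 1 ν} {Kb : Lp ℂ 1 ρ →L[ℂ] Lp ℂ 1 μ} {ka kb : ℝ → ℝ → ℝ}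
    (hKa : HasKernel Ka ka) (hKb : HasKernel Kb kb) (ha : StochKernel ν ka) (hb : StochKernel μ kb)
    {m : ℝ → ℂ} (hm : Measurable m) (hm1 : ∀ w, ‖m w‖ ≤ 1) {M : Lp ℂ 1 μ →L[ℂ] Lp ℂ 1 μ}
    (hM : ∀ f, M f =ᵐ[μ] fun w => m w * f w) {D : ℝ}
    (hD : ∀ x, ∫ v, ‖∫ w, (ka v w : ℂ) * m w * kb w x ∂μ‖ ∂ν ≤ D) :
    ‖Ka.comp (M.comp Kb)‖ ≤ D := by
  obtain ⟨Ba, hBa⟩ := ha.bounded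
  obtain ⟨Bb, hBb⟩ := hb.bounded
  have hD0 : 0 ≤ D := (integral_nonneg fun v => norm_nonneg _).trans (hD 0)
  have ham : Measurable fun y : ℝ × ℝ => ka y.1 y.2 := ha.continuous.measurable
  have hbm : Measurable fun y : ℝ × ℝ => kb y.1 y.2 := hb.continuous.measurable
  set N : ℝ → ℝ → ℂ := fun v x => ∫ w, (ka v w : ℂ) * m w * kb w x ∂μ with hN
  have hbd : ∀ v w x, ‖(ka v w : ℂ) * m w * kb w x‖ ≤ Ba * Bb := fun v w x => by
    rw [norm_mul, norm_mul, Complex.norm_real, Complex.norm_real,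
      Real.norm_of_nonneg (ha.nonneg _ _), Real.norm_of_nonneg (hb.nonneg _ _)]
    have h1 := ha.nonneg v w
    have h2 := hb.nonneg w x
    have h3 := hBa v w
    have h4 := hBb w x
    have h5 := hm1 w
    have h6 := h1.trans h3
    calc ka v w * ‖m w‖ * kb w x ≤ Ba * 1 * Bb := by gcongr
      _ = _ := by rw [mul_one]
  have hNm : Measurable (Function.uncurry N) := by
    have h1 : Measurable fun y : (ℝ × ℝ) × ℝ =>
        (ka y.1.1 y.2 : ℂ) * m y.2 * kb y.2 y.1.2 := by
      have e1 : Measurable fun y : (ℝ × ℝ) × ℝ => ka y.1.1 y.2 :=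
        ham.comp (by fun_prop : Measurable fun y : (ℝ × ℝ) × ℝ => (y.1.1, y.2))
      have e2 : Measurable fun y : (ℝ × ℝ) × ℝ => kb y.2 y.1.2 :=
        hbm.comp (by fun_prop : Measurable fun y : (ℝ × ℝ) × ℝ => (y.2, y.1.2))
      exact ((Complex.measurable_ofReal.comp e1).mul (hm.comp measurable_snd)).mul
        (Complex.measurable_ofReal.comp e2)
    exact (h1.stronglyMeasurable.integral_prod_right (ν := μ)).measurable
  have hNB : ∀ v x, ‖N v x‖ ≤ Ba * Bb * μ.real univ := fun v x =>
    norm_integral_le_of_norm_le_const (Eventually.of_forall fun w => hbd v w x)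
  have hNint : ∀ x, ∫⁻ v, ‖N v x‖ₑ ∂ν ≤ ENNReal.ofReal D := fun x => by
    have hi : Integrable (fun v => ‖N v x‖) ν :=
      (integrable_of_norm_le (hNm.comp measurable_prodMk_right).aestronglyMeasurable
        fun v => hNB v x).norm
    have := ofReal_integral_eq_lintegral_ofReal hi (Eventually.of_forall fun v => norm_nonneg _)
    simp only [ofReal_norm] at this
    rw [← this]
    exact ENNReal.ofReal_le_ofReal (hD x)
  refine ContinuousLinearMap.opNorm_le_bound _ hD0 fun f => ?_
  have hf : Measurable f := (Lp.stronglyMeasurable f).measurable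
  have hfi := L1.integrable_coeFn f
  have hrep : Ka.comp (M.comp Kb) f =ᵐ[ν] fun v => ∫ x, N v x * f x ∂ρ := by
    filter_upwards [hKa (M (Kb f))] with v hv
    simp only [ContinuousLinearMap.comp_apply]
    rw [hv]
    have e1 : ∫ w, (ka v w : ℂ) * M (Kb f) w ∂μ =
        ∫ w, ∫ x, (ka v w : ℂ) * m w * kb w x * f x ∂ρ ∂μ := by
      refine integral_congr_ae ?_
      filter_upwards [hM (Kb f), hKb f] with w h1 h2
      rw [h1, h2, ← mul_assoc, ← integral_const_mul]
      simp only [mul_assoc]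
    rw [e1, integral_integral_swap]
    · refine integral_congr_ae (Eventually.of_forall fun x => ?_)
      simp only [hN]
      rw [integral_mul_const]
    · refine Integrable.bdd_mul (c := Ba * Bb) (hfi.comp_snd μ) ?_
        (Eventually.of_forall fun y => hbd v y.1 y.2)
      have e1 : Measurable fun y : ℝ × ℝ => ka v y.1 :=
        ham.comp (by fun_prop : Measurable fun y : ℝ × ℝ => (v, y.1))
      exact (((Complex.measurable_ofReal.comp e1).mul (hm.comp measurable_fst)).mul
        (Complex.measurable_ofReal.comp hbm)).aestronglyMeasurable
  have key : ‖Ka.comp (M.comp Kb) f‖ₑ ≤ (D.toNNReal : ℝ≥0∞) * ‖f‖ₑ := by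
    rw [enorm_L1, enorm_L1]
    calc ∫⁻ v, ‖Ka.comp (M.comp Kb) f v‖ₑ ∂ν
        ≤ ∫⁻ v, ∫⁻ x, ‖N v x‖ₑ * ‖f x‖ₑ ∂ρ ∂ν := by
          refine lintegral_mono_ae ?_
          filter_upwards [hrep] with v hv
          rw [hv]
          refine (enorm_integral_le_lintegral_enorm _).trans_eq ?_
          simp only [enorm_mul]
      _ = ∫⁻ x, ∫⁻ v, ‖N v x‖ₑ * ‖f x‖ₑ ∂ν ∂ρ :=
          lintegral_lintegral_swap (hNm.enorm.mul (hf.enorm.comp measurable_snd)).aemeasurable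
      _ ≤ ∫⁻ x, ENNReal.ofReal D * ‖f x‖ₑ ∂ρ := by
          refine lintegral_mono fun x => ?_
          have hNx : Measurable fun v => ‖N v x‖ₑ := (hNm.comp measurable_prodMk_right).enorm
          rw [lintegral_mul_const _ hNx]
          gcongr
          exact hNint x
      _ = _ := by rw [lintegral_const_mul _ hf.enorm]; rfl
  have := norm_le_of_enorm_le key
  rwa [Real.coe_toNNReal _ hD0] at this

theorem exists_stochKernel (hμ : μ = unitVel p) (hν : ν = unitVel q)
    {K : Lp ℂ 1 μ →L[ℂ] Lp ℂ 1 ν} {k : ℝ → ℝ → ℝ} (hS : IsStochastic K) (hK : HasKernel K k)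
    (hk : ContinuousOn (Function.uncurry k) (Icc q (q + 1) ×ˢ Icc p (p + 1))) :
    ∃ κ, StochKernel ν κ ∧ HasKernel K κ := by
  subst hμ hν
  exact ⟨_, stochKernel_clampKernel hS hK hk, hasKernel_clampKernel hK⟩

/-- Multiplication by `exp (-z c / |v|)`. -/
def fade (μ : Measure ℝ) (c : ℝ) (z : ℂ) : Lp ℂ 1 μ →L[ℂ] Lp ℂ 1 μ :=
  damp μ (y := fun _ => c) measurable_const (r := id) measurable_id z

theorem fade_coe {c : ℝ} (hc : 0 ≤ c) {z : ℂ} (hz : 0 ≤ z.re) (f : Lp ℂ 1 μ) :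
    fade μ c z f =ᵐ[μ] fun v => phaseFactor c z v * f v := by
  filter_upwards [damp_coe (y := fun _ => c) measurable_const (r := id) measurable_id z f] with v hv
  rw [fade, hv, dampSymbol, phaseFactor, rightHalf_of_nonneg hz, abs_of_nonneg hc, id]

theorem norm_fade_le (μ : Measure ℝ) (c : ℝ) (z : ℂ) : ‖fade μ c z‖ ≤ 1 := norm_damp_le _ _ _

theorem exists_norm_kernel_fade_kernel_le (hp : p = 0 ∨ p = -1) (hμ : μ = unitVel p)
    (hν : ν = unitVel q) [IsFiniteMeasure ρ] {Ka : Lp ℂ 1 μ →L[ℂ] Lp ℂ 1 ν}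
    {Kb : Lp ℂ 1 ρ →L[ℂ] Lp ℂ 1 μ} {ka kb : ℝ → ℝ → ℝ} (hKa : HasKernel Ka ka)
    (hKb : HasKernel Kb kb) (ha : StochKernel ν ka) (hb : StochKernel μ kb) {c : ℝ} (hc : 0 < c) :
    ∃ κ : ℝ, 0 < κ ∧ ∀ z : ℂ, 0 ≤ z.re →
      ‖Ka.comp ((fade μ c z).comp Kb)‖ ≤ 1 - κ * min 1 (z.im ^ 2) := by
  subst hμ hν
  obtain ⟨κ, hκ, h⟩ := exists_contraction_const hp ha hb hc
  exact ⟨κ, hκ, fun z hz => norm_kernel_mul_kernel_le hKa hKb ha hb (measurable_phaseFactor c z)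
    (norm_phaseFactor_le hc.le hz) (fade_coe hc.le hz) (h z hz)⟩

end KernelOperators


/-! ### Specular reflection, and the contraction of a diffuse wall facing a mixed one. -/

section Reflection

variable {μ ν : Measure ℝ}

/-- The reflection `f ↦ f (-·)`. -/
def reflect (h : MeasurePreserving (fun v : ℝ => -v) ν μ) : Lp ℂ 1 μ →L[ℂ] Lp ℂ 1 ν :=
  (Lp.compMeasurePreservingₗᵢ ℂ (fun v : ℝ => -v) h).toContinuousLinearMap

variable (h : MeasurePreserving (fun v : ℝ => -v) ν μ)

theorem reflect_coe (f : Lp ℂ 1 μ) : reflect h f =ᵐ[ν] fun v => f (-v) :=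
  Lp.coeFn_compMeasurePreserving f h

theorem norm_reflect_le : ‖reflect h‖ ≤ 1 :=
  ContinuousLinearMap.opNorm_le_bound _ zero_le_one fun f => by
    rw [one_mul]
    exact (LinearIsometry.norm_map (Lp.compMeasurePreservingₗᵢ ℂ (fun v : ℝ => -v) h) f).le

theorem ae_reflect (h : MeasurePreserving (fun v : ℝ => -v) ν μ)
    {P : ℝ → Prop} (hP : ∀ᵐ w ∂μ, P w) :
    ∀ᵐ v ∂ν, P (-v) :=
  h.quasiMeasurePreserving.ae hP

theorem lintegral_reflect (h : MeasurePreserving (fun v : ℝ => -v) ν μ) (φ : ℝ → ℝ≥0∞) :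
    ∫⁻ v, φ (-v) ∂ν = ∫⁻ w, φ w ∂μ :=
  h.lintegral_comp_emb (MeasurableEquiv.neg ℝ).measurableEmbedding φ

theorem integral_reflect (h : MeasurePreserving (fun v : ℝ => -v) ν μ) (φ : ℝ → ℂ) :
    ∫ v, φ (-v) ∂ν = ∫ w, φ w ∂μ :=
  h.integral_comp (MeasurableEquiv.neg ℝ).measurableEmbedding φ

theorem StochKernel.reflect {ρ : Measure ℝ} {k : ℝ → ℝ → ℝ} (hk : StochKernel ρ k) :
    StochKernel ρ fun v w => k v (-w) where
  uniformContinuous := hk.uniformContinuous.comp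
    (uniformContinuous_fst.prodMk uniformContinuous_snd.neg)
  bounded := hk.bounded.imp fun _ hB v w => hB v (-w)
  nonneg v w := hk.nonneg v (-w)
  mass w := hk.mass (-w)

theorem HasKernel.comp_reflect {ρ : Measure ℝ} {K : Lp ℂ 1 ν →L[ℂ] Lp ℂ 1 ρ} {k : ℝ → ℝ → ℝ}
    (hK : HasKernel K k) : HasKernel (K.comp (reflect h)) fun v w => k v (-w) := by
  intro f
  filter_upwards [hK (reflect h f)] with v hv
  rw [ContinuousLinearMap.comp_apply, hv, ← integral_reflect h]
  refine integral_congr_ae ?_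
  filter_upwards [reflect_coe h f] with w hw
  rw [hw, neg_neg]

/-- The damping factor is even in `v`, so two flights joined by a specular reflection are a single
flight of twice the length. This makes the specular part of the opposite wall harmless. -/
theorem fade_reflect {c : ℝ} (hc : 0 ≤ c) {z : ℂ} (hz : 0 ≤ z.re) :
    (fade ν c z).comp ((reflect h).comp (fade μ c z)) = (reflect h).comp (fade μ (2 * c) z) := by
  ext1 f
  refine Lp.ext ?_
  simp only [ContinuousLinearMap.comp_apply]
  filter_upwards [fade_coe hc hz (reflect h (fade μ c z f)), reflect_coe h (fade μ c z f),
    ae_reflect h (fade_coe hc hz f), reflect_coe h (fade μ (2 * c) z f),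
    ae_reflect h (fade_coe (by positivity) hz f : fade μ (2 * c) z f =ᵐ[μ] _)]
    with v h1 h2 h3 h4 h5
  rw [h1, h2, h3, h4, h5, ← mul_assoc, phaseFactor, phaseFactor, phaseFactor, ← Complex.exp_add,
    abs_neg]
  congr 2
  push_cast
  ring

variable {p q : ℝ}

/-- The contraction estimate for one diffuse wall, the other wall being partly specular. -/
theorem exists_norm_diffuse_le (hp : p = 0 ∨ p = -1) (hμ : μ = unitVel p)
    (hν : ν = unitVel q) [IsFiniteMeasure μ] [IsFiniteMeasure ν] {Ka : Lp ℂ 1 ν →L[ℂ] Lp ℂ 1 μ}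
    {Kb : Lp ℂ 1 μ →L[ℂ] Lp ℂ 1 ν} {ka kb : ℝ → ℝ → ℝ} (hKa : HasKernel Ka ka)
    (hKb : HasKernel Kb kb) (ha : StochKernel μ ka) (hb : StochKernel ν kb) {c : ℝ} (hc : 0 < c)
    {α β : ℝ} (hα : 0 ≤ α) (hβ : 0 ≤ β) (hαβ : α + β = 1) {O : Lp ℂ 1 μ →L[ℂ] Lp ℂ 1 ν}
    (hO : O = (α : ℂ) • reflect h + (β : ℂ) • Kb) :
    ∃ κ : ℝ, 0 < κ ∧ ∀ z : ℂ, 0 ≤ z.re →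
      ‖Ka.comp ((fade ν c z).comp (O.comp ((fade μ c z).comp Ka)))‖ ≤
        1 - κ * min 1 (z.im ^ 2) := by
  -- Specular part: the kernel operators `Ka R` and `Ka`, separated by a flight of length `2 * c`.
  obtain ⟨κ₁, hκ₁, h₁⟩ := exists_norm_kernel_fade_kernel_le hp hμ hμ (hKa.comp_reflect h) hKa
    ha.reflect ha (by positivity : 0 < 2 * c)
  -- Diffuse part: the pair `Kb`, `Ka` contracts, while the outer `Ka` and its flight have norm at
  -- most 1.
  obtain ⟨κ₂, hκ₂, h₂⟩ := exists_norm_kernel_fade_kernel_le hp hμ hν hKb hKa hb ha hc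
  refine ⟨α * κ₁ + β * κ₂, ?_, fun z hz => ?_⟩
  · rcases hα.eq_or_lt with rfl | hα'
    · have : β = 1 := by linarith
      subst this
      simpa using hκ₂
    · positivity
  have e : Ka.comp ((fade ν c z).comp (O.comp ((fade μ c z).comp Ka))) =
      (α : ℂ) • (Ka.comp (reflect h)).comp ((fade μ (2 * c) z).comp Ka) +
      (β : ℂ) • (Ka.comp (fade ν c z)).comp (Kb.comp ((fade μ c z).comp Ka)) := by
    have e1 : (Ka.comp (reflect h)).comp ((fade μ (2 * c) z).comp Ka) =
        Ka.comp (((fade ν c z).comp ((reflect h).comp (fade μ c z))).comp Ka) := by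
      rw [fade_reflect h hc.le hz]
      rfl
    rw [e1, hO]
    ext1 f
    simp only [ContinuousLinearMap.comp_apply, add_apply, smul_apply, map_add, map_smul]
  have b2 : ‖(Ka.comp (fade ν c z)).comp (Kb.comp ((fade μ c z).comp Ka))‖ ≤
      1 - κ₂ * min 1 (z.im ^ 2) := by
    refine (ContinuousLinearMap.opNorm_comp_le _ _).trans ?_
    have : ‖Ka.comp (fade ν c z)‖ ≤ 1 :=
      (ContinuousLinearMap.opNorm_comp_le _ _).trans
        (mul_le_one₀ (norm_kernel_le hKa ha) (norm_nonneg _) (norm_fade_le _ _ _))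
    exact (mul_le_of_le_one_left (norm_nonneg _) this).trans (h₂ z hz)
  rw [e]
  refine (norm_add_le _ _).trans ?_
  rw [norm_smul, norm_smul, Complex.norm_real, Complex.norm_real, Real.norm_of_nonneg hα,
    Real.norm_of_nonneg hβ]
  calc _ ≤ α * (1 - κ₁ * min 1 (z.im ^ 2)) + β * (1 - κ₂ * min 1 (z.im ^ 2)) := by
        gcongr
        exact h₁ z hz
    _ = (α + β) - (α * κ₁ + β * κ₂) * min 1 (z.im ^ 2) := by ring
    _ = _ := by rw [hαβ]

end Reflection

/-! ### Boundedness on weighted spaces: interpolation between orders, and domination. -/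

section Weights

variable {μ ν ρ : Measure ℝ}

theorem IsBoundedWeighted.add {m n : ℕ} {A B : Lp ℂ 1 μ →L[ℂ] Lp ℂ 1 ν}
    (hA : IsBoundedWeighted m A n) (hB : IsBoundedWeighted m B n) :
    IsBoundedWeighted m (A + B) n := by
  obtain ⟨C, hC⟩ := hA
  obtain ⟨D, hD⟩ := hB
  refine ⟨C + D, fun f g hg => ?_⟩
  have hm : Measurable fun v : ℝ => ENNReal.ofReal ((|v| ^ m)⁻¹) * ‖A g v‖ₑ := by
    have : Measurable (A g) := (Lp.stronglyMeasurable (A g)).measurable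
    fun_prop
  calc ∫⁻ v, ENNReal.ofReal ((|v| ^ m)⁻¹) * ‖(A + B) g v‖ₑ ∂ν
      ≤ ∫⁻ v, (ENNReal.ofReal ((|v| ^ m)⁻¹) * ‖A g v‖ₑ +
          ENNReal.ofReal ((|v| ^ m)⁻¹) * ‖B g v‖ₑ) ∂ν := by
        refine lintegral_mono_ae ?_
        filter_upwards [Lp.coeFn_add (A g) (B g)] with v hv
        rw [add_apply, hv, Pi.add_apply, ← mul_add]
        gcongr
        exact enorm_add_le _ _
    _ ≤ C * ‖f‖ₑ + D * ‖f‖ₑ := by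
        rw [lintegral_add_left hm]
        exact add_le_add (hC f g hg) (hD f g hg)
    _ = _ := by push_cast; ring

theorem IsBoundedWeighted.smul {m n : ℕ} {A : Lp ℂ 1 μ →L[ℂ] Lp ℂ 1 ν}
    (hA : IsBoundedWeighted m A n) (c : ℂ) : IsBoundedWeighted m (c • A) n := by
  obtain ⟨C, hC⟩ := hA
  refine ⟨‖c‖₊ * C, fun f g hg => ?_⟩
  have hm : Measurable fun v : ℝ => ENNReal.ofReal ((|v| ^ m)⁻¹) * ‖A g v‖ₑ := by
    have : Measurable (A g) := (Lp.stronglyMeasurable (A g)).measurable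
    fun_prop
  calc ∫⁻ v, ENNReal.ofReal ((|v| ^ m)⁻¹) * ‖(c • A) g v‖ₑ ∂ν
      = ∫⁻ v, ‖c‖ₑ * (ENNReal.ofReal ((|v| ^ m)⁻¹) * ‖A g v‖ₑ) ∂ν := by
        refine lintegral_congr_ae ?_
        filter_upwards [Lp.coeFn_smul c (A g)] with v hv
        rw [smul_apply, hv, Pi.smul_apply, enorm_smul]
        ring
    _ ≤ ‖c‖ₑ * (C * ‖f‖ₑ) := by
        rw [lintegral_const_mul _ hm]
        gcongr
        exact hC f g hg
    _ = _ := by rw [enorm_eq_nnnorm c]; push_cast; ring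

theorem isBoundedWeighted_reflect (h : MeasurePreserving (fun v : ℝ => -v) ν μ)
    (h0 : ∀ᵐ v ∂ν, v ≠ 0) (m : ℕ) : IsBoundedWeighted m (reflect h) m := by
  refine ⟨1, fun f g hg => ?_⟩
  rw [ENNReal.coe_one, one_mul, enorm_L1, ← lintegral_reflect h]
  refine lintegral_mono_ae ?_
  filter_upwards [reflect_coe h g, ae_reflect h hg, h0] with v h1 h2 h3
  rw [h1, h2, abs_neg, enorm_mul, ← ofReal_norm, Complex.norm_real,
    Real.norm_of_nonneg (by positivity), ← mul_assoc, ← ENNReal.ofReal_mul (by positivity),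
    inv_mul_cancel₀ (by positivity), ENNReal.ofReal_one, one_mul]

/-- The weighted mass of the columns of a kernel that is bounded on a weighted space. -/
theorem ae_lintegral_kernel_le [IsFiniteMeasure μ] [IsFiniteMeasure ν]
    (hμ1 : ∀ᵐ w ∂μ, |w| ≤ 1) {K : Lp ℂ 1 μ →L[ℂ] Lp ℂ 1 ν}
    {k : ℝ → ℝ → ℝ} (hK : HasKernel K k) (hk : StochKernel ν k) {n : ℕ} {C : ℝ≥0}
    (hC : ∀ f g : Lp ℂ 1 μ, (g =ᵐ[μ] fun v => ((|v| ^ n : ℝ) : ℂ) * f v) →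
      ∫⁻ v, ENNReal.ofReal ((|v| ^ n)⁻¹) * ‖K g v‖ₑ ∂ν ≤ C * ‖f‖ₑ) :
    ∀ᵐ w ∂μ, (∫⁻ v, ENNReal.ofReal ((|v| ^ n)⁻¹) * ENNReal.ofReal (k v w) ∂ν) *
      ENNReal.ofReal (|w| ^ n) ≤ C := by
  have hkm : Measurable (Function.uncurry k) := hk.continuous.measurable
  have hkv : ∀ v, Measurable (k v) := fun v => hkm.comp measurable_prodMk_left
  have hϖ : Measurable fun v : ℝ => ENNReal.ofReal ((|v| ^ n)⁻¹) := by fun_prop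
  have hprod : Measurable fun y : ℝ × ℝ =>
      ENNReal.ofReal ((|y.1| ^ n)⁻¹) * ENNReal.ofReal (k y.1 y.2) :=
    (hϖ.comp measurable_fst).mul (ENNReal.measurable_ofReal.comp hkm)
  have hW : Measurable fun w => (∫⁻ v, ENNReal.ofReal ((|v| ^ n)⁻¹) * ENNReal.ofReal (k v w) ∂ν) *
      ENNReal.ofReal (|w| ^ n) :=
    (Measurable.lintegral_prod_left' hprod).mul (by fun_prop)
  refine ae_le_of_forall_setLIntegral_le_of_sigmaFinite hW fun s hs _ => ?_
  -- Testing with `f` an indicator and `g = |v|^n f` bounds the integral of the weighted column mass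
  -- over an arbitrary set `s` by `C μ(s)`; the pointwise bound follows.
  set f : Lp ℂ 1 μ := indicatorConstLp 1 hs (measure_ne_top _ _) 1 with hf
  have hfc : f =ᵐ[μ] s.indicator fun _ => (1 : ℂ) := indicatorConstLp_coeFn
  set g : Lp ℂ 1 μ := (clip μ measurable_id 1 ^ n) f with hg
  have hgc : g =ᵐ[μ] fun v => ((|v| ^ n : ℝ) : ℂ) * f v := clip_pow_coe measurable_id hμ1 n f
  have h1 := hC f g hgc
  have h2 : ‖f‖ₑ = μ s := by
    rw [enorm_L1, ← setLIntegral_one, ← lintegral_indicator hs]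
    refine lintegral_congr_ae ?_
    filter_upwards [hfc] with w hw
    rw [hw]
    by_cases h : w ∈ s <;> simp [h]
  have h3 : ∀ᵐ v ∂ν, ‖K g v‖ₑ =
      ∫⁻ w in s, ENNReal.ofReal (k v w) * ENNReal.ofReal (|w| ^ n) ∂μ := by
    filter_upwards [hK g] with v hv
    have e1 : ∫ w, (k v w : ℂ) * g w ∂μ =
        ((∫ w, s.indicator (fun w => k v w * |w| ^ n) w ∂μ : ℝ) : ℂ) := by
      rw [← integral_complex_ofReal]
      refine integral_congr_ae ?_
      filter_upwards [hgc, hfc] with w h1 h2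
      rw [h1, h2]
      by_cases hw : w ∈ s <;> simp [hw]
    have hnn : ∀ w, 0 ≤ s.indicator (fun w => k v w * |w| ^ n) w := fun w =>
      indicator_nonneg (fun w _ => mul_nonneg (hk.nonneg v w) (by positivity)) w
    obtain ⟨B, hB⟩ := hk.bounded
    have hint : Integrable (s.indicator (fun w => k v w * |w| ^ n)) μ := by
      refine Integrable.indicator ?_ hs
      refine (integrable_const B).mono' ?_ ?_
      · have := hkv v
        exact (by fun_prop : Measurable fun w => k v w * |w| ^ n).aestronglyMeasurable
      · filter_upwards [hμ1] with w hw
        rw [Real.norm_of_nonneg (mul_nonneg (hk.nonneg v w) (by positivity))]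
        exact (mul_le_of_le_one_right (hk.nonneg v w) (pow_le_one₀ (abs_nonneg _) hw)).trans
          (hB v w)
    rw [hv, e1, ← ofReal_norm, Complex.norm_real, Real.norm_of_nonneg (integral_nonneg hnn),
      ofReal_integral_eq_lintegral_ofReal hint (Eventually.of_forall hnn), ← lintegral_indicator hs]
    refine lintegral_congr fun w => ?_
    by_cases hw : w ∈ s
    · simp [hw, ENNReal.ofReal_mul (hk.nonneg v w)]
    · simp [hw]
  have hsw : Measurable fun y : ℝ × ℝ => ENNReal.ofReal ((|y.1| ^ n)⁻¹) *
      ENNReal.ofReal (k y.1 y.2) * ENNReal.ofReal (|y.2| ^ n) := hprod.mul (by fun_prop)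
  rw [h2] at h1
  rw [setLIntegral_const]
  refine le_trans (le_of_eq ?_) h1
  calc ∫⁻ w in s, (∫⁻ v, ENNReal.ofReal ((|v| ^ n)⁻¹) * ENNReal.ofReal (k v w) ∂ν) *
          ENNReal.ofReal (|w| ^ n) ∂μ
      = ∫⁻ w in s, ∫⁻ v, ENNReal.ofReal ((|v| ^ n)⁻¹) * ENNReal.ofReal (k v w) *
          ENNReal.ofReal (|w| ^ n) ∂ν ∂μ := by
        refine lintegral_congr fun w => ?_
        have : Measurable fun v => ENNReal.ofReal ((|v| ^ n)⁻¹) * ENNReal.ofReal (k v w) :=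
          hprod.comp measurable_prodMk_right
        rw [lintegral_mul_const _ this]
    _ = ∫⁻ v, ∫⁻ w in s, ENNReal.ofReal ((|v| ^ n)⁻¹) * ENNReal.ofReal (k v w) *
          ENNReal.ofReal (|w| ^ n) ∂μ ∂ν :=
        (lintegral_lintegral_swap hsw.aemeasurable).symm
    _ = _ := by
        refine lintegral_congr_ae ?_
        filter_upwards [h3] with v hv
        have : Measurable fun w => ENNReal.ofReal (k v w) * ENNReal.ofReal (|w| ^ n) := by
          have := hkv v
          fun_prop
        rw [hv, ← lintegral_const_mul _ this]
        simp only [mul_assoc]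

/-- If `|w| ≤ |v|` the first term suffices, otherwise the second. The first costs only the mass of
the column, the second its weighted mass of order `n`. -/
theorem inv_pow_le_add {v w : ℝ} (hv : v ≠ 0) (hw : w ≠ 0) {m n : ℕ} (hmn : m ≤ n) :
    (|v| ^ m)⁻¹ ≤ (|w| ^ m)⁻¹ + (|w| ^ m)⁻¹ * |w| ^ n * (|v| ^ n)⁻¹ := by
  have hv' := abs_pos.2 hv
  have hw' := abs_pos.2 hw
  rcases le_total |w| |v| with h | h
  · have : (|v| ^ m)⁻¹ ≤ (|w| ^ m)⁻¹ := by gcongr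
    have : 0 ≤ (|w| ^ m)⁻¹ * |w| ^ n * (|v| ^ n)⁻¹ := by positivity
    linarith
  · obtain ⟨j, rfl⟩ := Nat.exists_eq_add_of_le hmn
    have e : (|w| ^ m)⁻¹ * |w| ^ (m + j) * (|v| ^ (m + j))⁻¹ =
        (|v| ^ m)⁻¹ * (|w| ^ j / |v| ^ j) := by
      rw [pow_add, pow_add]
      field_simp
    rw [e]
    have h1 : 1 ≤ |w| ^ j / |v| ^ j := by
      rw [one_le_div (by positivity)]
      gcongr
    have h2 : 0 < (|v| ^ m)⁻¹ := by positivity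
    have h3 : 0 < (|w| ^ m)⁻¹ := by positivity
    nlinarith

/-- Interpolation between `L¹` and a weighted `L¹` space, for kernel operators. -/
theorem IsBoundedWeighted.of_le_of_kernel [IsFiniteMeasure μ] [IsFiniteMeasure ν]
    (hμ1 : ∀ᵐ w ∂μ, 0 < |w| ∧ |w| ≤ 1) (hν0 : ∀ᵐ v ∂ν, v ≠ 0) {K : Lp ℂ 1 μ →L[ℂ] Lp ℂ 1 ν}
    {k : ℝ → ℝ → ℝ} (hK : HasKernel K k) (hk : StochKernel ν k) {m n : ℕ} (hmn : m ≤ n)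
    (hn : IsBoundedWeighted n K n) : IsBoundedWeighted m K m := by
  obtain ⟨C, hC⟩ := hn
  have hcol := ae_lintegral_kernel_le (hμ1.mono fun _ h => h.2) hK hk hC
  have hkm : Measurable (Function.uncurry k) := hk.continuous.measurable
  refine ⟨1 + C, fun f g hg => ?_⟩
  refine (lintegral_mul_enorm_kernel_le hK hk (by fun_prop) g).trans ?_
  have hf : Measurable fun w => ‖f w‖ₑ := (Lp.stronglyMeasurable f).measurable.enorm
  rw [enorm_L1, ← lintegral_const_mul _ hf]
  refine lintegral_mono_ae ?_
  filter_upwards [hcol, hg, hμ1] with w h1 h2 h3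
  have hw : w ≠ 0 := abs_pos.1 h3.1
  have hkw : Measurable fun v => ENNReal.ofReal (k v w) :=
    ENNReal.measurable_ofReal.comp (hkm.comp measurable_prodMk_right)
  have hbound : ∫⁻ v, ENNReal.ofReal ((|v| ^ m)⁻¹) * ENNReal.ofReal (k v w) ∂ν ≤
      ENNReal.ofReal ((|w| ^ m)⁻¹) * (1 + C) := by
    calc ∫⁻ v, ENNReal.ofReal ((|v| ^ m)⁻¹) * ENNReal.ofReal (k v w) ∂ν
        ≤ ∫⁻ v, (ENNReal.ofReal ((|w| ^ m)⁻¹) * ENNReal.ofReal (k v w) +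
          ENNReal.ofReal ((|w| ^ m)⁻¹) * ENNReal.ofReal (|w| ^ n) *
            (ENNReal.ofReal ((|v| ^ n)⁻¹) * ENNReal.ofReal (k v w))) ∂ν := by
          refine lintegral_mono_ae ?_
          filter_upwards [hν0] with v hv
          rw [← mul_assoc, ← add_mul]
          gcongr
          rw [← ENNReal.ofReal_mul (by positivity), ← ENNReal.ofReal_mul (by positivity),
            ← ENNReal.ofReal_add (by positivity) (by positivity)]
          exact ENNReal.ofReal_le_ofReal (inv_pow_le_add hv hw hmn)
      _ = ENNReal.ofReal ((|w| ^ m)⁻¹) * (1 +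
          (∫⁻ v, ENNReal.ofReal ((|v| ^ n)⁻¹) * ENNReal.ofReal (k v w) ∂ν) *
            ENNReal.ofReal (|w| ^ n)) := by
          rw [lintegral_add_left (by fun_prop), lintegral_const_mul _ hkw,
            lintegral_ofReal_stochKernel hk, lintegral_const_mul _ (by fun_prop)]
          ring
      _ ≤ _ := by gcongr
  calc (∫⁻ v, ENNReal.ofReal ((|v| ^ m)⁻¹) * ENNReal.ofReal (k v w) ∂ν) * ‖g w‖ₑ
      ≤ ENNReal.ofReal ((|w| ^ m)⁻¹) * (1 + C) * ‖g w‖ₑ := by gcongr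
    _ = (1 + C) * ‖f w‖ₑ * (ENNReal.ofReal ((|w| ^ m)⁻¹) * ENNReal.ofReal (|w| ^ m)) := by
        rw [h2, enorm_mul, ← ofReal_norm ((|w| ^ m : ℝ) : ℂ), Complex.norm_real,
          Real.norm_of_nonneg (by positivity)]
        ring
    _ = _ := by
        rw [← ENNReal.ofReal_mul (by positivity), inv_mul_cancel₀ (by positivity),
          ENNReal.ofReal_one, mul_one]
        push_cast
        rfl

/-- Interpolation uses a positive kernel, while the hypothesis concerns the mixture `O`. A
reflection preserves `|v|` and is bounded at every order, so for `β ≠ 0` it can be subtracted to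
reach `K` and be restored afterwards. -/
theorem IsBoundedWeighted.of_le [IsFiniteMeasure μ] [IsFiniteMeasure ν]
    (h : MeasurePreserving (fun v : ℝ => -v) ν μ)
    (hμ1 : ∀ᵐ w ∂μ, 0 < |w| ∧ |w| ≤ 1) (hν0 : ∀ᵐ v ∂ν, v ≠ 0) {K : Lp ℂ 1 μ →L[ℂ] Lp ℂ 1 ν}
    {k : ℝ → ℝ → ℝ} (hK : HasKernel K k) (hk : StochKernel ν k) {α β : ℂ}
    {O : Lp ℂ 1 μ →L[ℂ] Lp ℂ 1 ν} (hO : O = α • reflect h + β • K) {m n : ℕ} (hmn : m ≤ n)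
    (hn : IsBoundedWeighted n O n) : IsBoundedWeighted m O m := by
  have hR := isBoundedWeighted_reflect h hν0
  rcases eq_or_ne β 0 with rfl | hβ
  · rw [hO, zero_smul, add_zero]
    exact (hR m).smul α
  · have e : K = β⁻¹ • O + (-(β⁻¹ * α)) • reflect h := by
      rw [hO, smul_add, smul_smul, smul_smul, inv_mul_cancel₀ hβ, one_smul, neg_smul]
      abel
    have hKn : IsBoundedWeighted n K n := by
      rw [e]
      exact (hn.smul _).add ((hR n).smul _)
    rw [hO]
    exact ((hR m).smul α).add ((hKn.of_le_of_kernel hμ1 hν0 hK hk hmn).smul β)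

/-- `f` is bounded by the nonnegative function `F` almost everywhere. -/
def Majorizes (f F : Lp ℂ 1 μ) : Prop := ∀ᵐ v ∂μ, ‖f v‖ ≤ (F v).re ∧ (F v).im = 0

theorem exists_majorizes_self (f : Lp ℂ 1 μ) : ∃ F : Lp ℂ 1 μ, Majorizes f F ∧ ‖F‖ₑ = ‖f‖ₑ := by
  have hi : Integrable (fun v => ((‖f v‖ : ℝ) : ℂ)) μ := (L1.integrable_coeFn f).norm.ofReal
  refine ⟨hi.toL1 _, ?_, ?_⟩
  · filter_upwards [Integrable.coeFn_toL1 hi] with v hv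
    rw [hv]
    simp
  · rw [Integrable.enorm_toL1, enorm_L1]
    simp [← ofReal_norm]

theorem Majorizes.reflect (h : MeasurePreserving (fun v : ℝ => -v) ν μ) {f F : Lp ℂ 1 μ}
    (hf : Majorizes f F) : Majorizes (reflect h f) (reflect h F) := by
  filter_upwards [ae_reflect h hf, reflect_coe h f, reflect_coe h F] with v h1 h2 h3
  rwa [h2, h3]

theorem Majorizes.kernel {K : Lp ℂ 1 μ →L[ℂ] Lp ℂ 1 ν} {k : ℝ → ℝ → ℝ} (hK : HasKernel K k)
    (hk : StochKernel ν k) {f F : Lp ℂ 1 μ} (hf : Majorizes f F) : Majorizes (K f) (K F) := by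
  filter_upwards [hK f, hK F] with v h1 h2
  obtain ⟨B, hB⟩ := hk.bounded
  have hkm : Measurable (k v) := hk.continuous.measurable.comp measurable_prodMk_left
  have hkB : ∀ w, ‖k v w‖ ≤ B := fun w => by
    rw [Real.norm_of_nonneg (hk.nonneg v w)]; exact hB v w
  have hre : Integrable (fun w => k v w * (F w).re) μ :=
    (L1.integrable_coeFn F).re.bdd_mul (c := B) hkm.aestronglyMeasurable (Eventually.of_forall hkB)
  have hfi : Integrable (fun w => (k v w : ℂ) * f w) μ := by
    refine (L1.integrable_coeFn f).bdd_mul (c := B)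
      (Complex.measurable_ofReal.comp hkm).aestronglyMeasurable (Eventually.of_forall fun w => ?_)
    rw [Complex.norm_real]
    exact hkB w
  have e : ∫ w, (k v w : ℂ) * F w ∂μ = ((∫ w, k v w * (F w).re ∂μ : ℝ) : ℂ) := by
    rw [← integral_complex_ofReal]
    refine integral_congr_ae ?_
    filter_upwards [hf] with w hw
    apply Complex.ext <;> simp [hw.2]
  rw [h1, h2, e, Complex.ofReal_re, Complex.ofReal_im]
  refine ⟨?_, rfl⟩
  refine (norm_integral_le_integral_norm _).trans (integral_mono_ae hfi.norm hre ?_)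
  filter_upwards [hf] with w hw
  rw [norm_mul, Complex.norm_real, Real.norm_of_nonneg (hk.nonneg v w)]
  exact mul_le_mul_of_nonneg_left hw.1 (hk.nonneg v w)

theorem Majorizes.combination (h : MeasurePreserving (fun v : ℝ => -v) ν μ)
    {K : Lp ℂ 1 μ →L[ℂ] Lp ℂ 1 ν} {k : ℝ → ℝ → ℝ} (hK : HasKernel K k) (hk : StochKernel ν k)
    {α β : ℝ} (hα : 0 ≤ α) (hβ : 0 ≤ β) {O : Lp ℂ 1 μ →L[ℂ] Lp ℂ 1 ν}
    (hO : O = (α : ℂ) • Slab.reflect h + (β : ℂ) • K) {f F : Lp ℂ 1 μ} (hf : Majorizes f F) :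
    Majorizes (O f) (O F) := by
  have e : ∀ f, O f =ᵐ[ν] fun v => (α : ℂ) * Slab.reflect h f v + (β : ℂ) * K f v := fun f => by
    rw [hO, add_apply, smul_apply, smul_apply]
    filter_upwards [Lp.coeFn_add ((α : ℂ) • Slab.reflect h f) ((β : ℂ) • K f),
      Lp.coeFn_smul (α : ℂ) (Slab.reflect h f), Lp.coeFn_smul (β : ℂ) (K f)] with v h1 h2 h3
    rw [h1, Pi.add_apply, h2, h3]
    rfl
  filter_upwards [e f, e F, hf.reflect h, hf.kernel hK hk] with v h1 h2 h3 h4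
  rw [h1, h2]
  simp only [Complex.add_re, Complex.add_im, Complex.re_ofReal_mul, Complex.im_ofReal_mul, h3.2,
    h4.2, mul_zero, add_zero, and_true]
  refine (norm_add_le _ _).trans ?_
  rw [norm_mul, norm_mul, Complex.norm_real, Complex.norm_real, Real.norm_of_nonneg hα,
    Real.norm_of_nonneg hβ]
  have := h3.1
  have := h4.1
  gcongr

/-- Damping factors have modulus at most 1, so a majorant survives them unchanged. This is how a
product containing flights is compared with the same product without them. -/
theorem Majorizes.fade {c : ℝ} {z : ℂ} {f F : Lp ℂ 1 μ} (hf : Majorizes f F) :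
    Majorizes (fade μ c z f) F := by
  filter_upwards [hf, damp_coe (y := fun _ => c) measurable_const (r := id) measurable_id z f]
    with v h1 h2
  refine ⟨?_, h1.2⟩
  rw [Slab.fade, h2, norm_mul]
  exact (mul_le_of_le_one_left (norm_nonneg _) (norm_dampSymbol_le _ _ _ _)).trans h1.1

theorem Majorizes.enorm_le {f F : Lp ℂ 1 μ} (hf : Majorizes f F) : ∀ᵐ v ∂μ, ‖f v‖ₑ ≤ ‖F v‖ₑ := by
  filter_upwards [hf] with v hv
  rw [← ofReal_norm, ← ofReal_norm]
  exact ENNReal.ofReal_le_ofReal (hv.1.trans (Complex.re_le_norm _))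

end Weights


/-! ### The space of fluxes over both directions, and the crossing operator. -/

section Velocities

/-- Lebesgue measure on the velocities `(-1, 1)`. -/
abbrev velAll : Measure ℝ := volume.restrict (Ioo (-1) 1)

/-- Complex `L¹((-1, 1); dv)`. -/
abbrev L1Vel : Type := Lp ℂ 1 velAll

theorem velPos_eq : velPos = unitVel 0 := by simp [velPos, unitVel]

theorem velNeg_eq : velNeg = unitVel (-1) := by simp [velNeg, unitVel]

theorem ae_velPos : ∀ᵐ v ∂velPos, 0 < |v| ∧ |v| ≤ 1 := by
  filter_upwards [ae_restrict_mem measurableSet_Ioo] with v hv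
  rw [abs_of_pos hv.1]
  exact ⟨hv.1, hv.2.le⟩

theorem ae_velNeg : ∀ᵐ v ∂velNeg, 0 < |v| ∧ |v| ≤ 1 := by
  filter_upwards [ae_restrict_mem measurableSet_Ioo] with v hv
  rw [abs_of_neg hv.2]
  constructor <;> linarith [hv.1, hv.2]

theorem ae_velAll_ne_zero : ∀ᵐ v ∂velAll, v ≠ 0 := by
  refine ae_restrict_of_ae ?_
  exact Measure.ae_ne volume 0

theorem ae_velAll : ∀ᵐ v ∂velAll, 0 < |v| ∧ |v| ≤ 1 := by
  filter_upwards [ae_restrict_mem measurableSet_Ioo, ae_velAll_ne_zero] with v hv hv0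
  exact ⟨abs_pos.2 hv0, abs_le.2 ⟨hv.1.le, hv.2.le⟩⟩

theorem wcomp_restrict {s t : Set ℝ} (h : s ⊆ t) :
    WComp id (fun _ => 1) (volume.restrict t) (volume.restrict s) 1 where
  measurable_map := measurable_id
  measurable_weight := measurable_const
  bound F _ := by
    simp only [enorm_one, one_mul, id, ENNReal.coe_one]
    exact lintegral_mono_set h

theorem wcomp_extend {s t u : Set ℝ} (hu : MeasurableSet u) (h : u ∩ t ⊆ s) :
    WComp id (u.indicator fun _ => 1) (volume.restrict s) (volume.restrict t) 1 where
  measurable_map := measurable_id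
  measurable_weight := measurable_const.indicator hu
  bound F _ := by
    have e : ∀ v, ‖u.indicator (fun _ => (1 : ℂ)) v‖ₑ * F (id v) = u.indicator F v := fun v => by
      by_cases hv : v ∈ u <;> simp [hv]
    simp only [e, ENNReal.coe_one, one_mul]
    rw [lintegral_indicator hu, Measure.restrict_restrict hu]
    exact lintegral_mono_set h

/-- Restriction to the positive velocities. -/
def resPos : L1Vel →L[ℂ] L1Pos :=
  wcomp (wcomp_restrict (Ioo_subset_Ioo_left (by norm_num)))

/-- Restriction to the negative velocities. -/
def resNeg : L1Vel →L[ℂ] L1Neg :=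
  wcomp (wcomp_restrict (Ioo_subset_Ioo_right (by norm_num)))

/-- Extension by zero from the positive velocities. -/
def extPos : L1Pos →L[ℂ] L1Vel :=
  wcomp (wcomp_extend (u := Ioi 0) measurableSet_Ioi fun _ h => ⟨h.1, h.2.2⟩)

/-- Extension by zero from the negative velocities. -/
def extNeg : L1Neg →L[ℂ] L1Vel :=
  wcomp (wcomp_extend (u := Iio 0) measurableSet_Iio fun _ h => ⟨h.2.1, h.1⟩)

theorem resPos_coe (f : L1Vel) : resPos f =ᵐ[velPos] f := by
  filter_upwards [wcomp_coe (wcomp_restrict (Ioo_subset_Ioo_left (by norm_num :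
    (-1 : ℝ) ≤ 0))) f] with v hv
  rw [resPos, hv, one_mul, id]

theorem resNeg_coe (f : L1Vel) : resNeg f =ᵐ[velNeg] f := by
  filter_upwards [wcomp_coe (wcomp_restrict (Ioo_subset_Ioo_right (by norm_num :
    (0 : ℝ) ≤ 1))) f] with v hv
  rw [resNeg, hv, one_mul, id]

theorem extPos_coe (f : L1Pos) : extPos f =ᵐ[velAll] (Ioi 0).indicator f := by
  filter_upwards [wcomp_coe (wcomp_extend (s := Ioo (0 : ℝ) 1) (t := Ioo (-1 : ℝ) 1)
    (u := Ioi 0) measurableSet_Ioi fun _ h => ⟨h.1, h.2.2⟩) f] with v hv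
  rw [extPos, hv, id]
  by_cases h : v ∈ Ioi (0 : ℝ) <;> simp [h]

theorem extNeg_coe (f : L1Neg) : extNeg f =ᵐ[velAll] (Iio 0).indicator f := by
  filter_upwards [wcomp_coe (wcomp_extend (s := Ioo (-1 : ℝ) 0) (t := Ioo (-1 : ℝ) 1)
    (u := Iio 0) measurableSet_Iio fun _ h => ⟨h.2.1, h.1⟩) f] with v hv
  rw [extNeg, hv, id]
  by_cases h : v ∈ Iio (0 : ℝ) <;> simp [h]

theorem ae_velPos_of_velAll {P : ℝ → Prop} (h : ∀ᵐ v ∂velAll, P v) : ∀ᵐ v ∂velPos, P v :=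
  ae_mono (Measure.restrict_mono (Ioo_subset_Ioo_left (by norm_num)) le_rfl) h

theorem ae_velNeg_of_velAll {P : ℝ → Prop} (h : ∀ᵐ v ∂velAll, P v) : ∀ᵐ v ∂velNeg, P v :=
  ae_mono (Measure.restrict_mono (Ioo_subset_Ioo_right (by norm_num)) le_rfl) h

theorem ae_velAll_of_pos_of_neg {P : ℝ → Prop} (hp : ∀ᵐ v ∂velPos, P v) (hn : ∀ᵐ v ∂velNeg, P v) :
    ∀ᵐ v ∂velAll, P v := by
  rw [ae_restrict_iff' measurableSet_Ioo] at hp hn ⊢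
  filter_upwards [hp, hn, Measure.ae_ne volume (0 : ℝ)] with v h1 h2 h3 hv
  rcases lt_or_gt_of_ne h3 with h | h
  · exact h2 ⟨hv.1, h⟩
  · exact h1 ⟨h, hv.2⟩

theorem resPos_extPos (f : L1Pos) : resPos (extPos f) = f := by
  refine Lp.ext ?_
  filter_upwards [resPos_coe (extPos f), ae_velPos_of_velAll (extPos_coe f),
    ae_restrict_mem measurableSet_Ioo] with v h1 h2 h3
  rw [h1, h2, indicator_of_mem (mem_Ioi.2 h3.1)]

theorem resNeg_extNeg (f : L1Neg) : resNeg (extNeg f) = f := by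
  refine Lp.ext ?_
  filter_upwards [resNeg_coe (extNeg f), ae_velNeg_of_velAll (extNeg_coe f),
    ae_restrict_mem measurableSet_Ioo] with v h1 h2 h3
  rw [h1, h2, indicator_of_mem (mem_Iio.2 h3.2)]

theorem resPos_extNeg (f : L1Neg) : resPos (extNeg f) = 0 := by
  refine Lp.ext ?_
  filter_upwards [resPos_coe (extNeg f), ae_velPos_of_velAll (extNeg_coe f),
    ae_restrict_mem measurableSet_Ioo, Lp.coeFn_zero ℂ 1 velPos] with v h1 h2 h3 h4
  rw [h1, h2, h4, indicator_of_notMem (notMem_Iio.2 h3.1.le), Pi.zero_apply]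

theorem resNeg_extPos (f : L1Pos) : resNeg (extPos f) = 0 := by
  refine Lp.ext ?_
  filter_upwards [resNeg_coe (extPos f), ae_velNeg_of_velAll (extPos_coe f),
    ae_restrict_mem measurableSet_Ioo, Lp.coeFn_zero ℂ 1 velNeg] with v h1 h2 h3 h4
  rw [h1, h2, h4, indicator_of_notMem (notMem_Ioi.2 h3.2.le), Pi.zero_apply]

theorem velAll_ext {f g : L1Vel} (hp : resPos f = resPos g) (hn : resNeg f = resNeg g) : f = g := by
  refine Lp.ext (ae_velAll_of_pos_of_neg ?_ ?_)
  · filter_upwards [resPos_coe f, resPos_coe g] with v h1 h2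
    rw [← h1, ← h2, hp]
  · filter_upwards [resNeg_coe f, resNeg_coe g] with v h1 h2
    rw [← h1, ← h2, hn]

theorem norm_resPos_add_norm_resNeg_le (f : L1Vel) : ‖resPos f‖ + ‖resNeg f‖ ≤ ‖f‖ := by
  have h : ‖resPos f‖ₑ + ‖resNeg f‖ₑ ≤ ‖f‖ₑ := by
    rw [enorm_L1, enorm_L1, enorm_L1,
      lintegral_congr_ae ((resPos_coe f).mono fun v hv => congrArg (fun z => ‖z‖ₑ) hv),
      lintegral_congr_ae ((resNeg_coe f).mono fun v hv => congrArg (fun z => ‖z‖ₑ) hv)]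
    rw [← lintegral_union measurableSet_Ioo]
    · refine lintegral_mono_set ?_
      rintro x (hx | hx)
      · exact ⟨by linarith [hx.1], hx.2⟩
      · exact ⟨hx.1, by linarith [hx.2]⟩
    · rw [Set.disjoint_left]
      exact fun x hx hx' => lt_asymm hx.1 hx'.2
  have h' : ‖resPos f‖₊ + ‖resNeg f‖₊ ≤ ‖f‖₊ := by
    simp only [enorm_eq_nnnorm] at h
    exact_mod_cast h
  exact_mod_cast h'

theorem norm_extPos_le : ‖extPos‖ ≤ 1 := norm_wcomp_le _

theorem norm_extNeg_le : ‖extNeg‖ ≤ 1 := norm_wcomp_le _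

/-- Multiplication by `|v|` for speeds less than `1`. -/
def speed (μ : Measure ℝ) : Lp ℂ 1 μ →L[ℂ] Lp ℂ 1 μ := clip μ measurable_id 1

theorem speed_fade (μ : Measure ℝ) (c : ℝ) (z : ℂ) :
    (speed μ).comp (fade μ c z) = (fade μ c z).comp (speed μ) := clip_comp_damp _ _ _ _

theorem resPos_speed : (speed velPos).comp resPos = resPos.comp (speed velAll) :=
  clip_comp_wcomp _ _ _ (fun _ => rfl) _

theorem resNeg_speed : (speed velNeg).comp resNeg = resNeg.comp (speed velAll) :=
  clip_comp_wcomp _ _ _ (fun _ => rfl) _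

theorem resPos_fade (c : ℝ) (z : ℂ) :
    (fade velPos c z).comp resPos = resPos.comp (fade velAll c z) :=
  damp_comp_wcomp _ _ _ _ _ (fun _ => rfl) (fun _ => rfl) _

theorem resNeg_fade (c : ℝ) (z : ℂ) :
    (fade velNeg c z).comp resNeg = resNeg.comp (fade velAll c z) :=
  damp_comp_wcomp _ _ _ _ _ (fun _ => rfl) (fun _ => rfl) _

/-- The operator exchanging the signs of velocities through `A` and `B`. -/
def crossOp (A : L1Neg →L[ℂ] L1Pos) (B : L1Pos →L[ℂ] L1Neg) : L1Vel →L[ℂ] L1Vel :=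
  extPos.comp (A.comp resNeg) + extNeg.comp (B.comp resPos)

/-- The operator preserving the signs of velocities through `P` and `Q`. -/
def diagOp (P : L1Pos →L[ℂ] L1Pos) (Q : L1Neg →L[ℂ] L1Neg) : L1Vel →L[ℂ] L1Vel :=
  extPos.comp (P.comp resPos) + extNeg.comp (Q.comp resNeg)

theorem resPos_crossOp (A : L1Neg →L[ℂ] L1Pos) (B : L1Pos →L[ℂ] L1Neg) (f : L1Vel) :
    resPos (crossOp A B f) = A (resNeg f) := by
  simp [crossOp, resPos_extPos, resPos_extNeg]

theorem resNeg_crossOp (A : L1Neg →L[ℂ] L1Pos) (B : L1Pos →L[ℂ] L1Neg) (f : L1Vel) :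
    resNeg (crossOp A B f) = B (resPos f) := by
  simp [crossOp, resNeg_extPos, resNeg_extNeg]

theorem resPos_diagOp (P : L1Pos →L[ℂ] L1Pos) (Q : L1Neg →L[ℂ] L1Neg) (f : L1Vel) :
    resPos (diagOp P Q f) = P (resPos f) := by
  simp [diagOp, resPos_extPos, resPos_extNeg]

theorem resNeg_diagOp (P : L1Pos →L[ℂ] L1Pos) (Q : L1Neg →L[ℂ] L1Neg) (f : L1Vel) :
    resNeg (diagOp P Q f) = Q (resNeg f) := by
  simp [diagOp, resNeg_extPos, resNeg_extNeg]

theorem norm_ext_add_ext_le {C : ℝ} (hC : 0 ≤ C) (f : L1Vel) {g : L1Pos} {g' : L1Neg}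
    {x y : ℝ} (hxy : x + y ≤ ‖f‖) (hg : ‖g‖ ≤ C * x) (hg' : ‖g'‖ ≤ C * y) :
    ‖extPos g + extNeg g'‖ ≤ C * ‖f‖ :=
  calc ‖extPos g + extNeg g'‖ ≤ ‖extPos g‖ + ‖extNeg g'‖ := norm_add_le _ _
    _ ≤ ‖g‖ + ‖g'‖ := by
      have h1 := extPos.le_of_opNorm_le norm_extPos_le g
      have h2 := extNeg.le_of_opNorm_le norm_extNeg_le g'
      linarith
    _ ≤ C * (x + y) := by linarith
    _ ≤ _ := by gcongr

theorem norm_crossOp_le {A : L1Neg →L[ℂ] L1Pos} {B : L1Pos →L[ℂ] L1Neg} {C : ℝ} (hA : ‖A‖ ≤ C)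
    (hB : ‖B‖ ≤ C) : ‖crossOp A B‖ ≤ C := by
  have hC := (norm_nonneg A).trans hA
  refine ContinuousLinearMap.opNorm_le_bound _ hC fun f => ?_
  refine norm_ext_add_ext_le hC f (x := ‖resNeg f‖) (y := ‖resPos f‖) ?_ ?_ ?_
  · linarith [norm_resPos_add_norm_resNeg_le f]
  · exact A.le_of_opNorm_le hA _
  · exact B.le_of_opNorm_le hB _

theorem norm_diagOp_le {P : L1Pos →L[ℂ] L1Pos} {Q : L1Neg →L[ℂ] L1Neg} {C : ℝ} (hP : ‖P‖ ≤ C)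
    (hQ : ‖Q‖ ≤ C) : ‖diagOp P Q‖ ≤ C := by
  have hC := (norm_nonneg P).trans hP
  refine ContinuousLinearMap.opNorm_le_bound _ hC fun f => ?_
  refine norm_ext_add_ext_le hC f (x := ‖resPos f‖) (y := ‖resNeg f‖) ?_ ?_ ?_
  · exact norm_resPos_add_norm_resNeg_le f
  · exact P.le_of_opNorm_le hP _
  · exact Q.le_of_opNorm_le hQ _

variable (O₁ : L1Neg →L[ℂ] L1Pos) (O₂ : L1Pos →L[ℂ] L1Neg) (c : ℝ) (z : ℂ)

/-- One crossing of the slab followed by a collision with a wall. -/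
def crossing : L1Vel →L[ℂ] L1Vel := (crossOp O₁ O₂).comp (fade velAll c z)

theorem resPos_crossing (f : L1Vel) :
    resPos (crossing O₁ O₂ c z f) = O₁ (fade velNeg c z (resNeg f)) := by
  rw [crossing, ContinuousLinearMap.comp_apply, resPos_crossOp]
  exact congrArg O₁ (DFunLike.congr_fun (resNeg_fade c z) f).symm

theorem resNeg_crossing (f : L1Vel) :
    resNeg (crossing O₁ O₂ c z f) = O₂ (fade velPos c z (resPos f)) := by
  rw [crossing, ContinuousLinearMap.comp_apply, resNeg_crossOp]
  exact congrArg O₂ (DFunLike.congr_fun (resPos_fade c z) f).symm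

theorem clm_pow_three_apply {E : Type*} [NormedAddCommGroup E] [NormedSpace ℂ E] (A : E →L[ℂ] E)
    (f : E) : (A ^ 3) f = A (A (A f)) := by
  rw [pow_succ', pow_two]
  rfl

/-- Three is the least power in which both blocks contain `O₁ E O₂`, the combination with the
smoothing property: in the square, the negative block is `O₂ E O₁ E`. -/
theorem crossing_pow_three :
    crossing O₁ O₂ c z ^ 3 =
      crossOp ((O₁.comp ((fade velNeg c z).comp O₂)).comp ((fade velPos c z).comp
          (O₁.comp (fade velNeg c z))))
        (O₂.comp ((fade velPos c z).comp ((O₁.comp ((fade velNeg c z).comp O₂)).comp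
          (fade velPos c z)))) := by
  ext1 f
  rw [clm_pow_three_apply]
  refine velAll_ext ?_ ?_
  · simp only [resPos_crossing, resNeg_crossing, resPos_crossOp, ContinuousLinearMap.comp_apply]
  · simp only [resPos_crossing, resNeg_crossing, resNeg_crossOp, ContinuousLinearMap.comp_apply]

variable {O₁ O₂ c z}

theorem norm_comp_le_of_le {E F G : Type*} [NormedAddCommGroup E] [NormedSpace ℂ E]
    [NormedAddCommGroup F] [NormedSpace ℂ F] [NormedAddCommGroup G] [NormedSpace ℂ G]
    {A : F →L[ℂ] G} {B : E →L[ℂ] F} {a b : ℝ} (hA : ‖A‖ ≤ a) (hB : ‖B‖ ≤ b) :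
    ‖A.comp B‖ ≤ a * b :=
  (ContinuousLinearMap.opNorm_comp_le _ _).trans
    (mul_le_mul hA hB (norm_nonneg _) ((norm_nonneg _).trans hA))

theorem crossing_comp_crossing (O₁ : L1Neg →L[ℂ] L1Pos) (O₂ : L1Pos →L[ℂ] L1Neg) (c : ℝ) (z : ℂ) :
    (crossing O₁ O₂ c z).comp (crossing O₁ O₂ c z) =
      diagOp ((O₁.comp (fade velNeg c z)).comp (O₂.comp (fade velPos c z)))
        ((O₂.comp (fade velPos c z)).comp (O₁.comp (fade velNeg c z))) := by
  ext1 f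
  refine velAll_ext ?_ ?_
  · simp only [resPos_crossing, resNeg_crossing, resPos_diagOp, ContinuousLinearMap.comp_apply]
  · simp only [resPos_crossing, resNeg_crossing, resNeg_diagOp, ContinuousLinearMap.comp_apply]

theorem diagOp_comp_diagOp (P P' : L1Pos →L[ℂ] L1Pos) (Q Q' : L1Neg →L[ℂ] L1Neg) :
    (diagOp P Q).comp (diagOp P' Q') = diagOp (P.comp P') (Q.comp Q') := by
  ext1 f
  refine velAll_ext ?_ ?_
  · simp only [resPos_diagOp, ContinuousLinearMap.comp_apply]
  · simp only [resNeg_diagOp, ContinuousLinearMap.comp_apply]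

theorem clm_pow_four {E : Type*} [NormedAddCommGroup E] [NormedSpace ℂ E] (A : E →L[ℂ] E) :
    A ^ 4 = (A.comp A).comp (A.comp A) := by
  rw [show 4 = 2 + 2 from rfl, pow_add, pow_two]
  rfl

/-- The word `A Q B P A Q B P` contains both `A Q B P A` and `B P A Q B`, and the remaining letters
are contractions. -/
theorem norm_alternating_le {E F : Type*} [NormedAddCommGroup E] [NormedSpace ℂ E]
    [NormedAddCommGroup F] [NormedSpace ℂ F] {A : F →L[ℂ] E} {B : E →L[ℂ] F} {P : E →L[ℂ] E}
    {Q : F →L[ℂ] F} (hA : ‖A‖ ≤ 1) (hB : ‖B‖ ≤ 1) (hP : ‖P‖ ≤ 1) (hQ : ‖Q‖ ≤ 1) {C : ℝ}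
    (hC : ‖A.comp (Q.comp (B.comp (P.comp A)))‖ ≤ C ∨ ‖B.comp (P.comp (A.comp (Q.comp B)))‖ ≤ C) :
    ‖((A.comp Q).comp (B.comp P)).comp ((A.comp Q).comp (B.comp P))‖ ≤ C := by
  rcases hC with hC | hC
  · have := norm_comp_le_of_le hC (norm_comp_le_of_le hQ (norm_comp_le_of_le hB hP))
    simp only [mul_one] at this
    exact this
  · have := norm_comp_le_of_le hA (norm_comp_le_of_le hQ (norm_comp_le_of_le hC hP))
    simp only [mul_one, one_mul] at this
    exact this

/-- The fourth power preserves the sign of the velocity. Each of its two blocks has both alternating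
five-letter words as factors, so a bound for either word is enough. -/
theorem norm_crossing_pow_four_le (h₁ : ‖O₁‖ ≤ 1) (h₂ : ‖O₂‖ ≤ 1) {C : ℝ}
    (hC : ‖O₁.comp ((fade velNeg c z).comp (O₂.comp ((fade velPos c z).comp O₁)))‖ ≤ C ∨
      ‖O₂.comp ((fade velPos c z).comp (O₁.comp ((fade velNeg c z).comp O₂)))‖ ≤ C) :
    ‖crossing O₁ O₂ c z ^ 4‖ ≤ C := by
  have hfp := norm_fade_le velPos c z
  have hfn := norm_fade_le velNeg c z
  rw [clm_pow_four, crossing_comp_crossing, diagOp_comp_diagOp]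
  exact norm_diagOp_le (norm_alternating_le h₁ h₂ hfp hfn hC)
    (norm_alternating_le h₂ h₁ hfn hfp hC.symm)

/-- Speeds are at most 1, so every crossing takes time at least `c`. -/
theorem norm_fade_le_exp (hc : 0 ≤ c) {z : ℂ} (hz : 0 ≤ z.re) :
    ‖fade velAll c z‖ ≤ Real.exp (-(z.re * c)) := by
  refine ContinuousLinearMap.opNorm_le_bound _ (Real.exp_pos _).le fun f => ?_
  rw [norm_L1, norm_L1, ← integral_const_mul]
  refine integral_mono_ae (L1.integrable_coeFn _).norm
    ((L1.integrable_coeFn f).norm.const_mul _) ?_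
  filter_upwards [damp_coe (y := fun _ => c) measurable_const (r := id) measurable_id z f,
    ae_velAll] with v h1 h2
  simp only [fade, h1, norm_mul, norm_dampSymbol, rightHalf_of_nonneg hz, abs_of_nonneg hc, id]
  gcongr
  exact le_div_self hc h2.1 h2.2

theorem norm_crossing_lt_one (hc : 0 < c) (h₁ : ‖O₁‖ ≤ 1) (h₂ : ‖O₂‖ ≤ 1) (hz : 0 < z.re) :
    ‖crossing O₁ O₂ c z‖ < 1 := by
  have h := norm_comp_le_of_le (norm_crossOp_le h₁ h₂) (norm_fade_le_exp hc.le hz.le)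
  refine h.trans_lt ?_
  rw [one_mul, Real.exp_lt_one_iff]
  exact neg_lt_zero.2 (by positivity)

end Velocities

/-! ### Inverting 1 - A from its fourth power, and on weighted spaces. -/

section Inverse

set_option linter.unusedSectionVars false

variable {Y : Type*} [NormedAddCommGroup Y] [NormedSpace ℂ Y] [CompleteSpace Y]

theorem isUnit_one_sub_of_norm_pow_four_lt {A : Y →L[ℂ] Y} (h : ‖A ^ 4‖ < 1) : IsUnit (1 - A) := by
  have h1 : IsUnit (1 - A ^ 4) := isUnit_one_sub_of_norm_lt_one h
  have e : 1 - A ^ 4 = (1 - A) * (1 + A + A ^ 2 + A ^ 3) := by noncomm_ring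
  have hc : Commute (1 - A) (1 + A + A ^ 2 + A ^ 3) := by
    rw [commute_iff_eq]; noncomm_ring
  rw [e] at h1
  exact (hc.isUnit_mul_iff.1 h1).1

/-- With `R` the inverse, `R = 1 + A + A² + A³ + A⁴ R`, so `‖R‖ ≤ 4 + C ‖R‖`. -/
theorem norm_inverse_one_sub_le [Nontrivial Y] {A : Y →L[ℂ] Y} (hA : ‖A‖ ≤ 1) {C : ℝ} (hC : C < 1)
    (h : ‖A ^ 4‖ ≤ C) : ‖Ring.inverse (1 - A)‖ ≤ 4 / (1 - C) := by
  have hu := isUnit_one_sub_of_norm_pow_four_lt (h.trans_lt hC)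
  set R := Ring.inverse (1 - A) with hR
  have h1 : (1 - A) * R = 1 := Ring.mul_inverse_cancel _ hu
  have e : R = (1 + A + A ^ 2 + A ^ 3) + A ^ 4 * R := by
    have : (1 + A + A ^ 2 + A ^ 3) * ((1 - A) * R) = 1 + A + A ^ 2 + A ^ 3 := by rw [h1, mul_one]
    rw [← this]
    noncomm_ring
  have hp : ∀ n, ‖A ^ n‖ ≤ 1 := fun n => (norm_pow_le A n).trans (pow_le_one₀ (norm_nonneg _) hA)
  have h3 : ‖1 + A + A ^ 2 + A ^ 3‖ ≤ 4 := by
    have b1 := norm_add_le (1 + A + A ^ 2) (A ^ 3)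
    have b2 := norm_add_le (1 + A) (A ^ 2)
    have b3 := norm_add_le 1 A
    have b4 : ‖(1 : Y →L[ℂ] Y)‖ ≤ 1 := norm_one.le
    linarith [hp 2, hp 3]
  have h4 : ‖R‖ ≤ 4 + C * ‖R‖ := by
    calc ‖R‖ = ‖(1 + A + A ^ 2 + A ^ 3) + A ^ 4 * R‖ := by rw [← e]
      _ ≤ ‖1 + A + A ^ 2 + A ^ 3‖ + ‖A ^ 4 * R‖ := norm_add_le _ _
      _ ≤ 4 + C * ‖R‖ := by
        refine add_le_add h3 ((norm_mul_le _ _).trans ?_)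
        gcongr
  rw [le_div_iff₀ (by linarith)]
  linarith

/-- The inverse of `1 - A'` from that of `1 - A`, when `A' = J⁻ᵐ A Jᵐ` and `A ^ 3` is divisible by
`Jᵐ`. -/
theorem weighted_inverse {J A A' S R : Y →L[ℂ] Y} (hJ : Function.Injective J)
    (hA : J * A' = A * J) (hS : J * S = A ^ 3) (h1 : R * (1 - A) = 1) (h2 : (1 - A) * R = 1) :
    J * (1 + A' + A' ^ 2 + S * R * J) = R * J ∧
      (1 + A' + A' ^ 2 + S * R * J) * (1 - A') = 1 ∧
      (1 - A') * (1 + A' + A' ^ 2 + S * R * J) = 1 := by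
  have hcancel : ∀ X X' : Y →L[ℂ] Y, J * X = J * X' → X = X' := fun X X' h => by
    ext1 x
    exact hJ (DFunLike.congr_fun h x)
  -- In this finite Neumann expansion `1`, `A`, `A ^ 2` can be conjugated by `J` through `A'`. The
  -- only term involving `R` comes after `A ^ 3`, from which a factor `J` splits off. This dictates
  -- the form of the candidate inverse `1 + A' + A' ^ 2 + S * R * J`.
  have hR : R = 1 + A + A ^ 2 + A ^ 3 * R := by
    have : (1 + A + A ^ 2) * ((1 - A) * R) = 1 + A + A ^ 2 := by rw [h2, mul_one]
    rw [← this]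
    noncomm_ring
  have hA2 : J * A' ^ 2 = A ^ 2 * J := by
    rw [pow_two, ← mul_assoc, hA, mul_assoc, hA, ← mul_assoc, ← pow_two]
  have hQ : J * (1 + A' + A' ^ 2 + S * R * J) = R * J := by
    calc J * (1 + A' + A' ^ 2 + S * R * J) = J + J * A' + J * A' ^ 2 + J * S * R * J := by
          noncomm_ring
      _ = (1 + A + A ^ 2 + A ^ 3 * R) * J := by rw [hA, hA2, hS]; noncomm_ring
      _ = R * J := by rw [← hR]
  refine ⟨hQ, hcancel _ _ ?_, hcancel _ _ ?_⟩
  · rw [← mul_assoc, hQ, mul_sub, mul_one, mul_assoc, hA, mul_one, ← mul_assoc]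
    calc R * J - R * A * J = (R * (1 - A)) * J := by noncomm_ring
      _ = J := by rw [h1, one_mul]
  · calc J * ((1 - A') * (1 + A' + A' ^ 2 + S * R * J))
        = (1 - A) * (J * (1 + A' + A' ^ 2 + S * R * J)) := by
          rw [← mul_assoc, mul_sub, mul_one, hA]
          noncomm_ring
      _ = J * 1 := by rw [hQ, ← mul_assoc, h2, one_mul, mul_one]

end Inverse


/-! ### Lifting the wall operators and their resolvent to all weighted spaces. -/

section Levels

theorem pow_comp_of_comp {E F : Type*} [NormedAddCommGroup E] [NormedSpace ℂ E]
    [NormedAddCommGroup F] [NormedSpace ℂ F] {A : F →L[ℂ] F} {B : E →L[ℂ] E} {T : E →L[ℂ] F}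
    (h : A.comp T = T.comp B) (m : ℕ) : (A ^ m).comp T = T.comp (B ^ m) := by
  induction m with
  | zero => rfl
  | succ m ih =>
    ext1 x
    have h1 := DFunLike.congr_fun h x
    have h2 := DFunLike.congr_fun ih (B x)
    simp only [ContinuousLinearMap.comp_apply] at h1 h2
    simp only [ContinuousLinearMap.comp_apply, pow_succ, mul_apply_eq_comp, h1, h2]

theorem pow_injective_of_injective {E : Type*} [NormedAddCommGroup E] [NormedSpace ℂ E]
    {A : E →L[ℂ] E} (h : Function.Injective A) (m : ℕ) : Function.Injective (A ^ m) := by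
  induction m with
  | zero => exact Function.injective_id
  | succ m ih =>
    intro x y hxy
    rw [pow_succ, mul_apply_eq_comp, mul_apply_eq_comp] at hxy
    exact h (ih hxy)

/-- Both sides become `O (J ^ (m + 1))` after multiplication by `J' ^ m`, which is injective. -/
theorem comm_of_pow_comm {E F : Type*} [NormedAddCommGroup E] [NormedSpace ℂ E]
    [NormedAddCommGroup F] [NormedSpace ℂ F] {J : E →L[ℂ] E} {J' : F →L[ℂ] F}
    (hJ' : Function.Injective J') {L : ℕ → E →L[ℂ] F} {O : E →L[ℂ] F} {n : ℕ}
    (h : ∀ m, m ≤ n → (J' ^ m).comp (L m) = O.comp (J ^ m)) {m : ℕ} (hm : m < n) :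
    J'.comp (L (m + 1)) = (L m).comp J := by
  ext1 x
  apply pow_injective_of_injective hJ' m
  have h1 := DFunLike.congr_fun (h (m + 1) hm) x
  have h2 := DFunLike.congr_fun (h m hm.le) (J x)
  simp only [ContinuousLinearMap.comp_apply, pow_succ, mul_apply_eq_comp] at h1 h2 ⊢
  rw [h1, h2]

variable {μ ν : Measure ℝ}

theorem speed_injective (hμ : ∀ᵐ v ∂μ, 0 < |v| ∧ |v| ≤ 1) : Function.Injective (speed μ) :=
  clip_injective measurable_id zero_lt_one (hμ.mono fun _ h => h.1)

theorem speed_pow_coe (hμ : ∀ᵐ v ∂μ, 0 < |v| ∧ |v| ≤ 1) (n : ℕ) (f : Lp ℂ 1 μ) :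
    (speed μ ^ n) f =ᵐ[μ] fun v => ((|v| ^ n : ℝ) : ℂ) * f v :=
  clip_pow_coe measurable_id (hμ.mono fun _ h => h.2) n f

theorem exists_levels (hμ : ∀ᵐ v ∂μ, 0 < |v| ∧ |v| ≤ 1) (hν : ∀ᵐ v ∂ν, 0 < |v| ∧ |v| ≤ 1)
    {O : Lp ℂ 1 μ →L[ℂ] Lp ℂ 1 ν} {n : ℕ} (h : ∀ m, m ≤ n → IsBoundedWeighted m O m) :
    ∃ L : ℕ → Lp ℂ 1 μ →L[ℂ] Lp ℂ 1 ν,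
      ∀ m, m ≤ n → (speed ν ^ m).comp (L m) = O.comp (speed μ ^ m) := by
  have : ∀ m, ∃ L : Lp ℂ 1 μ →L[ℂ] Lp ℂ 1 ν, m ≤ n →
      (speed ν ^ m).comp L = O.comp (speed μ ^ m) := fun m => by
    by_cases hm : m ≤ n
    · obtain ⟨C, hC⟩ := h m hm
      obtain ⟨S, hS, -⟩ := exists_clip_pow_factor measurable_id hν m (O.comp (speed μ ^ m)) C
        fun e => hC e _ (speed_pow_coe hμ m e)
      exact ⟨S, fun _ => hS⟩
    · exact ⟨0, fun h => absurd h hm⟩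
  choose L hL using this
  exact ⟨L, hL⟩

theorem isBoundedWeighted_zero (O : Lp ℂ 1 μ →L[ℂ] Lp ℂ 1 ν) : IsBoundedWeighted 0 O 0 := by
  refine ⟨‖O‖₊, fun f g hg => ?_⟩
  have e : g = f := Lp.ext (hg.trans (Eventually.of_forall fun v => by simp))
  subst e
  simp only [pow_zero, inv_one, ENNReal.ofReal_one, one_mul, ← enorm_L1]
  exact enorm_le_of_norm_le (O.le_opNorm g)

theorem speed_pow_comp_crossOp (m : ℕ) (A : L1Neg →L[ℂ] L1Pos) (B : L1Pos →L[ℂ] L1Neg) :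
    (speed velAll ^ m).comp (crossOp A B) =
      crossOp ((speed velPos ^ m).comp A) ((speed velNeg ^ m).comp B) := by
  ext1 f
  have h1 := fun x => DFunLike.congr_fun (pow_comp_of_comp resPos_speed m) x
  have h2 := fun x => DFunLike.congr_fun (pow_comp_of_comp resNeg_speed m) x
  simp only [ContinuousLinearMap.comp_apply] at h1 h2
  refine velAll_ext ?_ ?_
  · simp only [ContinuousLinearMap.comp_apply, ← h1, resPos_crossOp]
  · simp only [ContinuousLinearMap.comp_apply, ← h2, resNeg_crossOp]

theorem crossOp_comp_speed_pow (m : ℕ) (A : L1Neg →L[ℂ] L1Pos) (B : L1Pos →L[ℂ] L1Neg) :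
    (crossOp A B).comp (speed velAll ^ m) =
      crossOp (A.comp (speed velNeg ^ m)) (B.comp (speed velPos ^ m)) := by
  ext1 f
  have h1 := fun x => DFunLike.congr_fun (pow_comp_of_comp resPos_speed m) x
  have h2 := fun x => DFunLike.congr_fun (pow_comp_of_comp resNeg_speed m) x
  simp only [ContinuousLinearMap.comp_apply] at h1 h2
  refine velAll_ext ?_ ?_
  · simp only [ContinuousLinearMap.comp_apply, resPos_crossOp, h2]
  · simp only [ContinuousLinearMap.comp_apply, resNeg_crossOp, h1]

/-- The hypothesis on `O₁ O₂` says nothing directly about the product with an oscillating factor in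
between. Positivity helps: `|O₁ E O₂ f| ≤ O₁ O₂ |f|` almost everywhere, so the weighted bound is
inherited with a constant independent of `z`. -/
theorem exists_smoothing {O₁ : L1Neg →L[ℂ] L1Pos} {O₂ : L1Pos →L[ℂ] L1Neg}
    (h₁ : ∀ f F, Majorizes f F → Majorizes (O₁ f) (O₁ F))
    (h₂ : ∀ f F, Majorizes f F → Majorizes (O₂ f) (O₂ F)) {n : ℕ}
    (h : IsBoundedWeighted n (O₁.comp O₂) 0) (c : ℝ) :
    ∃ C : ℝ, 0 ≤ C ∧ ∀ z, ∃ S : L1Pos →L[ℂ] L1Pos,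
      (speed velPos ^ n).comp S = O₁.comp ((fade velNeg c z).comp O₂) ∧ ‖S‖ ≤ C := by
  obtain ⟨C, hC⟩ := h
  refine ⟨C, C.2, fun z => ?_⟩
  refine exists_clip_pow_factor measurable_id ae_velPos n _ C fun f => ?_
  obtain ⟨F, hF, hFn⟩ := exists_majorizes_self f
  have h3 := h₁ _ _ ((h₂ _ _ hF).fade (c := c) (z := z))
  rw [← hFn]
  refine le_trans ?_ (hC F F (Eventually.of_forall fun v => by simp))
  refine lintegral_mono_ae ?_
  filter_upwards [h3.enorm_le] with v hv
  exact mul_le_mul_right hv _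

/-- The inverses of `1 - H E`, on all weighted spaces up to the order `n`. -/
structure WallResolvent (O₁ : L1Neg →L[ℂ] L1Pos) (O₂ : L1Pos →L[ℂ] L1Neg) (c : ℝ) (n : ℕ)
    (H : ℕ → L1Vel →L[ℂ] L1Vel) (R : ℕ → ℂ → L1Vel →L[ℂ] L1Vel) (C : ℝ) : Prop where
  pow_comp : ∀ m, m ≤ n → (speed velAll ^ m).comp (H m) = (crossOp O₁ O₂).comp (speed velAll ^ m)
  norm_le : ∀ m z, m ≤ n → 0 ≤ z.re → z.im ≠ 0 → ‖R m z‖ ≤ C * omega z.im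
  pow_comp_res : ∀ m z, m ≤ n → 0 ≤ z.re → z.im ≠ 0 → (speed velAll ^ m).comp (R m z) =
    (Ring.inverse (1 - crossing O₁ O₂ c z)).comp (speed velAll ^ m)
  left_inv : ∀ m z x, m ≤ n → 0 ≤ z.re → z.im ≠ 0 → R m z (x - H m (fade velAll c z x)) = x
  right_inv : ∀ m z x, m ≤ n → 0 ≤ z.re → z.im ≠ 0 →
    R m z x - H m (fade velAll c z (R m z x)) = x

theorem inv_min_one_le_omega {s κ : ℝ} (hs : s ≠ 0) (hκ : 0 < κ) :
    4 / (1 - (1 - κ * min 1 (s ^ 2))) ≤ 4 / κ * omega s := by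
  have h1 : 0 < s ^ 2 := by positivity
  have h2 : 0 < min 1 (s ^ 2) := lt_min one_pos h1
  have h3 : (min 1 (s ^ 2))⁻¹ ≤ omega s := by
    rcases min_choice 1 (s ^ 2) with h | h
    · rw [h, inv_one]; exact one_le_omega s
    · rw [h]; exact le_max_right _ _
  calc 4 / (1 - (1 - κ * min 1 (s ^ 2))) = 4 / κ * (min 1 (s ^ 2))⁻¹ := by
        rw [sub_sub_cancel]; field_simp
    _ ≤ _ := by gcongr

instance : Nontrivial L1Vel := by
  refine ⟨indicatorConstLp 1 (measurableSet_Ioo (a := (-1 : ℝ)) (b := 1)) (by simp) 1, 0, ?_⟩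
  rw [← norm_ne_zero_iff, norm_indicatorConstLp one_ne_zero ENNReal.one_ne_top]
  simp [measureReal_def]

theorem norm_speed_le (μ : Measure ℝ) : ‖speed μ‖ ≤ 1 := by
  have : ‖speed μ‖ ≤ ((1 : ℝ≥0) : ℝ) := norm_wcomp_le (wcomp_min μ measurable_id 1)
  simpa using this

theorem exists_wallResolvent {O₁ : L1Neg →L[ℂ] L1Pos} {O₂ : L1Pos →L[ℂ] L1Neg} {c : ℝ} {n : ℕ}
    (hO₁ : ‖O₁‖ ≤ 1) (hO₂ : ‖O₂‖ ≤ 1)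
    (hL₁ : ∀ m, m ≤ n → IsBoundedWeighted m O₁ m) (hL₂ : ∀ m, m ≤ n → IsBoundedWeighted m O₂ m)
    {D : ℝ} (hD : 0 ≤ D) (hS : ∀ z, ∃ S : L1Pos →L[ℂ] L1Pos,
      (speed velPos ^ n).comp S = O₁.comp ((fade velNeg c z).comp O₂) ∧ ‖S‖ ≤ D)
    {κ : ℝ} (hκ : 0 < κ)
    (hcontr : ∀ z : ℂ, 0 ≤ z.re → ‖crossing O₁ O₂ c z ^ 4‖ ≤ 1 - κ * min 1 (z.im ^ 2)) :
    ∃ H R C, WallResolvent O₁ O₂ c n H R C := by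
  obtain ⟨L₁, hL₁⟩ := exists_levels ae_velNeg ae_velPos hL₁
  obtain ⟨L₂, hL₂⟩ := exists_levels ae_velPos ae_velNeg hL₂
  choose S hS hSD using hS
  set J := speed velAll with hJ
  set A : ℂ → L1Vel →L[ℂ] L1Vel := fun z => crossing O₁ O₂ c z with hA
  set H : ℕ → L1Vel →L[ℂ] L1Vel := fun m => crossOp (L₁ m) (L₂ m) with hH
  have hHm : ∀ m, m ≤ n → (J ^ m).comp (H m) = (crossOp O₁ O₂).comp (J ^ m) := fun m hm => by
    rw [hH, hJ, speed_pow_comp_crossOp, crossOp_comp_speed_pow, hL₁ m hm, hL₂ m hm]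
  have hJi : Function.Injective J := speed_injective ae_velAll
  set A' : ℕ → ℂ → L1Vel →L[ℂ] L1Vel := fun m z => (H m).comp (fade velAll c z) with hA'
  have hAA' : ∀ m z, m ≤ n → J ^ m * A' m z = A z * J ^ m := fun m z hm => by
    ext1 x
    have h1 := fun x => DFunLike.congr_fun (hHm m hm) x
    have h2 := fun x => DFunLike.congr_fun (pow_comp_of_comp (speed_fade velAll c z) m) x
    simp only [ContinuousLinearMap.comp_apply] at h1 h2
    simp only [hA', hA, mul_apply_eq_comp, crossing, ContinuousLinearMap.comp_apply, h1]
    rw [h2]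
  -- The cube of `A z` divided by `J ^ n`. In the positive block the factor `O₁ E O₂` stands first
  -- and is replaced by `S z`. In the negative block the power of the speed must still pass through
  -- `O₂` and a flight, hence `L₂ n`.
  set W : ℂ → L1Vel →L[ℂ] L1Vel := fun z =>
    crossOp ((S z).comp ((fade velPos c z).comp (O₁.comp (fade velNeg c z))))
      ((L₂ n).comp ((fade velPos c z).comp ((S z).comp (fade velPos c z)))) with hW
  have hJW : ∀ z, J ^ n * W z = A z ^ 3 := fun z => by
    rw [hA, crossing_pow_three]
    change (J ^ n).comp (W z) = _
    rw [hW, hJ, speed_pow_comp_crossOp]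
    have e1 := fun x => DFunLike.congr_fun (hS z) x
    have e2 := fun x => DFunLike.congr_fun (hL₂ n le_rfl) x
    have e3 := fun x => DFunLike.congr_fun (pow_comp_of_comp (speed_fade velPos c z) n) x
    simp only [ContinuousLinearMap.comp_apply] at e1 e2 e3
    congr 1
    · ext1 x
      simp only [ContinuousLinearMap.comp_apply, e1]
    · ext1 x
      simp only [ContinuousLinearMap.comp_apply, e2, e3, e1]
  set R₀ : ℂ → L1Vel →L[ℂ] L1Vel := fun z => Ring.inverse (1 - A z) with hR₀
  have hκ' : ∀ z : ℂ, z.im ≠ 0 → 1 - κ * min 1 (z.im ^ 2) < 1 := fun z hz => by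
    have h1 : 0 < z.im ^ 2 := by positivity
    have h2 : 0 < min 1 (z.im ^ 2) := lt_min one_pos h1
    have := mul_pos hκ h2
    linarith
  have hu : ∀ z : ℂ, 0 ≤ z.re → z.im ≠ 0 → IsUnit (1 - A z) := fun z hz hz' =>
    isUnit_one_sub_of_norm_pow_four_lt ((hcontr z hz).trans_lt (hκ' z hz'))
  have hl : ∀ z : ℂ, 0 ≤ z.re → z.im ≠ 0 → R₀ z * (1 - A z) = 1 := fun z hz hz' =>
    Ring.inverse_mul_cancel _ (hu z hz hz')
  have hr : ∀ z : ℂ, 0 ≤ z.re → z.im ≠ 0 → (1 - A z) * R₀ z = 1 := fun z hz hz' =>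
    Ring.mul_inverse_cancel _ (hu z hz hz')
  have hAn : ∀ z, ‖A z‖ ≤ 1 := fun z => by
    have := norm_comp_le_of_le (norm_crossOp_le hO₁ hO₂) (norm_fade_le velAll c z)
    rw [mul_one] at this
    exact this
  have hR₀n : ∀ z : ℂ, 0 ≤ z.re → z.im ≠ 0 → ‖R₀ z‖ ≤ 4 / κ * omega z.im := fun z hz hz' =>
    (norm_inverse_one_sub_le (hAn z) (hκ' z hz') (hcontr z hz)).trans (inv_min_one_le_omega hz' hκ)
  -- For `m < n` the cube is divisible by more than is needed; the surplus is kept as `J ^ (n - m)`.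
  set V : ℕ → ℂ → L1Vel →L[ℂ] L1Vel := fun m z => J ^ (n - m) * W z with hV
  have hJV : ∀ m z, m ≤ n → J ^ m * V m z = A z ^ 3 := fun m z hm => by
    rw [hV, ← hJW z, ← mul_assoc, ← pow_add, Nat.add_sub_cancel' hm]
  set R : ℕ → ℂ → L1Vel →L[ℂ] L1Vel := fun m z =>
    1 + A' m z + A' m z ^ 2 + V m z * R₀ z * J ^ m with hR
  have key : ∀ m z, m ≤ n → 0 ≤ z.re → z.im ≠ 0 →
      J ^ m * R m z = R₀ z * J ^ m ∧ R m z * (1 - A' m z) = 1 ∧ (1 - A' m z) * R m z = 1 :=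
    fun m z hm hz hz' => weighted_inverse (pow_injective_of_injective hJi m) (hAA' m z hm)
      (hJV m z hm) (hl z hz hz') (hr z hz hz')
  have hJn : ‖J‖ ≤ 1 := norm_speed_le velAll
  have hJp : ∀ m, ‖J ^ m‖ ≤ 1 := fun m => (norm_pow_le J m).trans (pow_le_one₀ (norm_nonneg _) hJn)
  set B := ∑ m ∈ Finset.range (n + 1), ‖H m‖ with hB
  have hHB : ∀ m, m ≤ n → ‖H m‖ ≤ B := fun m hm =>
    Finset.single_le_sum (f := fun m => ‖H m‖) (fun _ _ => norm_nonneg _)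
      (Finset.mem_range.2 (Nat.lt_succ_of_le hm))
  have hB0 : 0 ≤ B := Finset.sum_nonneg fun _ _ => norm_nonneg _
  set G := D + ‖L₂ n‖ * D with hG
  have hWn : ∀ z, ‖W z‖ ≤ G := fun z => by
    have hfp := norm_fade_le velPos c z
    have hfn := norm_fade_le velNeg c z
    have b1 := norm_comp_le_of_le (hSD z)
      (norm_comp_le_of_le hfp (norm_comp_le_of_le hO₁ hfn))
    have b2 := norm_comp_le_of_le (le_refl ‖L₂ n‖)
      (norm_comp_le_of_le hfp (norm_comp_le_of_le (hSD z) hfp))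
    simp only [mul_one, one_mul] at b1 b2
    have : 0 ≤ ‖L₂ n‖ * D := by positivity
    exact norm_crossOp_le (b1.trans (by linarith)) (b2.trans (by linarith))
  have hG0 : 0 ≤ G := by positivity
  refine ⟨H, R, 1 + B + B ^ 2 + G * (4 / κ), hHm, fun m z hm hz hz' => ?_,
    fun m z hm hz hz' => (key m z hm hz hz').1, fun m z x hm hz hz' => ?_,
    fun m z x hm hz hz' => ?_⟩
  · have a1 : ‖A' m z‖ ≤ B := by
      have := norm_comp_le_of_le (hHB m hm) (norm_fade_le velAll c z)
      rw [mul_one] at this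
      exact this
    have a2 : ‖A' m z ^ 2‖ ≤ B ^ 2 := (norm_pow_le _ 2).trans (by gcongr)
    have a3 : ‖V m z * R₀ z * J ^ m‖ ≤ G * (4 / κ * omega z.im) := by
      have v1 : ‖V m z‖ ≤ G := by
        refine (norm_mul_le _ _).trans ?_
        calc ‖J ^ (n - m)‖ * ‖W z‖ ≤ 1 * G := by
              gcongr
              · exact hJp _
              · exact hWn z
          _ = G := one_mul G
      calc ‖V m z * R₀ z * J ^ m‖ ≤ ‖V m z * R₀ z‖ * ‖J ^ m‖ := norm_mul_le _ _
        _ ≤ ‖V m z * R₀ z‖ * 1 := by gcongr; exact hJp m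
        _ = ‖V m z * R₀ z‖ := mul_one _
        _ ≤ ‖V m z‖ * ‖R₀ z‖ := norm_mul_le _ _
        _ ≤ _ := by gcongr; exact hR₀n z hz hz'
    have b1 := norm_add_le (1 + A' m z + A' m z ^ 2) (V m z * R₀ z * J ^ m)
    have b2 := norm_add_le (1 + A' m z) (A' m z ^ 2)
    have b3 := norm_add_le 1 (A' m z)
    have b4 : ‖(1 : L1Vel →L[ℂ] L1Vel)‖ ≤ 1 := norm_one.le
    have b5 : ‖R m z‖ ≤ (1 + B + B ^ 2) + G * (4 / κ * omega z.im) := by linarith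
    have b6 : (1 + B + B ^ 2) * 1 ≤ (1 + B + B ^ 2) * omega z.im :=
      mul_le_mul_of_nonneg_left (one_le_omega _) (by positivity)
    calc ‖R m z‖ ≤ (1 + B + B ^ 2) + G * (4 / κ * omega z.im) := b5
      _ ≤ (1 + B + B ^ 2) * omega z.im + G * (4 / κ * omega z.im) := by linarith
      _ = _ := by ring
  · have := DFunLike.congr_fun (key m z hm hz hz').2.1 x
    exact this
  · have := DFunLike.congr_fun (key m z hm hz hz').2.2 x
    exact this

end Levels


/-! ### The hypotheses on the walls deliver the weighted resolvents. -/

section Walls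

theorem norm_maxwell_le {μ ν : Measure ℝ} [SFinite μ] [SFinite ν]
    (h : MeasurePreserving (fun v : ℝ => -v) ν μ) {K : Lp ℂ 1 μ →L[ℂ] Lp ℂ 1 ν} {k : ℝ → ℝ → ℝ}
    (hK : HasKernel K k) (hk : StochKernel ν k) {α β : ℝ} (hα : 0 ≤ α) (hβ : 0 ≤ β)
    (hαβ : α + β = 1) {O : Lp ℂ 1 μ →L[ℂ] Lp ℂ 1 ν}
    (hO : O = (α : ℂ) • reflect h + (β : ℂ) • K) : ‖O‖ ≤ 1 := by
  rw [hO]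
  refine (norm_add_le _ _).trans ?_
  rw [norm_smul, norm_smul, Complex.norm_of_nonneg hα, Complex.norm_of_nonneg hβ]
  have h1 := mul_le_mul_of_nonneg_left (norm_reflect_le h) hα
  have h2 := mul_le_mul_of_nonneg_left (norm_kernel_le hK hk) hβ
  linarith

theorem exists_wallResolvent_of_maxwell {c : ℝ} (hc : 0 < c)
    {α₁ β₁ α₂ β₂ : ℝ} (hα₁ : 0 ≤ α₁) (hβ₁ : 0 ≤ β₁) (hα₂ : 0 ≤ α₂) (hβ₂ : 0 ≤ β₂)
    (hsum₁ : α₁ + β₁ = 1) (hsum₂ : α₂ + β₂ = 1)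
    {K₁ : L1Neg →L[ℂ] L1Pos} {K₂ : L1Pos →L[ℂ] L1Neg}
    (hK₁ : IsStochastic K₁) (hK₂ : IsStochastic K₂) {k₁ k₂ : ℝ → ℝ → ℝ}
    (hk₁ : HasKernel K₁ k₁) (hk₂ : HasKernel K₂ k₂)
    (hcont₁ : ContinuousOn (Function.uncurry k₁) (Icc (0 : ℝ) 1 ×ˢ Icc (-1 : ℝ) 0))
    (hcont₂ : ContinuousOn (Function.uncurry k₂) (Icc (-1 : ℝ) 0 ×ˢ Icc (0 : ℝ) 1))
    {O₁ : L1Neg →L[ℂ] L1Pos} {O₂ : L1Pos →L[ℂ] L1Neg}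
    (hO₁ : O₁ = (α₁ : ℂ) • reflect₁ + (β₁ : ℂ) • K₁)
    (hO₂ : O₂ = (α₂ : ℂ) • reflect₂ + (β₂ : ℂ) • K₂)
    (hdiffuse : O₁ = K₁ ∨ O₂ = K₂) {k : ℕ}
    (hO₁O₂ : IsBoundedWeighted (k + 1) (O₁.comp O₂) 0)
    (hO₁w : IsBoundedWeighted (k + 1) O₁ (k + 1))
    (hO₂w : ∀ p : ℕ, p ≤ k → IsBoundedWeighted (k + 1 - p) O₂ (k + 1 - p)) :
    ‖O₁‖ ≤ 1 ∧ ‖O₂‖ ≤ 1 ∧ ∃ H R C, WallResolvent O₁ O₂ c (k + 1) H R C := by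
  obtain ⟨κ₁, hs₁, hκ₁⟩ := exists_stochKernel velNeg_eq velPos_eq hK₁ hk₁
    (by convert hcont₁ using 2 <;> norm_num)
  obtain ⟨κ₂, hs₂, hκ₂⟩ := exists_stochKernel velPos_eq velNeg_eq hK₂ hk₂
    (by convert hcont₂ using 2 <;> norm_num)
  have n₁ : ‖O₁‖ ≤ 1 := norm_maxwell_le measurePreserving_neg_pos hκ₁ hs₁ hα₁ hβ₁ hsum₁ hO₁
  have n₂ : ‖O₂‖ ≤ 1 := norm_maxwell_le measurePreserving_neg_neg hκ₂ hs₂ hα₂ hβ₂ hsum₂ hO₂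
  have hpos0 : ∀ᵐ v ∂velPos, v ≠ 0 := ae_velPos.mono fun v hv => abs_pos.1 hv.1
  have l₁ : ∀ m, m ≤ k + 1 → IsBoundedWeighted m O₁ m := fun m hm =>
    IsBoundedWeighted.of_le measurePreserving_neg_pos ae_velNeg hpos0 hκ₁ hs₁ hO₁ hm hO₁w
  have l₂ : ∀ m, m ≤ k + 1 → IsBoundedWeighted m O₂ m := fun m hm => by
    -- The orders assumed for `O₂` are `k + 1 - p` with `p ≤ k`, that is, 1 to `k + 1`; order 0 is
    -- plain boundedness. For `O₁`, only the top order is assumed and the others are interpolated.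
    rcases Nat.eq_zero_or_pos m with rfl | h0
    · exact isBoundedWeighted_zero O₂
    · have := hO₂w (k + 1 - m) (by omega)
      rwa [Nat.sub_sub_self hm] at this
  obtain ⟨D, hD, hS⟩ := exists_smoothing
    (fun f F h => Majorizes.combination measurePreserving_neg_pos hκ₁ hs₁ hα₁ hβ₁ hO₁ h)
    (fun f F h => Majorizes.combination measurePreserving_neg_neg hκ₂ hs₂ hα₂ hβ₂ hO₂ h) hO₁O₂ c
  have hcontr : ∃ κ : ℝ, 0 < κ ∧ ∀ z : ℂ, 0 ≤ z.re →
      ‖crossing O₁ O₂ c z ^ 4‖ ≤ 1 - κ * min 1 (z.im ^ 2) := by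
    -- The two cases are mirror images: the diffuse wall supplies the outer operators of the
    -- contracting word.
    rcases hdiffuse with h | h
    · obtain ⟨κ, hκ, hb⟩ := exists_norm_diffuse_le measurePreserving_neg_neg (Or.inl rfl) velPos_eq
        velNeg_eq hκ₁ hκ₂ hs₁ hs₂ hc hα₂ hβ₂ hsum₂ hO₂
      refine ⟨κ, hκ, fun z hz => norm_crossing_pow_four_le n₁ n₂ (Or.inl ?_)⟩
      rw [h]
      exact hb z hz
    · obtain ⟨κ, hκ, hb⟩ := exists_norm_diffuse_le measurePreserving_neg_pos (Or.inr rfl) velNeg_eq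
        velPos_eq hκ₂ hκ₁ hs₂ hs₁ hc hα₁ hβ₁ hsum₁ hO₁
      refine ⟨κ, hκ, fun z hz => norm_crossing_pow_four_le n₁ n₂ (Or.inr ?_)⟩
      rw [h]
      exact hb z hz
  obtain ⟨κ, hκ, hb⟩ := hcontr
  exact ⟨n₁, n₂, exists_wallResolvent n₁ n₂ l₁ l₂ hD hS hκ hb⟩

end Walls


/-! ### Integrated linear differential equations with integrable right-hand side. -/

section Primitives

theorem absolutelyContinuousOnInterval_primitive {η : ℝ → ℂ} {b x : ℝ}
    (hη : IntervalIntegrable η volume b x) :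
    AbsolutelyContinuousOnInterval (fun t => ∫ y in b..t, η y) b x := by
  have hre : IntervalIntegrable (fun t => (η t).re) volume b x := ⟨hη.1.re, hη.2.re⟩
  have him : IntervalIntegrable (fun t => (η t).im) volume b x := ⟨hη.1.im, hη.2.im⟩
  have hc : ∀ w : ℂ, AbsolutelyContinuousOnInterval (fun _ : ℝ => w) b x := fun w =>
    (contDiffOn_const (c := w)).absolutelyContinuousOnInterval
  have h := ((hre.absolutelyContinuousOnInterval_intervalIntegral (c := b) (by simp)).fun_smul
    (hc 1)).add ((him.absolutelyContinuousOnInterval_intervalIntegral (c := b) (by simp)).fun_smul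
    (hc Complex.I))
  have heq : ∀ t ∈ uIcc b x, ((∫ y in b..t, (η y).re) • (1 : ℂ) +
      (∫ y in b..t, (η y).im) • Complex.I) = ∫ y in b..t, η y := fun t ht => by
    have ht' := hη.mono_set (uIcc_subset_uIcc_left ht)
    rw [Complex.real_smul, Complex.real_smul, mul_one, ← intervalIntegral.integral_ofReal,
      ← intervalIntegral.integral_ofReal, ← intervalIntegral.integral_mul_const,
      ← intervalIntegral.integral_add]
    · simp only [Complex.re_add_im]
    · exact ⟨ht'.1.re.ofReal, ht'.2.re.ofReal⟩
    · exact (IntervalIntegrable.mul_const ⟨ht'.1.im.ofReal, ht'.2.im.ofReal⟩ _)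
  refine Tendsto.congr' ?_ h
  rw [EventuallyEq, eventually_inf_principal]
  refine Eventually.of_forall fun E hE => Finset.sum_congr rfl fun i hi => ?_
  have := hE.1 i hi
  simp only [Pi.add_apply, heq _ this.1, heq _ this.2]

/-- Integration by parts for `η` merely integrable: the difference of the two sides is absolutely
continuous in the upper limit, and its derivative vanishes almost everywhere. -/
theorem integral_deriv_mul_primitive {φ φ' η : ℝ → ℂ} (hφ : ∀ t, HasDerivAt φ (φ' t) t)
    (hφ' : Continuous φ') {b x : ℝ} (hη : IntervalIntegrable η volume b x) :
    ∫ t in b..x, (φ' t * (∫ y in b..t, η y) + φ t * η t) = φ x * ∫ y in b..x, η y := by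
  set N : ℝ → ℂ := fun t => ∫ y in b..t, η y with hN
  have hNac : AbsolutelyContinuousOnInterval N b x :=
    absolutelyContinuousOnInterval_primitive hη
  have hφc : Continuous φ := continuous_iff_continuousAt.2 fun t => (hφ t).continuousAt
  have hφ1 : ContDiff ℝ 1 φ := contDiff_one_iff_deriv.2
    ⟨fun t => (hφ t).differentiableAt, by
      rw [show deriv φ = φ' from funext fun t => (hφ t).deriv]; exact hφ'⟩
  have hint : IntervalIntegrable (fun t => φ' t * N t + φ t * η t) volume b x :=
    ((hφ'.continuousOn.mul hNac.continuousOn).intervalIntegrable).add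
      (hη.continuousOn_mul hφc.continuousOn)
  have hac := (hφ1.contDiffOn.absolutelyContinuousOnInterval.fun_smul hNac).sub
    (absolutelyContinuousOnInterval_primitive hint)
  obtain ⟨C, hC⟩ := hac.const_of_ae_hasDerivAt_zero (by
    filter_upwards [hη.ae_hasDerivAt_integral, hint.ae_hasDerivAt_integral] with t h1 h2 ht
    have h3 := ((hφ t).mul (h1 ht b (by simp))).sub (h2 ht b (by simp))
    rw [show (φ' t * ∫ y in b..t, η y) + φ t * η t - (φ' t * N t + φ t * η t) = 0 from
      sub_self _] at h3
    exact h3)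
  have h1 := hC b (by simp)
  have h2 := hC x (by simp)
  simp [hN] at h1 h2
  rw [← h1] at h2
  exact (sub_eq_zero.1 h2).symm

theorem hasDerivAt_exp_mul_sub (c : ℂ) (b t : ℝ) :
    HasDerivAt (fun t : ℝ => Complex.exp (c * ((t : ℂ) - b)))
      (c * Complex.exp (c * ((t : ℂ) - b))) t := by
  have h : HasDerivAt (fun t : ℝ => c * ((t : ℂ) - b)) c t := by
    simpa using ((Complex.ofRealCLM.hasDerivAt (x := t)).sub_const (b : ℂ)).const_mul c
  simpa [mul_comm] using h.cexp

/-- The solution of `P' = γ - c P`, in integrated form. -/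
theorem eq_exp_of_integral_eq {c : ℂ} {b a₀ a₁ : ℝ} (hb : b ∈ Icc a₀ a₁) {P γ : ℝ → ℂ}
    (hP : ContinuousOn P (Icc a₀ a₁)) (hγ : IntegrableOn γ (Icc a₀ a₁))
    (h : ∀ x ∈ Icc a₀ a₁, P x = P b - ∫ t in b..x, (c * P t - γ t)) {x : ℝ} (hx : x ∈ Icc a₀ a₁) :
    P x = Complex.exp (-(c * ((x : ℂ) - b))) * P b +
      ∫ t in b..x, Complex.exp (-(c * ((x : ℂ) - t))) * γ t := by
  have hsub : uIcc b x ⊆ Icc a₀ a₁ := (convex_Icc a₀ a₁).ordConnected.uIcc_subset hb hx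
  have hPi : IntervalIntegrable P volume b x := (hP.mono hsub).intervalIntegrable
  have hγi : IntervalIntegrable γ volume b x := (hγ.mono_set hsub).intervalIntegrable
  have hE : Continuous fun t : ℝ => Complex.exp (c * ((t : ℂ) - b)) := by fun_prop
  -- The integrating factor is `exp (c (t - b))`. The primitive of `c P - γ` is `P b - P t` by
  -- hypothesis, so all terms with `P t` cancel under the integral and only `P b` and `γ` remain.
  have key := integral_deriv_mul_primitive (hasDerivAt_exp_mul_sub c b)
    (by fun_prop) ((hPi.const_mul c).sub hγi)
  have e1 : ∫ t in b..x, (c * Complex.exp (c * ((t : ℂ) - b)) * (∫ y in b..t, (c * P y - γ y)) +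
      Complex.exp (c * ((t : ℂ) - b)) * (c * P t - γ t)) =
      ∫ t in b..x, (c * Complex.exp (c * ((t : ℂ) - b)) * P b -
        Complex.exp (c * ((t : ℂ) - b)) * γ t) := by
    refine intervalIntegral.integral_congr fun t ht => ?_
    have := h t (hsub ht)
    have h2 : ∫ y in b..t, (c * P y - γ y) = P b - P t := by rw [this]; ring
    simp only [h2]
    ring
  have e2 : ∫ t in b..x, c * Complex.exp (c * ((t : ℂ) - b)) =
      Complex.exp (c * ((x : ℂ) - b)) - 1 := by
    rw [intervalIntegral.integral_eq_sub_of_hasDerivAt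
      (fun t _ => hasDerivAt_exp_mul_sub c b t) (Continuous.intervalIntegrable (by fun_prop) _ _)]
    simp
  have e3 : ∫ y in b..x, (c * P y - γ y) = P b - P x := by rw [h x hx]; ring
  rw [e1, e3, intervalIntegral.integral_sub, intervalIntegral.integral_mul_const, e2] at key
  · have e4 : ∫ t in b..x, Complex.exp (-(c * ((x : ℂ) - t))) * γ t =
        Complex.exp (-(c * ((x : ℂ) - b))) *
          ∫ t in b..x, Complex.exp (c * ((t : ℂ) - b)) * γ t := by
      rw [← intervalIntegral.integral_const_mul]
      refine intervalIntegral.integral_congr fun t _ => ?_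
      rw [← mul_assoc, ← Complex.exp_add]
      congr 2
      ring
    have e5 : Complex.exp (-(c * ((x : ℂ) - b))) * Complex.exp (c * ((x : ℂ) - b)) = 1 := by
      rw [← Complex.exp_add]; simp
    rw [e4]
    linear_combination (Complex.exp (-(c * ((x : ℂ) - b)))) * key - (P x) * e5
  · exact ((by fun_prop : Continuous fun t : ℝ =>
      c * Complex.exp (c * ((t : ℂ) - b)) * P b).intervalIntegrable _ _)
  · exact hγi.continuousOn_mul hE.continuousOn

/-- The converse, with the integrating factor of opposite sign applied to the primitive of `exp (c
(y - b)) γ`. -/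
theorem integral_eq_of_eq_exp {c : ℂ} {b x : ℝ} {P γ : ℝ → ℂ} {p : ℂ}
    (hγ : IntervalIntegrable γ volume b x)
    (h : ∀ t ∈ uIcc b x, P t = Complex.exp (-(c * ((t : ℂ) - b))) * p +
      ∫ y in b..t, Complex.exp (-(c * ((t : ℂ) - y))) * γ y) :
    P x = p - ∫ t in b..x, (c * P t - γ t) := by
  have hE : Continuous fun t : ℝ => Complex.exp (c * ((t : ℂ) - b)) := by fun_prop
  have hη : IntervalIntegrable (fun y : ℝ => Complex.exp (c * ((y : ℂ) - b)) * γ y) volume b x :=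
    hγ.continuousOn_mul hE.continuousOn
  have h' : ∀ t ∈ uIcc b x, P t = Complex.exp (-c * ((t : ℂ) - b)) *
      (p + ∫ y in b..t, Complex.exp (c * ((y : ℂ) - b)) * γ y) := fun t ht => by
    rw [h t ht, mul_add, ← intervalIntegral.integral_const_mul, neg_mul]
    congr 1
    refine intervalIntegral.integral_congr fun y _ => ?_
    rw [← mul_assoc, ← Complex.exp_add]
    congr 2
    ring
  have key := integral_deriv_mul_primitive (hasDerivAt_exp_mul_sub (-c) b) (by fun_prop) hη
  have e2 : ∫ t in b..x, (-c) * Complex.exp (-c * ((t : ℂ) - b)) =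
      Complex.exp (-c * ((x : ℂ) - b)) - 1 := by
    rw [intervalIntegral.integral_eq_sub_of_hasDerivAt
      (fun t _ => hasDerivAt_exp_mul_sub (-c) b t)
      (Continuous.intervalIntegrable (by fun_prop) _ _)]
    simp
  have e1 : ∫ t in b..x, (c * P t - γ t) = ∫ t in b..x,
      (-((-c) * Complex.exp (-c * ((t : ℂ) - b)) * p) -
        (-c * Complex.exp (-c * ((t : ℂ) - b)) *
          (∫ y in b..t, Complex.exp (c * ((y : ℂ) - b)) * γ y) +
          Complex.exp (-c * ((t : ℂ) - b)) * (Complex.exp (c * ((t : ℂ) - b)) * γ t))) := by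
    refine intervalIntegral.integral_congr fun t ht => ?_
    have : Complex.exp (-c * ((t : ℂ) - b)) * Complex.exp (c * ((t : ℂ) - b)) = 1 := by
      rw [← Complex.exp_add]; simp
    rw [h' t ht, ← mul_assoc (Complex.exp (-c * ((t : ℂ) - b))), this]
    ring
  have hNac : ContinuousOn (fun t => ∫ y in b..t, Complex.exp (c * ((y : ℂ) - b)) * γ y)
      (uIcc b x) :=
    (absolutelyContinuousOnInterval_primitive hη).continuousOn
  have hE' : Continuous fun t : ℝ => Complex.exp (-c * ((t : ℂ) - b)) := by fun_prop
  rw [e1, intervalIntegral.integral_sub, key, intervalIntegral.integral_neg,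
    intervalIntegral.integral_mul_const, e2, h' x (by simp)]
  · ring
  · exact (by fun_prop : Continuous fun t : ℝ =>
      -((-c) * Complex.exp (-c * ((t : ℂ) - b)) * p)).intervalIntegrable _ _
  · exact ((((continuous_const.mul hE').continuousOn).mul hNac).intervalIntegrable).add
      (hη.continuousOn_mul hE'.continuousOn)

end Primitives


/-! ### Smooth steps and approximate identities as test functions in x. -/

section Steps

/-- The derivative of the smooth transition. -/
def transitionDeriv (x : ℝ) : ℝ := deriv Real.smoothTransition x

theorem hasDerivAt_smoothTransition (x : ℝ) :
    HasDerivAt Real.smoothTransition (transitionDeriv x) x :=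
  ((Real.smoothTransition.contDiff (n := 1)).differentiable one_ne_zero x).hasDerivAt

theorem transitionDeriv_nonneg (x : ℝ) : 0 ≤ transitionDeriv x :=
  Real.smoothTransition.monotone.deriv_nonneg

theorem continuous_transitionDeriv : Continuous transitionDeriv :=
  (Real.smoothTransition.contDiff (n := 1)).continuous_deriv le_rfl

theorem transitionDeriv_eq_zero {x : ℝ} (hx : x ∉ Icc (0 : ℝ) 1) : transitionDeriv x = 0 := by
  rw [mem_Icc, not_and_or, not_le, not_le] at hx
  rcases hx with h | h
  · have : Real.smoothTransition =ᶠ[𝓝 x] fun _ => 0 := by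
      filter_upwards [gt_mem_nhds h] with y hy
      exact Real.smoothTransition.zero_of_nonpos hy.le
    rw [transitionDeriv, this.deriv_eq, deriv_const]
  · have : Real.smoothTransition =ᶠ[𝓝 x] fun _ => 1 := by
      filter_upwards [lt_mem_nhds h] with y hy
      exact Real.smoothTransition.one_of_one_le hy.le
    rw [transitionDeriv, this.deriv_eq, deriv_const]

theorem hasCompactSupport_transitionDeriv : HasCompactSupport transitionDeriv :=
  HasCompactSupport.intro isCompact_Icc fun _ h => transitionDeriv_eq_zero h

theorem integral_transitionDeriv : ∫ x, transitionDeriv x = 1 := by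
  have := integral_of_hasDerivAt_of_tendsto hasDerivAt_smoothTransition
    (continuous_transitionDeriv.integrable_of_hasCompactSupport hasCompactSupport_transitionDeriv)
    (m := 0) (n := 1) ?_ ?_
  · rw [this, sub_zero]
  · exact tendsto_const_nhds.congr' ((eventually_le_atBot 0).mono fun x hx =>
      (Real.smoothTransition.zero_of_nonpos hx).symm)
  · exact tendsto_const_nhds.congr' ((eventually_ge_atTop 1).mono fun x hx =>
      (Real.smoothTransition.one_of_one_le hx).symm)

/-- The functions `n ρ(n (x - p))`, with `ρ` the derivative of the smooth transition, form an
approximate identity on `[p, p + 1/n]`. `G` is cut off outside the slab, which does not matter near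
the interior point `p`. -/
theorem tendsto_integral_transitionDeriv {a : ℝ} {G : ℝ → ℂ} (hG : ContinuousOn G (Icc (-a) a))
    {p : ℝ} (hp : p ∈ Ioo (-a) a) :
    Tendsto (fun n : ℕ => ∫ x in Ioo (-a) a, ((n * transitionDeriv (n * (x - p)) : ℝ) : ℂ) * G x)
      atTop (𝓝 (G p)) := by
  have hint : Integrable ((Ioo (-a) a).indicator G) :=
    ((hG.integrableOn_Icc).mono_set Ioo_subset_Icc_self).integrable_indicator measurableSet_Ioo
  have hev : (Ioo (-a) a).indicator G =ᶠ[𝓝 p] G := by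
    filter_upwards [isOpen_Ioo.mem_nhds hp] with x hx
    exact indicator_of_mem hx G
  have hcont : ContinuousAt ((Ioo (-a) a).indicator G) p :=
    (hG.continuousAt (Icc_mem_nhds hp.1 hp.2)).congr hev.symm
  have h := tendsto_integral_comp_smul_smul_of_integrable' (μ := volume)
    (φ := fun u => transitionDeriv (-u)) (fun u => transitionDeriv_nonneg _)
    (by rw [integral_neg_eq_self transitionDeriv]; exact integral_transitionDeriv)
    (by
      refine tendsto_const_nhds.congr' ?_
      have : ∀ᶠ u : ℝ in Bornology.cobounded ℝ, 1 < ‖u‖ :=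
        tendsto_norm_cobounded_atTop.eventually_gt_atTop 1
      filter_upwards [this] with u hu
      rw [transitionDeriv_eq_zero, mul_zero]
      intro hmem
      rw [Real.norm_eq_abs] at hu
      have : |u| ≤ 1 := abs_le.2 ⟨by linarith [hmem.2], by linarith [hmem.1]⟩
      linarith) hint hcont
  rw [hev.eq_of_nhds] at h
  refine (h.comp tendsto_natCast_atTop_atTop).congr fun n => ?_
  rw [← integral_indicator measurableSet_Ioo]
  refine integral_congr_ae (Eventually.of_forall fun x => ?_)
  by_cases hx : x ∈ Ioo (-a) a
  · have : -((n : ℝ) • (p - x)) = n * (x - p) := by rw [smul_eq_mul]; ring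
    simp only [indicator_of_mem hx, this, Module.finrank_self, pow_one,
      Complex.real_smul]
  · simp [indicator_of_notMem hx]

/-- A smooth approximation of the indicator of `(p, q]`. -/
def smoothStep (p q : ℝ) (n : ℕ) (x : ℝ) : ℝ :=
  Real.smoothTransition (n * (x - p)) - Real.smoothTransition (n * (x - q))

/-- The derivative of `smoothStep`. -/
def smoothStepDeriv (p q : ℝ) (n : ℕ) (x : ℝ) : ℝ :=
  n * transitionDeriv (n * (x - p)) - n * transitionDeriv (n * (x - q))

variable (p q : ℝ) (n : ℕ)

theorem hasDerivAt_smoothStep (x : ℝ) :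
    HasDerivAt (smoothStep p q n) (smoothStepDeriv p q n x) x := by
  have h : ∀ r : ℝ, HasDerivAt (fun x : ℝ => Real.smoothTransition (n * (x - r)))
      (n * transitionDeriv (n * (x - r))) x := fun r => by
    have h1 : HasDerivAt (fun x : ℝ => (n : ℝ) * (x - r)) n x := by
      simpa using ((hasDerivAt_id x).sub_const r).const_mul (n : ℝ)
    have h2 := (hasDerivAt_smoothTransition (n * (x - r))).comp x h1
    rw [mul_comm] at h2
    exact h2
  exact (h p).sub (h q)

theorem contDiff_smoothStep : ContDiff ℝ ∞ (smoothStep p q n) := by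
  have h : ∀ r : ℝ, ContDiff ℝ ∞ (fun x : ℝ => Real.smoothTransition (n * (x - r))) := fun r =>
    Real.smoothTransition.contDiff.comp (contDiff_const.mul (contDiff_id.sub contDiff_const))
  exact (h p).sub (h q)

theorem continuous_smoothStepDeriv : Continuous (smoothStepDeriv p q n) := by
  have := continuous_transitionDeriv
  unfold smoothStepDeriv
  fun_prop

variable {p q n}

theorem smoothStep_eq_zero (hpq : p ≤ q) (hn : 0 < n) {x : ℝ} (hx : x ∉ Icc p (q + 1 / n)) :
    smoothStep p q n x = 0 := by
  have hn' : (0 : ℝ) < n := by exact_mod_cast hn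
  rw [mem_Icc, not_and_or, not_le, not_le] at hx
  rcases hx with h | h
  · rw [smoothStep, Real.smoothTransition.zero_of_nonpos, Real.smoothTransition.zero_of_nonpos,
      sub_zero]
    · exact mul_nonpos_of_nonneg_of_nonpos hn'.le (by linarith)
    · exact mul_nonpos_of_nonneg_of_nonpos hn'.le (by linarith)
  · have h1 : 1 ≤ (n : ℝ) * (x - q) := by
      have : 1 / (n : ℝ) < x - q := by linarith
      rw [div_lt_iff₀ hn'] at this
      linarith
    rw [smoothStep, Real.smoothTransition.one_of_one_le h1, Real.smoothTransition.one_of_one_le,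
      sub_self]
    exact h1.trans (mul_le_mul_of_nonneg_left (by linarith) hn'.le)

theorem abs_smoothStep_le (x : ℝ) : |smoothStep p q n x| ≤ 1 := by
  have h1 := Real.smoothTransition.nonneg (n * (x - p))
  have h2 := Real.smoothTransition.nonneg (n * (x - q))
  have h3 := Real.smoothTransition.le_one (n * (x - p))
  have h4 := Real.smoothTransition.le_one (n * (x - q))
  rw [smoothStep, abs_le]
  constructor <;> linarith

theorem tendsto_smoothStep (p q x : ℝ) (hpq : p ≤ q) :
    Tendsto (fun n => smoothStep p q n x) atTop (𝓝 ((Ioc p q).indicator 1 x)) := by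
  have h : ∀ r : ℝ, Tendsto (fun n : ℕ => Real.smoothTransition (n * (x - r))) atTop
      (𝓝 ((Ioi r).indicator 1 x)) := fun r => by
    by_cases hr : r < x
    · rw [indicator_of_mem (show x ∈ Ioi r from hr)]
      refine tendsto_const_nhds.congr' ?_
      have : Tendsto (fun n : ℕ => (n : ℝ) * (x - r)) atTop atTop :=
        tendsto_natCast_atTop_atTop.atTop_mul_const (sub_pos.2 hr)
      filter_upwards [this.eventually_ge_atTop 1] with n hn
      exact (Real.smoothTransition.one_of_one_le hn).symm
    · rw [indicator_of_notMem (show x ∉ Ioi r from hr)]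
      refine tendsto_const_nhds.congr fun n => ?_
      exact (Real.smoothTransition.zero_of_nonpos
        (mul_nonpos_of_nonneg_of_nonpos n.cast_nonneg (by linarith))).symm
  have h' := (h p).sub (h q)
  have e : (Ioc p q).indicator (1 : ℝ → ℝ) x =
      (Ioi p).indicator (1 : ℝ → ℝ) x - (Ioi q).indicator (1 : ℝ → ℝ) x := by
    simp only [indicator_apply, mem_Ioc, mem_Ioi, Pi.one_apply]
    split_ifs with h1 h2 h3 h4 h5 <;> first | (exfalso; linarith [h1.2]) | norm_num
    all_goals (exfalso; grind)
  rw [e]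
  exact h'

end Steps


/-! ### Equivalence of the weak and the integrated transport equation. -/

section WeakForm

/-- Lebesgue measure on the slab `(-a, a)`. -/
abbrev slabMeasure (a : ℝ) : Measure ℝ := volume.restrict (Ioo (-a) a)

theorem phase_eq (a : ℝ) : phase a = (slabMeasure a).prod velAll := by
  rw [phase, slabMeasure, velAll, Measure.prod_restrict, Measure.volume_eq_prod]

variable {a : ℝ}

theorem ae_velAll_ae_slab {P : ℝ × ℝ → Prop} (h : ∀ᵐ y ∂(phase a), P y) :
    ∀ᵐ v ∂velAll, ∀ᵐ x ∂(slabMeasure a), P (x, v) :=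
  ae_snd_of_prod_eq (phase_eq a) h

theorem integrable_phase (f : L1Phase a) : Integrable f ((slabMeasure a).prod velAll) :=
  integrable_of_prod_eq (phase_eq a) (L1.integrable_coeFn f)

theorem ae_integrable_slab (f : L1Phase a) :
    ∀ᵐ v ∂velAll, IntegrableOn (fun x => f (x, v)) (Ioo (-a) a) :=
  (integrable_phase f).prod_left_ae

theorem _root_.MeasureTheory.Integrable.of_slab_prod {φ : ℝ × ℝ → ℂ}
    (h : Integrable φ ((slabMeasure a).prod velAll)) : Integrable φ (phase a) := by
  rw [phase_eq]
  exact h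

theorem integral_phase {φ : ℝ × ℝ → ℂ} (h : Integrable φ ((slabMeasure a).prod velAll)) :
    ∫ y, φ y ∂(phase a) = ∫ v in Ioo (-1) 1, ∫ x in Ioo (-a) a, φ (x, v) := by
  rw [phase_eq]
  exact integral_prod_symm φ h

theorem integrable_continuous_mul {φ : ℝ × ℝ → ℝ} (hφ : Continuous φ) {C : ℝ}
    (hC : ∀ᵐ y ∂(slabMeasure a).prod velAll, |φ y| ≤ C) (f : L1Phase a) :
    Integrable (fun y => (φ y : ℂ) * f y) ((slabMeasure a).prod velAll) :=
  (integrable_phase f).bdd_mul (Complex.continuous_ofReal.comp hφ).aestronglyMeasurable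
    (c := C) (hC.mono fun y hy => by rwa [Complex.norm_real])

theorem ae_mem_phase :
    ∀ᵐ y ∂(slabMeasure a).prod velAll, y.1 ∈ Ioo (-a) a ∧ y.2 ∈ Ioo (-1 : ℝ) 1 := by
  rw [← phase_eq]
  exact (ae_restrict_mem (measurableSet_Ioo.prod measurableSet_Ioo)).mono fun y hy => hy

theorem fderiv_mul_apply {χ ψ : ℝ → ℝ} {χ' : ℝ} {y : ℝ × ℝ} (hχ : HasDerivAt χ χ' y.1)
    (hψ : DifferentiableAt ℝ ψ y.2) :
    fderiv ℝ (fun y : ℝ × ℝ => χ y.1 * ψ y.2) y (1, 0) = χ' * ψ y.2 := by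
  have h1 : HasFDerivAt (fun y : ℝ × ℝ => χ y.1) _ y :=
    hχ.hasFDerivAt.comp y (hasFDerivAt_fst (𝕜 := ℝ) (E := ℝ) (F := ℝ) (p := y))
  have h2 : HasFDerivAt (fun y : ℝ × ℝ => ψ y.2) _ y :=
    hψ.hasFDerivAt.comp y (hasFDerivAt_snd (𝕜 := ℝ) (E := ℝ) (F := ℝ) (p := y))
  rw [show (fun y : ℝ × ℝ => χ y.1 * ψ y.2) = (fun y => χ y.1) * fun y => ψ y.2 from rfl,
    (h1.mul h2).fderiv]
  simp [mul_comm]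

/-- Test with products of a smooth step in `x` and an arbitrary `ψ` in `v`. As `ψ` is arbitrary, the
equation integrated over `x` alone holds for almost every `v`. -/
theorem IsWeakTransport.ae_integral_smoothStep {f w : L1Phase a} (h : IsWeakTransport a f w)
    {p q : ℝ} (hp : -a < p) (hpq : p ≤ q) {n : ℕ} (hn : 0 < n) (hq : q + 1 / n < a) :
    ∀ᵐ v ∂velAll, ∫ x in Ioo (-a) a, ((v * smoothStepDeriv p q n x : ℝ) : ℂ) * f (x, v) =
      ∫ x in Ioo (-a) a, (smoothStep p q n x : ℂ) * w (x, v) := by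
  have hcχ : Continuous (smoothStep p q n) := (contDiff_smoothStep p q n).continuous
  have hcχ' := continuous_smoothStepDeriv p q n
  obtain ⟨B, hB⟩ := isCompact_Icc.exists_bound_of_continuousOn (s := Icc (-a) a) hcχ'.continuousOn
  have hi1 : Integrable (fun y : ℝ × ℝ => ((y.2 * smoothStepDeriv p q n y.1 : ℝ) : ℂ) * f y)
      ((slabMeasure a).prod velAll) := by
    refine integrable_continuous_mul (φ := fun y => y.2 * smoothStepDeriv p q n y.1)
      (by fun_prop) (C := B) ?_ f
    filter_upwards [ae_mem_phase] with y hy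
    rw [abs_mul]
    have h1 := hB y.1 (Ioo_subset_Icc_self hy.1)
    have h2 : |y.2| ≤ 1 := abs_le.2 ⟨hy.2.1.le, hy.2.2.le⟩
    rw [Real.norm_eq_abs] at h1
    calc |y.2| * |smoothStepDeriv p q n y.1| ≤ 1 * B := by gcongr
      _ = B := one_mul B
  have hi2 : Integrable (fun y : ℝ × ℝ => (smoothStep p q n y.1 : ℂ) * w y)
      ((slabMeasure a).prod velAll) :=
    integrable_continuous_mul (φ := fun y => smoothStep p q n y.1) (by fun_prop)
      (C := 1) (Eventually.of_forall fun y => abs_smoothStep_le _) w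
  set D : ℝ → ℂ := fun v => ∫ x in Ioo (-a) a, (((v * smoothStepDeriv p q n x : ℝ) : ℂ) * f (x, v) -
    (smoothStep p q n x : ℂ) * w (x, v)) with hD
  have hDi : IntegrableOn D (Ioo (-1) 1) := (hi1.sub hi2).integral_prod_right
  have hD0 : ∀ᵐ v, v ∈ Ioo (-1 : ℝ) 1 → D v = 0 := by
    refine isOpen_Ioo.ae_eq_zero_of_integral_contDiff_smul_eq_zero hDi.locallyIntegrableOn
      fun ψ hψ hψc hψs => ?_
    rw [← setIntegral_eq_integral_of_forall_compl_eq_zero (s := Ioo (-1 : ℝ) 1) fun v hv => by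
      rw [image_eq_zero_of_notMem_tsupport fun h => hv (hψs h), zero_smul]]
    have hw := h (fun y => smoothStep p q n y.1 * ψ y.2)
      (((contDiff_smoothStep p q n).comp contDiff_fst).mul (hψ.comp contDiff_snd)) ?_ ?_
    · obtain ⟨M, hM⟩ := hψc.exists_bound_of_continuous hψ.continuous
      have hψb : ∀ᵐ y ∂(slabMeasure a).prod velAll, ‖((ψ y.2 : ℝ) : ℂ)‖ ≤ M :=
        Eventually.of_forall fun y => by rw [Complex.norm_real]; exact hM _
      have hψm : AEStronglyMeasurable (fun y : ℝ × ℝ => ((ψ y.2 : ℝ) : ℂ))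
          ((slabMeasure a).prod velAll) :=
        (Complex.continuous_ofReal.comp (hψ.continuous.comp continuous_snd)).aestronglyMeasurable
      have hj1 := hi1.bdd_mul hψm hψb
      have hj2 := hi2.bdd_mul hψm hψb
      have e : ∀ v, ψ v • D v = ∫ x in Ioo (-a) a,
          ((ψ v : ℂ) * (((v * smoothStepDeriv p q n x : ℝ) : ℂ) * f (x, v)) -
            (ψ v : ℂ) * ((smoothStep p q n x : ℂ) * w (x, v))) := fun v => by
        rw [hD, Complex.real_smul, ← integral_const_mul]
        simp only [mul_sub]
      simp only [e]
      refine (integral_phase (hj1.sub hj2)).symm.trans ?_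
      rw [integral_sub' hj1.of_slab_prod hj2.of_slab_prod, sub_eq_zero]
      refine Eq.trans ?_ (hw.trans ?_)
      · refine integral_congr_ae (Eventually.of_forall fun y => ?_)
        simp only [fderiv_mul_apply (hasDerivAt_smoothStep p q n y.1)
          (hψ.differentiable (by simp) y.2)]
        push_cast
        ring
      · refine integral_congr_ae (Eventually.of_forall fun y => ?_)
        simp only
        push_cast
        ring
    · refine HasCompactSupport.intro ((isCompact_Icc (a := p) (b := q + 1 / n)).prod hψc)
        fun y hy => ?_
      rw [mem_prod, not_and_or] at hy
      rcases hy with hy | hy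
      · rw [smoothStep_eq_zero hpq hn hy, zero_mul]
      · rw [image_eq_zero_of_notMem_tsupport hy, mul_zero]
    · have : tsupport (fun y : ℝ × ℝ => smoothStep p q n y.1 * ψ y.2) ⊆
          Icc p (q + 1 / n) ×ˢ tsupport ψ := by
        refine closure_minimal (fun y hy => ?_) (isClosed_Icc.prod (isClosed_tsupport ψ))
        by_contra hy'
        rw [mem_prod, not_and_or] at hy'
        rcases hy' with hy' | hy'
        · exact hy (by simp only [smoothStep_eq_zero hpq hn hy', zero_mul])
        · exact hy (by simp only [image_eq_zero_of_notMem_tsupport hy', mul_zero])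
      exact this.trans (prod_mono (fun x hx => ⟨hp.trans_le hx.1, hx.2.trans_lt hq⟩) hψs)
  filter_upwards [(ae_restrict_iff' measurableSet_Ioo).2 hD0, hi1.prod_left_ae, hi2.prod_left_ae]
    with v hv h1 h2
  rw [hD] at hv
  simp only at hv
  rw [integral_sub h1 h2] at hv
  exact sub_eq_zero.1 hv

/-- The representative that is continuous in `x` satisfies the integrated transport equation. -/
theorem IsWeakTransport.ae_integrated (ha : 0 < a) {f w : L1Phase a} (h : IsWeakTransport a f w)
    {F : ℝ × ℝ → ℂ} (hF : f =ᵐ[phase a] F)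
    (hc : ∀ᵐ v ∂velAll, ContinuousOn (fun x => F (x, v)) (Icc (-a) a)) :
    ∀ᵐ (v : ℝ) ∂velAll, ∀ b ∈ Icc (-a) a, ∀ x ∈ Icc (-a) a,
      (v : ℂ) * F (x, v) = (v : ℂ) * F (b, v) - ∫ t in b..x, w (t, v) := by
  -- The exceptional null set depends on the test function, so only countably many steps, with
  -- rational ends, may be used.
  have hall : ∀ᵐ v ∂velAll, ∀ (p q : ℚ) (n : ℕ), -a < p → p ≤ q → 0 < n → (q : ℝ) + 1 / n < a →
      ∫ x in Ioo (-a) a, ((v * smoothStepDeriv p q n x : ℝ) : ℂ) * f (x, v) =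
        ∫ x in Ioo (-a) a, (smoothStep p q n x : ℂ) * w (x, v) := by
    simp only [ae_all_iff, eventually_imp_distrib_left]
    intro p q n hp hpq hn hq
    exact h.ae_integral_smoothStep hp (by exact_mod_cast hpq) hn hq
  filter_upwards [hall, ae_velAll_ae_slab hF, hc, ae_integrable_slab w] with v hv hFv hcv hwv
  have hwI : ∀ x ∈ Icc (-a) a, ∀ y ∈ Icc (-a) a,
      IntervalIntegrable (fun t => w (t, v)) volume x y := fun x hx y hy =>
    (((integrableOn_Icc_iff_integrableOn_Ioo).2 hwv).mono_set
      ((convex_Icc (-a) a).ordConnected.uIcc_subset hx hy)).intervalIntegrable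
  have hle : -a ≤ a := by linarith
  -- As the steps sharpen, their derivatives pick out the values of `F` at `p` and at `q`, and they
  -- themselves tend to the indicator of `(p, q]`.
  have step : ∀ p q : ℚ, (p : ℝ) ∈ Ioo (-a) a → (q : ℝ) ∈ Ioo (-a) a → p ≤ q →
      (v : ℂ) * F (p, v) - (v : ℂ) * F (q, v) = ∫ t in (p : ℝ)..q, w (t, v) := by
    intro p q hp hq hpq
    have hpq' : (p : ℝ) ≤ q := by exact_mod_cast hpq
    have l1 := tendsto_integral_transitionDeriv hcv hp
    have l2 := tendsto_integral_transitionDeriv hcv hq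
    have l3 := (l1.sub l2).const_mul (v : ℂ)
    have l4 : Tendsto (fun n : ℕ => ∫ x in Ioo (-a) a, (smoothStep p q n x : ℂ) * w (x, v)) atTop
        (𝓝 (∫ x in Ioo (-a) a, (((Ioc (p : ℝ) q).indicator 1 x : ℝ) : ℂ) * w (x, v))) := by
      refine tendsto_integral_of_dominated_convergence (fun x => ‖w (x, v)‖) (fun n => ?_) hwv.norm
        (fun n => Eventually.of_forall fun x => ?_) (Eventually.of_forall fun x => ?_)
      · exact (Complex.continuous_ofReal.comp
          (contDiff_smoothStep p q n).continuous).aestronglyMeasurable.mul hwv.1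
      · rw [norm_mul, Complex.norm_real]
        exact mul_le_of_le_one_left (norm_nonneg _) (abs_smoothStep_le x)
      · exact ((Complex.continuous_ofReal.tendsto _).comp
          (tendsto_smoothStep p q x hpq')).mul_const _
    have e4 : ∫ x in Ioo (-a) a, (((Ioc (p : ℝ) q).indicator 1 x : ℝ) : ℂ) * w (x, v) =
        ∫ t in (p : ℝ)..q, w (t, v) := by
      rw [intervalIntegral.integral_of_le hpq', ← integral_indicator measurableSet_Ioc,
        ← setIntegral_eq_integral_of_forall_compl_eq_zero (s := Ioo (-a) a) fun x hx =>
          indicator_of_notMem (s := Ioc (p : ℝ) q)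
            (fun hx' => hx ⟨hp.1.trans hx'.1, hx'.2.trans_lt hq.2⟩) fun t => w (t, v)]
      refine integral_congr_ae (Eventually.of_forall fun x => ?_)
      by_cases hx : x ∈ Ioc (p : ℝ) q <;> simp [hx]
    rw [e4] at l4
    rw [← mul_sub]
    refine tendsto_nhds_unique (l3.congr' ?_) l4
    -- The step extends by `1 / n` beyond `q` and must still vanish near the wall.
    have hev : ∀ᶠ n : ℕ in atTop, 1 / (n : ℝ) < a - q :=
      tendsto_one_div_atTop_nhds_zero_nat.eventually_lt_const (sub_pos.2 hq.2)
    filter_upwards [hev, eventually_gt_atTop 0] with n hn hn0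
    rw [← hv p q n hp.1 hpq hn0 (by linarith)]
    have hi : ∀ r : ℝ, IntegrableOn (fun x => ((n * transitionDeriv (n * (x - r)) : ℝ) : ℂ) *
        F (x, v)) (Ioo (-a) a) := fun r => by
      have hc' : Continuous fun x : ℝ => ((n * transitionDeriv (n * (x - r)) : ℝ) : ℂ) := by
        have := continuous_transitionDeriv
        fun_prop
      exact ((hc'.continuousOn.mul hcv).integrableOn_Icc).mono_set Ioo_subset_Icc_self
    rw [← integral_sub (hi p) (hi q), ← integral_const_mul]
    refine integral_congr_ae ?_
    filter_upwards [hFv] with x hx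
    rw [hx, smoothStepDeriv]
    push_cast
    ring
  set Φ : ℝ → ℂ := fun x => (v : ℂ) * F (x, v) + ∫ t in (-a)..x, w (t, v) with hΦ
  have hma : -a ∈ Icc (-a) a := ⟨le_rfl, hle⟩
  have haa : a ∈ Icc (-a) a := ⟨hle, le_rfl⟩
  have hΦc : ContinuousOn Φ (Icc (-a) a) := by
    have := (absolutelyContinuousOnInterval_primitive (hwI _ hma _ haa)).continuousOn
    rw [uIcc_of_le hle] at this
    exact (hcv.const_smul (v : ℂ)).add this
  have hadd : ∀ x ∈ Icc (-a) a, ∀ y ∈ Icc (-a) a, (∫ t in (-a)..x, w (t, v)) +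
      ∫ t in x..y, w (t, v) = ∫ t in (-a)..y, w (t, v) := fun x hx y hy =>
    intervalIntegral.integral_add_adjacent_intervals (hwI _ hma x hx) (hwI x hx y hy)
  have hstep' : ∀ p q : ℚ, (p : ℝ) ∈ Ioo (-a) a → (q : ℝ) ∈ Ioo (-a) a → p ≤ q → Φ p = Φ q := by
    intro p q hp hq hpq
    have h1 := step p q hp hq hpq
    have h2 := hadd p (Ioo_subset_Icc_self hp) q (Ioo_subset_Icc_self hq)
    rw [hΦ]
    simp only
    linear_combination h1 + h2
  obtain ⟨r, hr1, hr2⟩ := exists_rat_btwn (show -a < a by linarith)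
  -- `Φ` is constant on the rational points, which are dense, and continuous up to the walls; this
  -- brings in the boundary values.
  have hconst : EqOn Φ (fun _ => Φ r) (Icc (-a) a) := by
    refine EqOn.of_subset_closure (s := Ioo (-a) a ∩ range ((↑) : ℚ → ℝ)) ?_ hΦc
      continuousOn_const (inter_subset_left.trans Ioo_subset_Icc_self) ?_
    · rintro _ ⟨hp, p, rfl⟩
      rcases le_total p r with h' | h'
      · exact hstep' p r hp ⟨hr1, hr2⟩ h'
      · exact (hstep' r p ⟨hr1, hr2⟩ hp h').symm
    · rw [← closure_Ioo (show -a ≠ a by linarith)]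
      exact closure_minimal
        ((Rat.denseRange_cast (𝕜 := ℝ)).open_subset_closure_inter isOpen_Ioo) isClosed_closure
  intro b hb x hx
  have h1 : Φ x = Φ b := (hconst hx).trans (hconst hb).symm
  have h2 := hadd b hb x hx
  rw [hΦ] at h1
  simp only at h1
  linear_combination h1 + h2

/-- A function that satisfies the integrated transport equation satisfies the weak one. -/
theorem isWeakTransport_of_ae_integrated (ha : 0 < a) {f w : L1Phase a} {F : ℝ × ℝ → ℂ}
    (hF : f =ᵐ[phase a] F)
    (h : ∀ᵐ (v : ℝ) ∂velAll, ∃ b ∈ Icc (-a) a, ∀ x ∈ Icc (-a) a,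
      (v : ℂ) * F (x, v) = (v : ℂ) * F (b, v) - ∫ t in b..x, w (t, v)) :
    IsWeakTransport a f w := by
  intro φ hφ hφc hφs
  have hφ1 : Continuous φ := hφ.continuous
  have hφ' : Continuous fun y => fderiv ℝ φ y (1, 0) :=
    (hφ.continuous_fderiv (by simp)).clm_apply continuous_const
  have hφ'c : HasCompactSupport fun y => fderiv ℝ φ y (1, 0) :=
    (hφc.fderiv ℝ).comp_left (g := fun L : ℝ × ℝ →L[ℝ] ℝ => L (1, 0)) rfl
  obtain ⟨M, hM⟩ := hφc.exists_bound_of_continuous hφ1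
  obtain ⟨M', hM'⟩ := hφ'c.exists_bound_of_continuous hφ'
  have hi1 : Integrable (fun y : ℝ × ℝ => ((y.2 * fderiv ℝ φ y (1, 0) : ℝ) : ℂ) * f y)
      ((slabMeasure a).prod velAll) := by
    refine integrable_continuous_mul (φ := fun y => y.2 * fderiv ℝ φ y (1, 0))
      (continuous_snd.mul hφ') (C := M') ?_ f
    filter_upwards [ae_mem_phase] with y hy
    rw [abs_mul]
    have h2 : |y.2| ≤ 1 := abs_le.2 ⟨hy.2.1.le, hy.2.2.le⟩
    calc |y.2| * |fderiv ℝ φ y (1, 0)| ≤ 1 * M' := by gcongr; exact hM' y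
      _ = M' := one_mul M'
  have hi2 : Integrable (fun y : ℝ × ℝ => (φ y : ℂ) * w y) ((slabMeasure a).prod velAll) :=
    integrable_continuous_mul hφ1 (C := M) (Eventually.of_forall hM) w
  have hle : -a ≤ a := by linarith
  rw [integral_phase hi1, integral_phase hi2]
  refine integral_congr_ae ?_
  filter_upwards [h, ae_velAll_ae_slab hF, ae_integrable_slab w] with v ⟨b, hb, hv⟩ hFv hwv
  have hwI : IntervalIntegrable (fun t => w (t, v)) volume (-a) a := by
    rw [intervalIntegrable_iff_integrableOn_Ioo_of_le hle]
    exact hwv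
  have hd : ∀ t, HasDerivAt (fun t : ℝ => (φ (t, v) : ℂ)) ((fderiv ℝ φ (t, v) (1, 0) : ℝ) : ℂ) t :=
    fun t => by
      have h1 : HasDerivAt (fun t : ℝ => (t, v)) ((1 : ℝ), (0 : ℝ)) t :=
        (hasDerivAt_id t).prodMk (hasDerivAt_const t v)
      exact ((hφ.differentiable (by simp) (t, v)).hasFDerivAt.comp_hasDerivAt t h1).ofReal_comp
  have hdc : Continuous fun t : ℝ => ((fderiv ℝ φ (t, v) (1, 0) : ℝ) : ℂ) :=
    Complex.continuous_ofReal.comp (hφ'.comp (by fun_prop))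
  have key := integral_deriv_mul_primitive hd hdc hwI
  have key0 := intervalIntegral.integral_eq_sub_of_hasDerivAt (fun t _ => hd t)
    (hdc.intervalIntegrable (-a) a)
  have hz : ∀ x : ℝ, x ∉ Ioo (-a) a → φ (x, v) = 0 := fun x hx =>
    image_eq_zero_of_notMem_tsupport fun h' => hx (hφs h').1
  rw [hz a (by simp), hz (-a) (by simp), sub_self] at key0
  rw [hz a (by simp), Complex.ofReal_zero, zero_mul] at key
  have hma : -a ∈ Icc (-a) a := ⟨le_rfl, hle⟩
  have e : ∀ x ∈ Ioo (-a) a, (v : ℂ) * F (x, v) =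
      (v : ℂ) * F (-a, v) - ∫ t in (-a)..x, w (t, v) := fun x hx => by
    have h1 := hv x (Ioo_subset_Icc_self hx)
    have h2 := hv (-a) hma
    have hI : ∀ s ∈ Icc (-a) a, ∀ t ∈ Icc (-a) a,
        IntervalIntegrable (fun t => w (t, v)) volume s t := fun s hs t ht =>
      hwI.mono_set (by rw [uIcc_of_le hle]
                       exact (convex_Icc (-a) a).ordConnected.uIcc_subset hs ht)
    have h3 := intervalIntegral.integral_add_adjacent_intervals (hI b hb _ hma)
      (hI _ hma x (Ioo_subset_Icc_self hx))
    linear_combination h1 - h2 + h3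
  have hN := (absolutelyContinuousOnInterval_primitive hwI).continuousOn
  rw [intervalIntegral.integral_add (hdc.continuousOn.fun_mul hN).intervalIntegrable
    (hwI.continuousOn_mul
      (continuous_iff_continuousAt.2 fun t => (hd t).continuousAt).continuousOn)]
    at key
  rw [← integral_Ioc_eq_integral_Ioo, ← integral_Ioc_eq_integral_Ioo,
    ← intervalIntegral.integral_of_le hle, ← intervalIntegral.integral_of_le hle]
  have e1 : ∫ x in (-a)..a, ((v * fderiv ℝ φ (x, v) (1, 0) : ℝ) : ℂ) * f (x, v) =
      ∫ x in (-a)..a, (((fderiv ℝ φ (x, v) (1, 0) : ℝ) : ℂ) * ((v : ℂ) * F (-a, v)) -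
        ((fderiv ℝ φ (x, v) (1, 0) : ℝ) : ℂ) * ∫ t in (-a)..x, w (t, v)) := by
    rw [intervalIntegral.integral_of_le hle, intervalIntegral.integral_of_le hle,
      integral_Ioc_eq_integral_Ioo, integral_Ioc_eq_integral_Ioo]
    refine integral_congr_ae ?_
    filter_upwards [hFv, ae_restrict_mem measurableSet_Ioo] with x hx hx'
    rw [hx]
    push_cast
    linear_combination ((fderiv ℝ φ (x, v) (1, 0) : ℝ) : ℂ) * e x hx'
  rw [e1, intervalIntegral.integral_sub ((hdc.fun_mul continuous_const).intervalIntegrable _ _)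
    ((hdc.continuousOn.fun_mul hN).intervalIntegrable), intervalIntegral.integral_mul_const, key0]
  simp only [zero_mul, zero_sub]
  linear_combination -key

end WeakForm


/-! ### Free flight from a wall or a source to a wall or an interior point. -/

section Flights

/-- The attenuation `exp (-z |d| / |v|)` along a flight of length `|d|` with velocity `v`. -/
def transit (z : ℂ) (d v : ℝ) : ℂ := Complex.exp (-(rightHalf z * ((|d| / |v| : ℝ) : ℂ)))

theorem norm_transit (z : ℂ) (d v : ℝ) :
    ‖transit z d v‖ = Real.exp (-((rightHalf z).re * (|d| / |v|))) :=
  norm_dampSymbol (fun _ : Unit => d) (fun _ => v) z ()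

theorem measurable_transit {α : Type*} [MeasurableSpace α] {y r : α → ℝ} (hy : Measurable y)
    (hr : Measurable r) (z : ℂ) : Measurable fun x => transit z (y x) (r x) :=
  measurable_dampSymbol hy hr z

theorem integral_exp_neg_mul_abs {b : ℝ} (hb : 0 < b) : ∫ x : ℝ, Real.exp (-b * |x|) = 2 / b := by
  rw [integral_comp_abs (f := fun x => Real.exp (-b * x)), integral_exp_mul_Ioi (by linarith)]
  simp
  ring

/-- The singular factor `1 / |v|` is offset by decay at the rate `z.re / |v|`, so the bound is
uniform in `v`. It blows up as `z.re` tends to 0, which is why the imaginary axis is reached only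
for sources divisible by a power of `|v|`. -/
theorem lintegral_transit_le {z : ℂ} (hz : 0 < z.re) {v : ℝ} (hv : v ≠ 0) (y : ℝ) :
    ∫⁻ x, ‖transit z (x - y) v / (|v| : ℝ)‖ₑ ≤ ENNReal.ofReal (2 / z.re) := by
  have hv' : 0 < |v| := abs_pos.2 hv
  have hb : 0 < z.re / |v| := by positivity
  have e : ∀ x, ‖transit z (x - y) v / (|v| : ℝ)‖ₑ =
      ENNReal.ofReal (Real.exp (-(z.re / |v|) * |x - y|) / |v|) := fun x => by
    rw [← ofReal_norm, norm_div, norm_transit, rightHalf_of_nonneg hz.le, Complex.norm_real,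
      Real.norm_of_nonneg hv'.le]
    congr 3
    ring
  simp only [e]
  rw [lintegral_sub_right_eq_self
    (fun x => ENNReal.ofReal (Real.exp (-(z.re / |v|) * |x|) / |v|)) y]
  have hI := integral_exp_neg_mul_abs hb
  have hi : Integrable fun x : ℝ => Real.exp (-(z.re / |v|) * |x|) := by
    by_contra h
    rw [integral_undef h] at hI
    have : 0 < 2 / (z.re / |v|) := by positivity
    linarith
  rw [← ofReal_integral_eq_lintegral_ofReal (hi.div_const _)
    (Eventually.of_forall fun x => by positivity), integral_div, hI]
  refine ENNReal.ofReal_le_ofReal (le_of_eq ?_)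
  field_simp

variable {a : ℝ}

theorem lintegral_mul_snd_le {κ : ℝ × ℝ → ℝ≥0∞} (hκ : Measurable κ) {C : ℝ≥0∞}
    (hC : ∀ᵐ v ∂velAll, ∫⁻ x, κ (x, v) ∂(slabMeasure a) ≤ C) {F : ℝ → ℝ≥0∞} (hF : Measurable F) :
    ∫⁻ y, κ y * F y.2 ∂(phase a) ≤ C * ∫⁻ v, F v ∂velAll := by
  rw [phase_eq, lintegral_prod_symm' _ (hκ.fun_mul (hF.fun_comp measurable_snd)),
    ← lintegral_const_mul _ hF]
  refine lintegral_mono_ae (hC.mono fun v hv => ?_)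
  simp only
  rw [lintegral_mul_const _ (by fun_prop : Measurable fun x => κ (x, v))]
  gcongr

theorem wcomp_snd {κ : ℝ × ℝ → ℂ} (hκ : Measurable κ) {C : ℝ≥0}
    (hC : ∀ᵐ v ∂velAll, ∫⁻ x, ‖κ (x, v)‖ₑ ∂(slabMeasure a) ≤ C) :
    WComp Prod.snd κ velAll (phase a) C where
  measurable_map := measurable_snd
  measurable_weight := hκ
  bound _ hF := lintegral_mul_snd_le hκ.enorm hC hF

theorem wcomp_flight {κ : ℝ × ℝ × ℝ → ℂ} (hκ : Measurable κ) {C : ℝ≥0}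
    (hC : ∀ ξ, ∀ᵐ v ∂velAll, ∫⁻ x, ‖κ (ξ, x, v)‖ₑ ∂(slabMeasure a) ≤ C) :
    WComp (fun t : ℝ × ℝ × ℝ => (t.1, t.2.2)) κ (phase a) ((slabMeasure a).prod (phase a)) C where
  measurable_map := by fun_prop
  measurable_weight := hκ
  bound F hF := by
    rw [lintegral_prod _ (by fun_prop)]
    have e : ∫⁻ y, F y ∂(phase a) = ∫⁻ ξ in Ioo (-a) a, ∫⁻ v in Ioo (-1) 1, F (ξ, v) := by
      rw [phase_eq, lintegral_prod _ hF.aemeasurable]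
    rw [e, ← lintegral_const_mul _ (by fun_prop)]
    refine lintegral_mono fun ξ => ?_
    exact lintegral_mul_snd_le (hκ.comp (measurable_const.prodMk measurable_id)).enorm (hC ξ)
      (hF.comp (measurable_const.prodMk measurable_id))

/-- The end of the slab where particles of velocity `v` come in. -/
def entry (a v : ℝ) : ℝ := if 0 < v then -a else a

theorem measurable_entry (a : ℝ) : Measurable (entry a) :=
  Measurable.ite measurableSet_Ioi measurable_const measurable_const

/-- The signed distance from the point of entry. -/
def distIn (a : ℝ) (y : ℝ × ℝ) : ℝ := y.1 - entry a y.2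

/-- The signed distance from the point of exit. -/
def distOut (a : ℝ) (y : ℝ × ℝ) : ℝ := y.1 + entry a y.2

/-- The signed length of the flight from `ξ` to `x`. -/
def distFlight (t : ℝ × ℝ × ℝ) : ℝ := t.2.1 - t.1

theorem measurable_distIn (a : ℝ) : Measurable (distIn a) :=
  measurable_fst.sub ((measurable_entry a).comp measurable_snd)

theorem measurable_distOut (a : ℝ) : Measurable (distOut a) :=
  measurable_fst.add ((measurable_entry a).comp measurable_snd)

theorem measurable_distFlight : Measurable distFlight := by unfold distFlight; fun_prop

theorem measurable_flightVel : Measurable fun t : ℝ × ℝ × ℝ => t.2.2 := by fun_prop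

/-- Flights go in the direction of the velocity. -/
def forward : Set (ℝ × ℝ × ℝ) := {t | 0 < (t.2.1 - t.1) * t.2.2}

theorem measurableSet_forward : MeasurableSet forward :=
  measurableSet_lt measurable_const (by fun_prop)

theorem slabMeasure_univ (a : ℝ) : slabMeasure a univ = (2 * a).toNNReal := by
  simp only [slabMeasure, Measure.restrict_apply_univ, Real.volume_Ioo]
  rw [ENNReal.ofReal]
  congr 2
  ring

theorem wcomp_lift (a : ℝ) :
    WComp Prod.snd (fun _ => 1) velAll (phase a) (2 * a).toNNReal :=
  wcomp_snd measurable_const (Eventually.of_forall fun v => by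
    rw [enorm_one, lintegral_one, slabMeasure_univ])

theorem wcomp_spread (a : ℝ) :
    WComp (fun t : ℝ × ℝ × ℝ => (t.1, t.2.2)) (forward.indicator fun _ => 1)
    (phase a) ((slabMeasure a).prod (phase a)) (2 * a).toNNReal := by
  refine wcomp_flight (measurable_const.indicator measurableSet_forward) fun ξ =>
    Eventually.of_forall fun v => ?_
  rw [← slabMeasure_univ, ← lintegral_one]
  refine lintegral_mono fun x => (enorm_indicator_le_enorm_self _ _).trans ?_
  rw [enorm_one]

/-- `h ↦ exp (-z |x - x₀(v)| / |v|) h(v)`, where `x₀(v)` is the point of entry. -/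
def emit (a : ℝ) (z : ℂ) : L1Vel →L[ℂ] L1Phase a :=
  (damp (phase a) (measurable_distIn a) measurable_snd z).comp (wcomp (wcomp_lift a))

/-- `g ↦ ∫ exp (-z |x - x₁(v)| / |v|) g(x, v) dx`, where `x₁(v)` is the point of exit. -/
def collect (a : ℝ) (z : ℂ) : L1Phase a →L[ℂ] L1Vel :=
  (proj (phase_eq a)).comp (damp (phase a) (measurable_distOut a) measurable_snd z)

/-- `g ↦ ∫ exp (-z |x - ξ| / |v|) g(ξ, v) dξ`, the integral over the `ξ` before `x`. -/
def stream (a : ℝ) (z : ℂ) : L1Phase a →L[ℂ] L1Phase a :=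
  (proj (P := (slabMeasure a).prod (phase a)) rfl).comp
    ((damp ((slabMeasure a).prod (phase a)) measurable_distFlight measurable_flightVel z).comp
      (wcomp (wcomp_spread a)))

/-- The weight of `emitDensity`. -/
def emitWeight (a : ℝ) (z : ℂ) (y : ℝ × ℝ) : ℂ := transit z (y.1 - entry a y.2) y.2 / (|y.2| : ℝ)

/-- The weight of `streamDensity`. -/
def streamWeight (z : ℂ) : ℝ × ℝ × ℝ → ℂ :=
  forward.indicator fun t => transit z (t.2.1 - t.1) t.2.2 / (|t.2.2| : ℝ)

theorem wcomp_emitWeight (a : ℝ) {z : ℂ} (hz : 0 < z.re) :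
    WComp Prod.snd (emitWeight a z) velAll (phase a) (2 / z.re).toNNReal := by
  refine wcomp_snd ?_ (ae_velAll_ne_zero.mono fun v hv => ?_)
  · exact (measurable_transit (measurable_distIn a) measurable_snd z).div (by fun_prop)
  · exact (setLIntegral_le_lintegral _ _).trans (lintegral_transit_le hz hv (entry a v))

theorem wcomp_streamWeight (a : ℝ) {z : ℂ} (hz : 0 < z.re) :
    WComp (fun t : ℝ × ℝ × ℝ => (t.1, t.2.2)) (streamWeight z)
      (phase a) ((slabMeasure a).prod (phase a)) (2 / z.re).toNNReal := by
  refine wcomp_flight ?_ fun ξ => ae_velAll_ne_zero.mono fun v hv => ?_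
  · exact ((measurable_transit measurable_distFlight measurable_flightVel z).div
      (by fun_prop)).indicator measurableSet_forward
  · refine (setLIntegral_le_lintegral _ _).trans
      (le_trans (lintegral_mono fun x => ?_) (lintegral_transit_le hz hv ξ))
    exact enorm_indicator_le_enorm_self _ _

/-- The particle density due to an inflow through the walls. -/
def emitDensity (a : ℝ) {z : ℂ} (hz : 0 < z.re) : L1Vel →L[ℂ] L1Phase a :=
  wcomp (wcomp_emitWeight a hz)

/-- The particle density due to a source in the slab. -/
def streamDensity (a : ℝ) {z : ℂ} (hz : 0 < z.re) : L1Phase a →L[ℂ] L1Phase a :=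
  (proj (P := (slabMeasure a).prod (phase a)) rfl).comp (wcomp (wcomp_streamWeight a hz))

theorem collect_coe (a : ℝ) (z : ℂ) (g : L1Phase a) : collect a z g =ᵐ[velAll] fun v =>
    ∫ x in Ioo (-a) a, transit z (x + entry a v) v * g (x, v) := by
  refine (proj_coe (phase_eq a) _).trans ?_
  filter_upwards [ae_velAll_ae_slab (damp_coe (μ := phase a) (measurable_distOut a)
    measurable_snd z g)] with v hv
  exact integral_congr_ae hv

theorem emitDensity_coe (a : ℝ) {z : ℂ} (hz : 0 < z.re) (h : L1Vel) :
    emitDensity a hz h =ᵐ[phase a] fun y => emitWeight a z y * h y.2 := wcomp_coe _ _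

theorem streamDensity_coe (a : ℝ) {z : ℂ} (hz : 0 < z.re) (g : L1Phase a) :
    streamDensity a hz g =ᵐ[phase a] fun y =>
      ∫ ξ in Ioo (-a) a, streamWeight z (ξ, y) * g (ξ, y.2) := by
  refine (proj_coe (P := (slabMeasure a).prod (phase a)) rfl _).trans ?_
  filter_upwards [ae_snd_of_prod_eq rfl (wcomp_coe (wcomp_streamWeight a hz) g)] with y hy
  exact integral_congr_ae hy

end Flights


/-! ### Solution formulas for a single velocity. -/

section Resolvent

variable {a : ℝ}

theorem transit_neg (z : ℂ) (d v : ℝ) : transit z (-d) v = transit z d v := by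
  simp only [transit, abs_neg]

theorem transit_eq {z : ℂ} (hz : 0 ≤ z.re) {d v : ℝ} (h : 0 ≤ d * v) :
    transit z d v = Complex.exp (-(z / v * d)) := by
  have h1 : 0 ≤ d / v := by
    rcases eq_or_ne v 0 with rfl | hv
    · simp
    · rw [show d / v = d * v / v ^ 2 by field_simp]
      positivity
  rw [transit, rightHalf_of_nonneg hz, ← abs_div, abs_of_nonneg h1]
  push_cast
  congr 2
  ring

theorem entry_of_pos {v : ℝ} (hv : 0 < v) : entry a v = -a := if_pos hv

theorem entry_of_neg {v : ℝ} (hv : v < 0) : entry a v = a := if_neg hv.not_gt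

theorem entry_mem (ha : 0 < a) (v : ℝ) : entry a v ∈ Icc (-a) a := by
  unfold entry
  split_ifs <;> constructor <;> linarith

theorem neg_entry_mem (ha : 0 < a) (v : ℝ) : -entry a v ∈ Icc (-a) a := by
  have := entry_mem ha v
  constructor <;> linarith [this.1, this.2]

theorem sub_entry_mul_nonneg {v x : ℝ} (hx : x ∈ Icc (-a) a) : 0 ≤ (x - entry a v) * v := by
  unfold entry
  split_ifs with h
  · exact mul_nonneg (by linarith [hx.1]) h.le
  · exact mul_nonneg_of_nonpos_of_nonpos (by linarith [hx.2]) (not_lt.1 h)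

theorem neg_entry_sub_mul_pos {v ξ : ℝ} (hv : v ≠ 0) (hξ : ξ ∈ Ioo (-a) a) :
    0 < (-entry a v - ξ) * v := by
  rcases hv.lt_or_gt with h | h
  · rw [entry_of_neg h]
    exact mul_pos_of_neg_of_neg (by linarith [hξ.1]) h
  · rw [entry_of_pos h]
    exact mul_pos (by linarith [hξ.2]) h

/-- Multiplying by the sign of `v` turns the oriented integral from the entry point into an integral
over the points upstream of `x`, so both directions are treated at once. -/
theorem sign_mul_integral_flight {v : ℝ} (hv : v ≠ 0) {x : ℝ} (hx : x ∈ Icc (-a) a) (φ : ℝ → ℂ) :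
    (v : ℂ) / (|v| : ℝ) * ∫ t in (entry a v)..x, φ t =
      ∫ ξ in Ioo (-a) a, if 0 < (x - ξ) * v then φ ξ else 0 := by
  have hv' : (v : ℂ) ≠ 0 := by exact_mod_cast hv
  rcases hv.lt_or_gt with h | h
  · have e : (fun ξ => if 0 < (x - ξ) * v then φ ξ else 0) = (Ioi x).indicator φ := by
      funext ξ
      rw [indicator_apply]
      refine if_congr ?_ rfl rfl
      refine ⟨fun h' => ?_, fun h' => mul_pos_of_neg_of_neg (sub_neg.2 h') h⟩
      by_contra hc
      exact h'.not_ge (mul_nonpos_of_nonneg_of_nonpos (sub_nonneg.2 (not_lt.1 hc)) h.le)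
    rw [e, setIntegral_indicator measurableSet_Ioi, entry_of_neg h, abs_of_neg h,
      intervalIntegral.integral_of_ge hx.2, integral_Ioc_eq_integral_Ioo, Ioo_inter_Ioi,
      sup_of_le_right hx.1]
    push_cast
    field_simp
  · have e : (fun ξ => if 0 < (x - ξ) * v then φ ξ else 0) = (Iio x).indicator φ := by
      funext ξ
      rw [indicator_apply]
      refine if_congr ?_ rfl rfl
      rw [mul_pos_iff_of_pos_right h]
      simp
    rw [e, setIntegral_indicator measurableSet_Iio, entry_of_pos h, abs_of_pos h,
      intervalIntegral.integral_of_le hx.1, integral_Ioc_eq_integral_Ioo, Ioo_inter_Iio,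
      inf_of_le_right hx.2, div_self hv', one_mul]

/-- The fluxes in terms of the inflow and the source, for one velocity. -/
theorem flux_eq {z : ℂ} (hz : 0 ≤ z.re) {v : ℝ} (hv : v ≠ 0) {γ P : ℝ → ℂ} {p : ℂ}
    (h : ∀ x ∈ Icc (-a) a, P x = Complex.exp (-(z / v * ((x : ℂ) - entry a v))) * p +
      ∫ t in (entry a v)..x, Complex.exp (-(z / v * ((x : ℂ) - t))) * γ t)
    {x : ℝ} (hx : x ∈ Icc (-a) a) :
    (v : ℂ) / (|v| : ℝ) * P x = transit z (x - entry a v) v * ((v : ℂ) / (|v| : ℝ) * p) +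
      ∫ ξ in Ioo (-a) a, if 0 < (x - ξ) * v then transit z (x - ξ) v * γ ξ else 0 := by
  rw [h x hx, mul_add, sign_mul_integral_flight hv hx, transit_eq hz (sub_entry_mul_nonneg hx)]
  congr 1
  · push_cast
    ring
  · refine integral_congr_ae (Eventually.of_forall fun ξ => ?_)
    simp only
    split_ifs with h'
    · rw [transit_eq hz h'.le]
      push_cast
      rfl
    · rfl

theorem continuousOn_exp_formula {c p : ℂ} {b a₀ a₁ : ℝ} (hb : b ∈ Icc a₀ a₁) {γ : ℝ → ℂ}
    (hγ : IntegrableOn γ (Icc a₀ a₁)) :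
    ContinuousOn (fun x : ℝ => Complex.exp (-(c * ((x : ℂ) - b))) * p +
      ∫ t in b..x, Complex.exp (-(c * ((x : ℂ) - t))) * γ t) (Icc a₀ a₁) := by
  have e : ∀ x : ℝ, ∫ t in b..x, Complex.exp (-(c * ((x : ℂ) - t))) * γ t =
      Complex.exp (-(c * x)) * ∫ t in b..x, Complex.exp (c * t) * γ t := fun x => by
    rw [← intervalIntegral.integral_const_mul]
    refine intervalIntegral.integral_congr fun t _ => ?_
    rw [← mul_assoc, ← Complex.exp_add]
    congr 2
    ring
  simp only [e]
  have hle : a₀ ≤ a₁ := hb.1.trans hb.2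
  have hi : IntegrableOn (fun t : ℝ => Complex.exp (c * t) * γ t) (Icc a₀ a₁) :=
    hγ.continuousOn_mul (by fun_prop) isCompact_Icc
  have hN : ContinuousOn (fun x => ∫ t in b..x, Complex.exp (c * t) * γ t) (Icc a₀ a₁) := by
    have := intervalIntegral.continuousOn_primitive_interval' (b₁ := a₀) (b₂ := a₁) (a := b)
      (μ := volume) (f := fun t : ℝ => Complex.exp (c * t) * γ t)
      ((intervalIntegrable_iff_integrableOn_Icc_of_le hle).2 hi) (by rwa [uIcc_of_le hle])
    rwa [uIcc_of_le hle] at this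
  exact (by fun_prop : Continuous fun x : ℝ =>
      Complex.exp (-(c * ((x : ℂ) - b))) * p).continuousOn.add
    ((by fun_prop : Continuous fun x : ℝ => Complex.exp (-(c * x))).continuousOn.mul hN)

theorem fade_velAll_coe {z : ℂ} (h : L1Vel) :
    fade velAll (2 * a) z h =ᵐ[velAll] fun v => transit z (-entry a v - entry a v) v * h v := by
  refine (damp_coe _ _ _ _).trans (Eventually.of_forall fun v => ?_)
  simp only [dampSymbol, transit, id]
  congr 6
  unfold entry
  split_ifs
  · congr 1; ring
  · rw [← abs_neg]; congr 1; ring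

/-- The values of a density with given inflow and source. -/
theorem density_eq {z : ℂ} {v : ℝ} (hv : v ≠ 0) {γ F : ℝ → ℂ} {q : ℂ} {x : ℝ}
    (h : (v : ℂ) / (|v| : ℝ) * ((v : ℂ) * F x) = transit z (x - entry a v) v * q +
      ∫ ξ in Ioo (-a) a, if 0 < (x - ξ) * v then transit z (x - ξ) v * γ ξ else 0) :
    F x = emitWeight a z (x, v) * q +
      ∫ ξ in Ioo (-a) a, streamWeight z (ξ, x, v) * γ ξ := by
  have hv' : ((|v| : ℝ) : ℂ) ≠ 0 := by exact_mod_cast (abs_pos.2 hv).ne'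
  have e : (v : ℂ) / (|v| : ℝ) * ((v : ℂ) * F x) = (|v| : ℝ) * F x := by
    have : (v : ℂ) * v = (|v| : ℝ) * (|v| : ℝ) := by exact_mod_cast (abs_mul_abs_self v).symm
    field_simp
    linear_combination F x * this
  have e2 : ∫ ξ in Ioo (-a) a, streamWeight z (ξ, x, v) * γ ξ = ((|v| : ℝ) : ℂ)⁻¹ *
      ∫ ξ in Ioo (-a) a, if 0 < (x - ξ) * v then transit z (x - ξ) v * γ ξ else 0 := by
    rw [← integral_const_mul]
    refine integral_congr_ae (Eventually.of_forall fun ξ => ?_)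
    simp only [streamWeight, indicator_apply, forward, mem_ofPred_eq]
    split_ifs
    · ring
    · simp
  rw [e] at h
  rw [e2, emitWeight]
  have h' : F x = ((|v| : ℝ) : ℂ)⁻¹ * ((|v| : ℝ) * F x) := by rw [inv_mul_cancel_left₀ hv']
  rw [h', h]
  ring

/-- At the point of exit, `-entry a v`, every point of the slab is upstream. Thus `collect` is the
source term of the flux formula evaluated there. -/
theorem collect_ae_eq (a : ℝ) (z : ℂ) (g : L1Phase a) : collect a z g =ᵐ[velAll] fun v =>
    ∫ ξ in Ioo (-a) a, if 0 < (-entry a v - ξ) * v then transit z (-entry a v - ξ) v * g (ξ, v)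
      else 0 := by
  filter_upwards [collect_coe a z g, ae_velAll_ne_zero] with v hv h0
  rw [hv]
  refine setIntegral_congr_fun measurableSet_Ioo fun ξ hξ => ?_
  simp only [if_pos (neg_entry_sub_mul_pos h0 hξ)]
  rw [← transit_neg]
  congr 2
  ring

end Resolvent


/-! ### The resolvent in the open right half plane: uniqueness and existence. -/

section Graph

variable {a : ℝ}

theorem sign_mul_mul {v : ℝ} (hv : v ≠ 0) (y : ℂ) :
    (v : ℂ) / (|v| : ℝ) * ((v : ℂ) * y) = (|v| : ℝ) * y := by
  have hv' : ((|v| : ℝ) : ℂ) ≠ 0 := by exact_mod_cast (abs_pos.2 hv).ne'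
  have : (v : ℂ) * v = (|v| : ℝ) * (|v| : ℝ) := by exact_mod_cast (abs_mul_abs_self v).symm
  field_simp
  linear_combination y * this

theorem sign_mul_sign_mul {v : ℝ} (hv : v ≠ 0) (y : ℂ) :
    (v : ℂ) / (|v| : ℝ) * ((v : ℂ) / (|v| : ℝ) * y) = y := by
  have hv' : ((|v| : ℝ) : ℂ) ≠ 0 := by exact_mod_cast (abs_pos.2 hv).ne'
  have : (v : ℂ) * v = (|v| : ℝ) * (|v| : ℝ) := by exact_mod_cast (abs_mul_abs_self v).symm
  field_simp
  linear_combination y * this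

theorem ae_phase_of_ae_ae {p : ℝ × ℝ → Prop} (hp : MeasurableSet {y | p y})
    (h : ∀ᵐ v ∂velAll, ∀ᵐ x ∂(slabMeasure a), p (x, v)) : ∀ᵐ y ∂(phase a), p y := by
  have h0 : (slabMeasure a).prod velAll {y | p y}ᶜ = 0 := by
    rw [Measure.prod_apply_symm hp.compl, lintegral_eq_zero_iff'
      (measurable_measure_prodMk_right hp.compl).aemeasurable]
    exact h
  rw [phase_eq]
  exact h0

theorem ae_velAll_of_res {u : L1Vel} {φ : ℝ → ℂ} (hp : ∀ᵐ v ∂velPos, 0 < v → resPos u v = φ v)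
    (hn : ∀ᵐ v ∂velNeg, v < 0 → resNeg u v = φ v) : ∀ᵐ v ∂velAll, u v = φ v := by
  refine ae_velAll_of_pos_of_neg ?_ ?_
  · filter_upwards [hp, resPos_coe u, ae_restrict_mem measurableSet_Ioo] with v h1 h2 h3
    rw [← h2, h1 h3.1]
  · filter_upwards [hn, resNeg_coe u, ae_restrict_mem measurableSet_Ioo] with v h1 h2 h3
    rw [← h2, h1 h3.2]

theorem ae_sub_smul (z : ℂ) {f w g : L1Phase a} (h : z • f - w = g) :
    ∀ᵐ v ∂velAll, ∀ᵐ x ∂(slabMeasure a), w (x, v) = z * f (x, v) - g (x, v) := by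
  refine ae_velAll_ae_slab (P := fun y => w y = z * f y - g y) ?_
  rw [← h]
  filter_upwards [Lp.coeFn_sub (z • f) w, Lp.coeFn_smul z f] with y h1 h2
  rw [h1, Pi.sub_apply, h2, Pi.smul_apply, smul_eq_mul]
  ring

theorem integral_transport_congr {z : ℂ} {v : ℝ} (hv : v ≠ 0) {f F w g : ℝ → ℂ}
    (hF : ∀ᵐ x ∂(slabMeasure a), f x = F x)
    (hw : ∀ᵐ x ∂(slabMeasure a), w x = z * f x - g x) {b x : ℝ} (hb : b ∈ Icc (-a) a)
    (hx : x ∈ Icc (-a) a) :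
    ∫ t in b..x, w t = ∫ t in b..x, (z / v * ((v : ℂ) * F t) - g t) := by
  have hv' : (v : ℂ) ≠ 0 := by exact_mod_cast hv
  have h : ∀ᵐ t ∂(volume.restrict (Icc (-a) a)), w t = z / v * ((v : ℂ) * F t) - g t := by
    rw [← Measure.restrict_congr_set Ioo_ae_eq_Icc]
    filter_upwards [hF, hw] with t h1 h2
    rw [h2, h1]
    field_simp
  refine intervalIntegral.integral_congr_ae ?_
  filter_upwards [(ae_restrict_iff' measurableSet_Icc).1 h] with t ht ht'
  exact ht ((convex_Icc (-a) a).ordConnected.uIcc_subset hb hx (uIoc_subset_uIcc ht'))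

/-- The fluxes of an element of the domain of the transport operator. -/
theorem ae_flux_eq (ha : 0 < a) {z : ℂ} (hz : 0 < z.re) {f w g : L1Phase a}
    (h : IsWeakTransport a f w) (hg : z • f - w = g) {F : ℝ × ℝ → ℂ} (hF : f =ᵐ[phase a] F)
    (hc : ∀ᵐ v ∂velAll, ContinuousOn (fun x => F (x, v)) (Icc (-a) a)) :
    ∀ᵐ (v : ℝ) ∂velAll, ∀ x ∈ Icc (-a) a, (v : ℂ) / (|v| : ℝ) * ((v : ℂ) * F (x, v)) =
      transit z (x - entry a v) v * ((|v| : ℝ) * F (entry a v, v)) +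
      ∫ ξ in Ioo (-a) a, if 0 < (x - ξ) * v then transit z (x - ξ) v * g (ξ, v) else 0 := by
  filter_upwards [h.ae_integrated ha hF hc, hc, ae_velAll_ae_slab hF, ae_sub_smul z hg,
    ae_integrable_slab g, ae_velAll_ne_zero] with v h1 h2 h3 h4 h5 h6
  intro x hx
  rw [← sign_mul_mul h6]
  refine flux_eq hz.le h6 (P := fun x => (v : ℂ) * F (x, v)) (fun x hx => ?_) hx
  refine eq_exp_of_integral_eq (P := fun x => (v : ℂ) * F (x, v)) (entry_mem ha v)
    (h2.const_smul (v : ℂ))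
    ((integrableOn_Icc_iff_integrableOn_Ioo).2 h5) (fun x hx => ?_) hx
  rw [h1 _ (entry_mem ha v) x hx, integral_transport_congr h6 h3 h4 (entry_mem ha v) hx]

variable {O₁ : L1Neg →L[ℂ] L1Pos} {O₂ : L1Pos →L[ℂ] L1Neg}

theorem velAll_eq_of_res {u : L1Vel} {f : L1Pos} {g : L1Neg} (hu : u = extPos f + extNeg g) :
    resPos u = f ∧ resNeg u = g := by
  rw [hu, map_add, map_add, resPos_extPos, resPos_extNeg, resNeg_extPos, resNeg_extNeg, add_zero,
    zero_add]
  exact ⟨rfl, rfl⟩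

/-- Uniqueness. The fluxes of any solution obey `o = E i + collect g` and `i = H o`; hence `(1 - H
E) i = H (collect g)` determines `i`, and the characteristic formula then determines `f`. -/
theorem TransportGraph.eq_density (ha : 0 < a) {z : ℂ} (hz : 0 < z.re)
    (hu : IsUnit (1 - crossing O₁ O₂ (2 * a) z)) {f w g : L1Phase a}
    (h : TransportGraph a O₁ O₂ f w) (hg : z • f - w = g) :
    f = emitDensity a hz (Ring.inverse (1 - crossing O₁ O₂ (2 * a) z)
      (crossOp O₁ O₂ (collect a z g))) + streamDensity a hz g := by
  obtain ⟨hweak, p, n, p', n', ⟨F, hF, hc, hp, hn, hp', hn'⟩, e₁, e₂⟩ := h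
  have key := ae_flux_eq ha hz hweak hg hF hc
  -- The incoming flux gathers the left wall for `v > 0` and the right wall for `v < 0`; the
  -- outgoing flux gathers the other two halves.
  set i : L1Vel := extPos p + extNeg n' with hi
  set o : L1Vel := extPos p' + extNeg n with ho
  obtain ⟨hi1, hi2⟩ := velAll_eq_of_res hi
  obtain ⟨ho1, ho2⟩ := velAll_eq_of_res ho
  have hiF : ∀ᵐ (v : ℝ) ∂velAll, i v = (|v| : ℝ) * F (entry a v, v) := by
    refine ae_velAll_of_res ?_ ?_
    · filter_upwards [hp] with v hv h0
      rw [hi1, hv, entry_of_pos h0]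
    · filter_upwards [hn'] with v hv h0
      rw [hi2, hv, entry_of_neg h0]
  have hoF : ∀ᵐ (v : ℝ) ∂velAll, o v = (|v| : ℝ) * F (-entry a v, v) := by
    refine ae_velAll_of_res ?_ ?_
    · filter_upwards [hp'] with v hv h0
      rw [ho1, hv, entry_of_pos h0, neg_neg]
    · filter_upwards [hn] with v hv h0
      rw [ho2, hv, entry_of_neg h0]
  have hoi : o = fade velAll (2 * a) z i + collect a z g := by
    refine Lp.ext ?_
    filter_upwards [Lp.coeFn_add (fade velAll (2 * a) z i) (collect a z g),
      fade_velAll_coe (a := a) (z := z) i, collect_ae_eq a z g, hiF, hoF, key, ae_velAll_ne_zero]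
      with v h1 h2 h3 h4 h5 h6 h7
    rw [h1, Pi.add_apply, h2, h3, h4, h5, ← sign_mul_mul h7, h6 _ (neg_entry_mem ha v)]
  have hio : i = crossOp O₁ O₂ o := by
    refine velAll_ext ?_ ?_
    · rw [resPos_crossOp, hi1, ho2, e₁]
    · rw [resNeg_crossOp, hi2, ho1, e₂]
  have hinv : i = Ring.inverse (1 - crossing O₁ O₂ (2 * a) z)
      (crossOp O₁ O₂ (collect a z g)) := by
    have h1 : (1 - crossing O₁ O₂ (2 * a) z) i = crossOp O₁ O₂ (collect a z g) := by
      have h2 := hio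
      rw [hoi, map_add] at h2
      have h3 : (1 - crossing O₁ O₂ (2 * a) z) i =
          i - crossOp O₁ O₂ (fade velAll (2 * a) z i) := rfl
      rw [h3]
      exact sub_eq_of_eq_add' h2
    rw [← h1]
    exact (DFunLike.congr_fun (Ring.inverse_mul_cancel _ hu) i).symm
  rw [← hinv]
  refine Lp.ext (ae_phase_of_ae_ae (measurableSet_eq_fun (Lp.stronglyMeasurable f).measurable
    (Lp.stronglyMeasurable _).measurable) ?_)
  filter_upwards [ae_velAll_ae_slab (Lp.coeFn_add (emitDensity a hz i) (streamDensity a hz g)),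
    ae_velAll_ae_slab (emitDensity_coe a hz i), ae_velAll_ae_slab (streamDensity_coe a hz g),
    ae_velAll_ae_slab hF, hiF, key, ae_velAll_ne_zero] with v h1 h2 h3 h4 h5 h6 h7
  filter_upwards [h1, h2, h3, h4, ae_restrict_mem measurableSet_Ioo] with x k1 k2 k3 k4 k5
  rw [k1, Pi.add_apply, k2, k3, k4]
  refine density_eq (F := fun x => F (x, v)) (γ := fun ξ => g (ξ, v)) h7 ?_
  rw [h6 x (Ioo_subset_Icc_self k5), h5]

/-- Existence. Fluxes that satisfy the balance and the wall conditions give a function whose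
explicit formula serves as the representative continuous in `x`. Its boundary values are recovered
as `i` at the entry and `o` at the exit. -/
theorem transportGraph_density (ha : 0 < a) {z : ℂ} (hz : 0 < z.re) {g : L1Phase a} {i o : L1Vel}
    (ho : o = fade velAll (2 * a) z i + collect a z g) (hi : i = crossOp O₁ O₂ o) :
    TransportGraph a O₁ O₂ (emitDensity a hz i + streamDensity a hz g)
      (z • (emitDensity a hz i + streamDensity a hz g) - g) := by
  set f := emitDensity a hz i + streamDensity a hz g with hf
  set F : ℝ × ℝ → ℂ := fun y => emitWeight a z y * i y.2 +
    ∫ ξ in Ioo (-a) a, streamWeight z (ξ, y) * g (ξ, y.2) with hFdef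
  have hF : f =ᵐ[phase a] F := by
    filter_upwards [Lp.coeFn_add (emitDensity a hz i) (streamDensity a hz g),
      emitDensity_coe a hz i, streamDensity_coe a hz g] with y h1 h2 h3
    rw [hf, h1, Pi.add_apply, h2, h3]
  have key : ∀ᵐ (v : ℝ) ∂velAll, ∀ x ∈ Icc (-a) a, (v : ℂ) * F (x, v) =
      Complex.exp (-(z / v * ((x : ℂ) - entry a v))) * ((v : ℂ) / (|v| : ℝ) * i v) +
      ∫ t in (entry a v)..x, Complex.exp (-(z / v * ((x : ℂ) - t))) * g (t, v) := by
    filter_upwards [ae_velAll_ne_zero] with v hv x hx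
    have hv' : (v : ℂ) ≠ 0 := by exact_mod_cast hv
    set P : ℝ → ℂ := fun x => Complex.exp (-(z / v * ((x : ℂ) - entry a v))) *
      ((v : ℂ) / (|v| : ℝ) * i v) +
      ∫ t in (entry a v)..x, Complex.exp (-(z / v * ((x : ℂ) - t))) * g (t, v) with hP
    have h1 := flux_eq hz.le hv (γ := fun t => g (t, v)) (P := P) (fun _ _ => rfl) hx
    rw [sign_mul_sign_mul hv] at h1
    have h2 := density_eq (F := fun x => (v : ℂ)⁻¹ * P x) (γ := fun t => g (t, v)) (x := x) hv
      (by simp only [mul_inv_cancel_left₀ hv']; exact h1)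
    have h3 : F (x, v) = (v : ℂ)⁻¹ * P x := h2.symm
    rw [h3, mul_inv_cancel_left₀ hv']
  have key' : ∀ᵐ (v : ℝ) ∂velAll, ∀ x ∈ Icc (-a) a, ((|v| : ℝ) : ℂ) * F (x, v) =
      transit z (x - entry a v) v * i v +
      ∫ ξ in Ioo (-a) a, if 0 < (x - ξ) * v then transit z (x - ξ) v * g (ξ, v) else 0 := by
    filter_upwards [key, ae_velAll_ne_zero] with v h1 hv x hx
    have h2 := flux_eq hz.le hv (γ := fun t => g (t, v)) (P := fun x => (v : ℂ) * F (x, v)) h1 hx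
    rwa [sign_mul_mul hv, sign_mul_sign_mul hv] at h2
  have hiF : ∀ᵐ (v : ℝ) ∂velAll, i v = (|v| : ℝ) * F (entry a v, v) := by
    filter_upwards [key, ae_velAll_ne_zero] with v h1 hv
    have h2 := h1 _ (entry_mem ha v)
    rw [sub_self, mul_zero, neg_zero, Complex.exp_zero, one_mul, intervalIntegral.integral_same,
      add_zero] at h2
    rw [← sign_mul_mul hv, h2, sign_mul_sign_mul hv]
  have hoF : ∀ᵐ (v : ℝ) ∂velAll, o v = (|v| : ℝ) * F (-entry a v, v) := by
    rw [ho]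
    filter_upwards [Lp.coeFn_add (fade velAll (2 * a) z i) (collect a z g),
      fade_velAll_coe (a := a) (z := z) i, collect_ae_eq a z g, key'] with v h1 h2 h3 h4
    rw [h1, Pi.add_apply, h2, h3, h4 _ (neg_entry_mem ha v)]
  have hw := ae_sub_smul z (show z • f - (z • f - g) = g from sub_sub_cancel _ _)
  refine ⟨isWeakTransport_of_ae_integrated ha hF ?_, resPos i, resNeg o, resPos o, resNeg i,
    ⟨F, hF, ?_, ?_, ?_, ?_, ?_⟩, ?_, ?_⟩
  · filter_upwards [key, hw, ae_velAll_ae_slab hF, ae_integrable_slab g, ae_velAll_ne_zero]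
      with v h1 h2 h3 h4 h5
    refine ⟨entry a v, entry_mem ha v, fun x hx => ?_⟩
    have h0 := h1 _ (entry_mem ha v)
    rw [sub_self, mul_zero, neg_zero, Complex.exp_zero, one_mul, intervalIntegral.integral_same,
      add_zero] at h0
    have hsub := (convex_Icc (-a) a).ordConnected.uIcc_subset (entry_mem ha v) hx
    rw [integral_transport_congr h5 h3 h2 (entry_mem ha v) hx, h0]
    exact integral_eq_of_eq_exp (P := fun x => (v : ℂ) * F (x, v))
      ((((integrableOn_Icc_iff_integrableOn_Ioo).2 h4).mono_set hsub).intervalIntegrable)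
      fun t ht => h1 t (hsub ht)
  · filter_upwards [key, ae_integrable_slab g, ae_velAll_ne_zero] with v h1 h2 h3
    have hv' : (v : ℂ) ≠ 0 := by exact_mod_cast h3
    have hcont := (continuousOn_exp_formula (c := z / v) (p := (v : ℂ) / (|v| : ℝ) * i v)
      (entry_mem ha v) ((integrableOn_Icc_iff_integrableOn_Ioo).2 h2)).const_smul (v : ℂ)⁻¹
    refine hcont.congr fun x hx => ?_
    simp only [Pi.smul_apply, smul_eq_mul]
    rw [← h1 x hx, inv_mul_cancel_left₀ hv']
  · filter_upwards [ae_velPos_of_velAll hiF, resPos_coe i, ae_restrict_mem measurableSet_Ioo]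
      with v h1 h2 h3
    rw [h2, h1, entry_of_pos h3.1]
  · filter_upwards [ae_velNeg_of_velAll hoF, resNeg_coe o, ae_restrict_mem measurableSet_Ioo]
      with v h1 h2 h3
    rw [h2, h1, entry_of_neg h3.2]
  · filter_upwards [ae_velPos_of_velAll hoF, resPos_coe o, ae_restrict_mem measurableSet_Ioo]
      with v h1 h2 h3
    rw [h2, h1, entry_of_pos h3.1, neg_neg]
  · filter_upwards [ae_velNeg_of_velAll hiF, resNeg_coe i, ae_restrict_mem measurableSet_Ioo]
      with v h1 h2 h3
    rw [h2, h1, entry_of_neg h3.2]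
  · rw [hi, resPos_crossOp]
  · rw [hi, resNeg_crossOp]

variable (O₁ O₂ a) in
/-- The resolvent of the transport operator in the right half plane. -/
def transportResolvent (z : ℂ) : L1Phase a →L[ℂ] L1Phase a :=
  if hz : 0 < z.re then (emitDensity a hz).comp ((Ring.inverse (1 - crossing O₁ O₂ (2 * a) z)).comp
    ((crossOp O₁ O₂).comp (collect a z))) + streamDensity a hz else 0

theorem transportResolvent_apply {z : ℂ} (hz : 0 < z.re) (g : L1Phase a) :
    transportResolvent a O₁ O₂ z g = emitDensity a hz (Ring.inverse (1 - crossing O₁ O₂ (2 * a) z)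
      (crossOp O₁ O₂ (collect a z g))) + streamDensity a hz g := by
  rw [transportResolvent, dif_pos hz]
  rfl

theorem isResolventAt_transportResolvent (ha : 0 < a) (h₁ : ‖O₁‖ ≤ 1) (h₂ : ‖O₂‖ ≤ 1) {z : ℂ}
    (hz : 0 < z.re) : IsResolventAt a O₁ O₂ z (transportResolvent a O₁ O₂ z) := by
  have hu : IsUnit (1 - crossing O₁ O₂ (2 * a) z) :=
    isUnit_one_sub_of_norm_lt_one (norm_crossing_lt_one (by positivity) h₁ h₂ hz)
  intro f g
  rw [transportResolvent_apply hz]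
  refine ⟨fun ⟨w, hw, hg⟩ => hw.eq_density ha hz hu hg, fun hf => ?_⟩
  set i := Ring.inverse (1 - crossing O₁ O₂ (2 * a) z) (crossOp O₁ O₂ (collect a z g)) with hi
  have hi' : i = crossOp O₁ O₂ (fade velAll (2 * a) z i + collect a z g) := by
    have h1 : (1 - crossing O₁ O₂ (2 * a) z) i = crossOp O₁ O₂ (collect a z g) :=
      DFunLike.congr_fun (Ring.mul_inverse_cancel _ hu) _
    have h3 : (1 - crossing O₁ O₂ (2 * a) z) i =
        i - crossOp O₁ O₂ (fade velAll (2 * a) z i) := rfl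
    rw [h3] at h1
    rw [map_add]
    exact eq_add_of_sub_eq' h1
  refine ⟨z • f - g, ?_, sub_sub_cancel _ _⟩
  rw [hf]
  exact transportGraph_density ha hz rfl hi'

end Graph


/-! ### All free-flight operators commute with multiplication by |v|. -/

section Intertwining

theorem clip_comp_proj {α β : Type*} [MeasurableSpace α] [MeasurableSpace β] {ρ : Measure β}
    [SFinite ρ] {σ : Measure α} [SFinite σ] {P : Measure (β × α)} (hP : P = ρ.prod σ) {r : α → ℝ}
    (hr : Measurable r) {r' : β × α → ℝ} (hr' : Measurable r') (hrr : ∀ x, r' x = r x.2) (Y : ℝ≥0) :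
    (clip σ hr Y).comp (proj hP) = (proj hP).comp (clip P hr' Y) := by
  ext1 f
  simp only [ContinuousLinearMap.comp_apply]
  refine Lp.ext ?_
  filter_upwards [wcomp_congr_apply (wcomp_min σ hr Y) (proj_coe hP f),
    proj_coe hP (clip P hr' Y f), ae_snd_of_prod_eq hP (clip_coe hr' Y f)] with y h1 h2 h3
  rw [h2]
  refine h1.trans ?_
  rw [integral_congr_ae h3, ← integral_const_mul]
  simp only [hrr, id]

variable (a : ℝ)

/-- Multiplication by `|v|` on the phase space. -/
def phaseSpeed : L1Phase a →L[ℂ] L1Phase a := clip (phase a) measurable_snd 1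

/-- Multiplication by `|v|` on the space of flights. -/
def flightSpeed : Lp ℂ 1 ((slabMeasure a).prod (phase a)) →L[ℂ]
    Lp ℂ 1 ((slabMeasure a).prod (phase a)) :=
  clip ((slabMeasure a).prod (phase a)) measurable_flightVel 1

theorem ae_phase_of_velAll {P : ℝ → Prop} (h : ∀ᵐ v ∂velAll, P v) :
    ∀ᵐ y ∂(phase a), P y.2 := by
  have := (wcomp_lift a).ae_of_ae h
  exact this.mono fun y hy => hy.resolve_left one_ne_zero

theorem ae_phase_speed : ∀ᵐ y ∂(phase a), 0 < |y.2| ∧ |y.2| ≤ 1 := ae_phase_of_velAll a ae_velAll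

theorem ae_flight_of_phase {P : ℝ × ℝ → Prop} (h : ∀ᵐ y ∂(phase a), P y) :
    ∀ᵐ t ∂((slabMeasure a).prod (phase a)), P t.2 :=
  Measure.quasiMeasurePreserving_snd.ae h

theorem ae_flight_speed : ∀ᵐ t ∂((slabMeasure a).prod (phase a)), 0 < |t.2.2| ∧ |t.2.2| ≤ 1 :=
  ae_flight_of_phase a (ae_phase_speed a)

theorem speed_comp_collect (z : ℂ) :
    (speed velAll).comp (collect a z) = (collect a z).comp (phaseSpeed a) := by
  have h1 := clip_comp_proj (phase_eq a) measurable_id (r' := Prod.snd) measurable_snd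
    (fun _ => rfl) 1
  have h2 := clip_comp_damp (μ := phase a) (measurable_distOut a) measurable_snd 1 z
  rw [speed, collect, ← ContinuousLinearMap.comp_assoc, h1, ContinuousLinearMap.comp_assoc, h2,
    ContinuousLinearMap.comp_assoc, phaseSpeed]

theorem phaseSpeed_comp_lift :
    (phaseSpeed a).comp (wcomp (wcomp_lift a)) = (wcomp (wcomp_lift a)).comp (speed velAll) :=
  clip_comp_wcomp measurable_id (wcomp_lift a) measurable_snd (fun _ => rfl) 1

theorem phaseSpeed_comp_emit (z : ℂ) :
    (phaseSpeed a).comp (emit a z) = (emit a z).comp (speed velAll) := by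
  have h2 := clip_comp_damp (μ := phase a) (measurable_distIn a) measurable_snd 1 z
  rw [emit, ← ContinuousLinearMap.comp_assoc, phaseSpeed, h2, ContinuousLinearMap.comp_assoc,
    ContinuousLinearMap.comp_assoc, ← phaseSpeed_comp_lift, phaseSpeed]

theorem flightSpeed_comp_spread :
    (flightSpeed a).comp (wcomp (wcomp_spread a)) = (wcomp (wcomp_spread a)).comp (phaseSpeed a) :=
  clip_comp_wcomp measurable_snd (wcomp_spread a) measurable_flightVel (fun _ => rfl) 1

theorem phaseSpeed_comp_proj :
    (phaseSpeed a).comp (proj (P := (slabMeasure a).prod (phase a)) rfl) =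
      (proj (P := (slabMeasure a).prod (phase a)) rfl).comp (flightSpeed a) :=
  clip_comp_proj rfl measurable_snd measurable_flightVel (fun _ => rfl) 1

theorem phaseSpeed_comp_stream (z : ℂ) :
    (phaseSpeed a).comp (stream a z) = (stream a z).comp (phaseSpeed a) := by
  have h2 := clip_comp_damp (μ := (slabMeasure a).prod (phase a)) measurable_distFlight
    measurable_flightVel 1 z
  rw [stream, ← ContinuousLinearMap.comp_assoc, phaseSpeed_comp_proj,
    ContinuousLinearMap.comp_assoc, ContinuousLinearMap.comp_assoc,
    ContinuousLinearMap.comp_assoc, ← flightSpeed_comp_spread]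
  congr 1
  rw [← ContinuousLinearMap.comp_assoc, ← ContinuousLinearMap.comp_assoc, flightSpeed, h2]

variable {z : ℂ} (hz : 0 < z.re)

/-- One power of `|v|` cancels the `1 / |v|` in the density. What remains, `emit`, is bounded also
for purely imaginary `z`, unlike `emitDensity`. -/
theorem emitDensity_comp_speed : (emitDensity a hz).comp (speed velAll) = emit a z := by
  ext1 h
  simp only [ContinuousLinearMap.comp_apply, emit]
  refine Lp.ext ?_
  filter_upwards [wcomp_congr_apply (wcomp_emitWeight a hz) (clip_coe measurable_id 1 h),
    wcomp_congr_apply (wcomp_dampSymbol (phase a) (measurable_distIn a) measurable_snd z)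
      (wcomp_coe (wcomp_lift a) h), ae_phase_speed a] with y h1 h2 h3
  refine h1.trans (Eq.trans ?_ h2.symm)
  have h0 : ((|y.2| : ℝ) : ℂ) ≠ 0 := by exact_mod_cast h3.1.ne'
  simp only [id, NNReal.coe_one, min_eq_left h3.2, emitWeight, one_mul]
  rw [← mul_assoc, div_mul_cancel₀ _ h0]
  rfl

theorem streamDensity_comp_phaseSpeed : (streamDensity a hz).comp (phaseSpeed a) = stream a z := by
  rw [streamDensity, stream, ContinuousLinearMap.comp_assoc]
  congr 1
  ext1 g
  simp only [ContinuousLinearMap.comp_apply]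
  refine Lp.ext ?_
  filter_upwards [wcomp_congr_apply (wcomp_streamWeight a hz) (clip_coe measurable_snd 1 g),
    wcomp_congr_apply (wcomp_dampSymbol ((slabMeasure a).prod (phase a)) measurable_distFlight
      measurable_flightVel z) (wcomp_coe (wcomp_spread a) g), ae_flight_speed a] with t h1 h2 h3
  refine h1.trans (Eq.trans ?_ h2.symm)
  have h0 : ((|t.2.2| : ℝ) : ℂ) ≠ 0 := by exact_mod_cast h3.1.ne'
  simp only [id, NNReal.coe_one, min_eq_left h3.2, streamWeight]
  by_cases ht : t ∈ forward
  · rw [indicator_of_mem ht, indicator_of_mem ht, one_mul, ← mul_assoc, div_mul_cancel₀ _ h0]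
    rfl
  · rw [indicator_of_notMem ht, indicator_of_notMem ht, zero_mul, zero_mul, mul_zero]

end Intertwining

/-! ### A formula for the resolvent that makes sense on the imaginary axis. -/

section Profile

variable {a : ℝ} {O₁ : L1Neg →L[ℂ] L1Pos} {O₂ : L1Pos →L[ℂ] L1Neg} {k : ℕ}
  {H : ℕ → L1Vel →L[ℂ] L1Vel} {R : ℕ → ℂ → L1Vel →L[ℂ] L1Vel} {C : ℝ}

theorem WallResolvent.resolventFamily {c : ℝ} {n : ℕ} (h : WallResolvent O₁ O₂ c n H R C) :
    ResolventFamily (speed velAll) n H (fun s : ℝ => fade velAll c (s * Complex.I))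
      (fun m s => R m (s * Complex.I)) C where
  norm_le m s hm hs := by
    have := h.norm_le m (s * Complex.I) hm (by simp) (by simpa using hs)
    simpa using this
  comm m s hm hs := comm_of_pow_comm (speed_injective ae_velAll)
    (fun m hm => h.pow_comp_res m (s * Complex.I) hm (by simp) (by simpa using hs)) hm
  left_inv m s x hm hs := h.left_inv m (s * Complex.I) x hm (by simp) (by simpa using hs)
  right_inv m s x hm hs := h.right_inv m (s * Complex.I) x hm (by simp) (by simpa using hs)

theorem WallResolvent.speed_comp {c : ℝ} {n : ℕ} (h : WallResolvent O₁ O₂ c n H R C) (m : ℕ)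
    (hm : m < n) : (speed velAll).comp (H (m + 1)) = (H m).comp (speed velAll) :=
  comm_of_pow_comm (speed_injective ae_velAll) h.pow_comp hm

variable (a k H R) in
/-- The solution with source `|v|^{k+1} g`, divided by `|v|^k`. -/
def profile (z : ℂ) (g : L1Phase a) : L1Phase a :=
  emit a z (R (k + 1) z (H (k + 1) (collect a z g))) + stream a z g

/-- All `k + 1` powers of the speed are carried from the source to the left, through `collect`, the
walls and the inverse, which replaces the latter two by their versions of level `k + 1`. One power
is absorbed in passing from densities to `emit` and `stream`; `k` remain in front. -/
theorem transportResolvent_phaseSpeed_pow (h : WallResolvent O₁ O₂ (2 * a) (k + 1) H R C) {z : ℂ}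
    (hz : 0 < z.re) (hz' : z.im ≠ 0) (g : L1Phase a) :
    transportResolvent a O₁ O₂ z ((phaseSpeed a ^ (k + 1)) g) =
      (phaseSpeed a ^ k) (profile a k H R z g) := by
  have e1 := DFunLike.congr_fun (pow_comp_of_comp (speed_comp_collect a z) (k + 1)) g
  have e2 := fun x => DFunLike.congr_fun (h.pow_comp (k + 1) le_rfl) x
  have e3 := fun x => DFunLike.congr_fun (h.pow_comp_res (k + 1) z le_rfl hz.le hz') x
  have e4 := fun x => DFunLike.congr_fun (emitDensity_comp_speed a hz) x
  have e5 := fun x => DFunLike.congr_fun (streamDensity_comp_phaseSpeed a hz) x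
  have e6 := fun x => DFunLike.congr_fun (pow_comp_of_comp (phaseSpeed_comp_emit a z) k) x
  have e7 := fun x => DFunLike.congr_fun (pow_comp_of_comp (phaseSpeed_comp_stream a z) k) x
  simp only [ContinuousLinearMap.comp_apply] at e1 e2 e3 e4 e5 e6 e7
  rw [transportResolvent_apply hz, ← e1, ← e2, ← e3, profile, map_add, e6, e7, ← e4, ← e5]
  simp only [pow_succ', mul_apply_eq_comp]

end Profile


/-! ### The profile is regular of order k and contains one resolvent. -/

section GradedProfile

theorem Graded.const {Y : Type*} [NormedAddCommGroup Y] [NormedSpace ℂ Y] [NormedSpace ℝ Y]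
    [IsScalarTower ℝ ℂ Y] {ι : Type*} {J : Y →L[ℂ] Y} {N : ι → ℝ} (hN : ∀ i, 0 ≤ N i) {x : ι → Y}
    (hx : ∀ i, ‖x i‖ ≤ N i) (n : ℕ) : Graded J N n 0 (fun i _ => x i) := by
  have base : ∀ {q : ℕ} {x : ι → Y}, (∀ i, ‖x i‖ ≤ N i) → OmegaBounded N q (fun i _ => x i) :=
    fun {q x} hx => ⟨fun i => continuousOn_const, 1, zero_le_one, fun i s _ => by
      have h1 : 1 ≤ omega s ^ q := one_le_pow₀ (one_le_omega s)
      calc ‖x i‖ ≤ 1 * N i := by rw [one_mul]; exact hx i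
        _ ≤ 1 * omega s ^ q * N i := by
          rw [one_mul (omega s ^ q)]
          exact mul_le_mul_of_nonneg_right h1 (hN i)⟩
  have zero : ∀ n q, Graded J N n q (fun _ _ => 0) := by
    intro n
    induction n with
    | zero => exact fun q => base fun i => by simpa using hN i
    | succ n ih =>
      refine fun q => ⟨base fun i => by simpa using hN i, _, ih (q + 1), fun i s _ => ?_⟩
      exact hasDerivAt_const _ _
  cases n with
  | zero => exact base hx
  | succ n => exact ⟨base hx, _, zero n 1, fun i s _ => hasDerivAt_const _ _⟩

variable {a : ℝ} {O₁ : L1Neg →L[ℂ] L1Pos} {O₂ : L1Pos →L[ℂ] L1Neg} {k : ℕ}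
  {H : ℕ → L1Vel →L[ℂ] L1Vel} {R : ℕ → ℂ → L1Vel →L[ℂ] L1Vel} {C : ℝ}

theorem ae_abs_distIn_le (ha : 0 < a) : ∀ᵐ y ∂(phase a), |distIn a y| ≤ (2 * a).toNNReal := by
  have hm : ∀ᵐ y ∂(phase a), y.1 ∈ Ioo (-a) a := by
    rw [phase_eq]
    exact ae_mem_phase.mono fun _ h => h.1
  filter_upwards [hm] with y hy
  have h := entry_mem ha y.2
  rw [Real.coe_toNNReal _ (by positivity), distIn, abs_le]
  constructor <;> linarith [hy.1, hy.2, h.1, h.2]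

theorem ae_abs_distOut_le (ha : 0 < a) : ∀ᵐ y ∂(phase a), |distOut a y| ≤ (2 * a).toNNReal := by
  have hm : ∀ᵐ y ∂(phase a), y.1 ∈ Ioo (-a) a := by
    rw [phase_eq]
    exact ae_mem_phase.mono fun _ h => h.1
  filter_upwards [hm] with y hy
  have h := entry_mem ha y.2
  rw [Real.coe_toNNReal _ (by positivity), distOut, abs_le]
  constructor <;> linarith [hy.1, hy.2, h.1, h.2]

theorem ae_abs_distFlight_le (ha : 0 < a) :
    ∀ᵐ t ∂((slabMeasure a).prod (phase a)), |distFlight t| ≤ (2 * a).toNNReal := by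
  have hm : ∀ᵐ y ∂(phase a), y.1 ∈ Ioo (-a) a := by
    rw [phase_eq]
    exact ae_mem_phase.mono fun _ h => h.1
  have hf : ∀ᵐ t ∂((slabMeasure a).prod (phase a)), t.1 ∈ Ioo (-a) a :=
    Measure.quasiMeasurePreserving_fst.ae (ae_restrict_mem measurableSet_Ioo)
  filter_upwards [ae_flight_of_phase a hm, hf] with t h1 h2
  rw [Real.coe_toNNReal _ (by positivity), distFlight, abs_le]
  constructor <;> linarith [h1.1, h1.2, h2.1, h2.2]

theorem strongFamily_fade (ha : 0 < a) : StrongFamily (speed velAll)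
    (fun s : ℝ => fade velAll (2 * a) (s * Complex.I))
    ((-Complex.I) • clip velAll (r := fun _ => 2 * a) measurable_const (2 * a).toNNReal) :=
  strongFamily_damp measurable_const measurable_id (Eventually.of_forall fun v => by
    rw [Real.coe_toNNReal _ (by positivity), abs_of_nonneg (by positivity)]) ae_velAll

/-- The exponent 1 is that of the single resolvent in the wall term; the stream term has exponent 0.
Taking the sources themselves as index set makes the constants uniform in the source. -/
theorem graded_profile (ha : 0 < a) (h : WallResolvent O₁ O₂ (2 * a) (k + 1) H R C) :
    Graded (phaseSpeed a) (fun g : L1Phase a => ‖g‖) k 1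
      (fun g s => profile a k H R (s * Complex.I) g) := by
  have hN : ∀ g : L1Phase a, 0 ≤ ‖g‖ := norm_nonneg
  have g0 : Graded (phaseSpeed a) (fun g : L1Phase a => ‖g‖) k 0 (fun g _ => g) :=
    Graded.const hN (fun _ => le_rfl) k
  have g1 := (g0.strongFamily hN (strongFamily_damp (measurable_distOut a) measurable_snd
    (ae_abs_distOut_le ha) (ae_phase_speed a))).map (L := proj (phase_eq a)) (J' := speed velAll)
    (clip_comp_proj (phase_eq a) measurable_id measurable_snd (fun _ => rfl) 1)
  -- Operators of level `k + 1` are used, while only `k` derivatives are required of them.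
  have g2 := (g1.level h.speed_comp (Nat.le_succ k) le_rfl).resolvent hN (strongFamily_fade ha)
    h.speed_comp h.resolventFamily (Nat.le_succ k) le_rfl
  have g3 := (g2.map (phaseSpeed_comp_lift a)).strongFamily hN (strongFamily_damp
    (measurable_distIn a) measurable_snd (ae_abs_distIn_le ha) (ae_phase_speed a))
  have g4 := ((g0.map (flightSpeed_comp_spread a)).strongFamily hN (strongFamily_damp
    measurable_distFlight measurable_flightVel (ae_abs_distFlight_le ha)
    (ae_flight_speed a))).map (phaseSpeed_comp_proj a)
  exact g3.add (g4.mono hN zero_le_one)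

end GradedProfile

/-! ### Boundary values of the profile on the imaginary axis. -/

section Limit

variable {a : ℝ} {O₁ : L1Neg →L[ℂ] L1Pos} {O₂ : L1Pos →L[ℂ] L1Neg} {k : ℕ}
  {H : ℕ → L1Vel →L[ℂ] L1Vel} {R : ℕ → ℂ → L1Vel →L[ℂ] L1Vel} {C : ℝ}

theorem tendsto_damp_apply {α : Type*} [MeasurableSpace α] {μ : Measure α} {y r : α → ℝ}
    (hy : Measurable y) (hr : Measurable r) {l : Filter ℂ} {z₀ : ℂ} (hl : l ≤ 𝓝 z₀)
    {ξ : ℂ → Lp ℂ 1 μ} {x : Lp ℂ 1 μ} (hξ : Tendsto ξ l (𝓝 x)) :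
    Tendsto (fun z => damp μ hy hr z (ξ z)) l (𝓝 (damp μ hy hr z₀ x)) :=
  tendsto_apply_of_bounded (C := 1) (Eventually.of_forall fun z => norm_damp_le hy hr z)
    (((continuous_damp hy hr x).tendsto z₀).mono_left hl) hξ

/-- The second resolvent identity again, now between `z` in the half plane and the boundary point
`z₀`. The bound of `R m` by ω depends on the imaginary part only, so it does not deteriorate as
`z.re` tends to 0. -/
theorem WallResolvent.tendsto_apply {c : ℝ} {n : ℕ} (h : WallResolvent O₁ O₂ c n H R C) {m : ℕ}
    (hm : m ≤ n) {z₀ : ℂ} (h0 : 0 ≤ z₀.re) (h0' : z₀.im ≠ 0) {l : Filter ℂ} (hl : l ≤ 𝓝 z₀)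
    (hl' : ∀ᶠ z in l, 0 ≤ z.re) {ξ : ℂ → L1Vel} {x : L1Vel} (hξ : Tendsto ξ l (𝓝 x)) :
    Tendsto (fun z => R m z (ξ z)) l (𝓝 (R m z₀ x)) := by
  have hC : 0 ≤ C := nonneg_of_mul_nonneg_left
    ((norm_nonneg _).trans (h.norm_le m z₀ hm h0 h0')) (omega_pos z₀.im)
  have him : ∀ᶠ z in l, z.im ≠ 0 :=
    hl ((Complex.continuous_im.continuousAt (x := z₀)).eventually_ne h0')
  have hb : ∀ᶠ z in l, ‖R m z‖ ≤ C * (omega z₀.im + 1) := by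
    have hω : ∀ᶠ z in l, omega z.im ≤ omega z₀.im + 1 :=
      hl ((Complex.continuous_im.continuousAt (x := z₀)).eventually (eventually_omega_le h0'))
    filter_upwards [hω, hl', him] with z h1 h2 h3
    exact (h.norm_le m z hm h2 h3).trans (by gcongr)
  refine tendsto_apply_of_bounded hb ?_ hξ
  have h1 : Tendsto (fun z => H m (fade velAll c z (R m z₀ x) - fade velAll c z₀ (R m z₀ x))) l
      (𝓝 0) := by
    have : Continuous fun z =>
        H m (fade velAll c z (R m z₀ x) - fade velAll c z₀ (R m z₀ x)) :=
      (H m).continuous.comp ((continuous_damp _ _ _).sub continuous_const)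
    have h2 := (this.tendsto z₀).mono_left hl
    rwa [sub_self, map_zero] at h2
  have h2 : Tendsto (fun z => R m z
      (H m (fade velAll c z (R m z₀ x) - fade velAll c z₀ (R m z₀ x)))) l (𝓝 0) :=
    tendsto_apply_of_bounded hb (by simpa using tendsto_const_nhds) h1
  have h3 := h2.const_add (R m z₀ x)
  rw [add_zero] at h3
  refine h3.congr' ?_
  filter_upwards [hl', him] with z hz hz'
  have e1 := h.left_inv m z (R m z₀ x) hm hz hz'
  have e2 := h.right_inv m z₀ x hm h0 h0'
  have e3 : x = (R m z₀ x - H m (fade velAll c z (R m z₀ x))) +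
      H m (fade velAll c z (R m z₀ x) - fade velAll c z₀ (R m z₀ x)) := by
    rw [map_sub]
    nth_rewrite 1 [← e2]
    abel
  have e4 := congrArg (R m z) e3
  rw [map_add, e1] at e4
  exact e4.symm

theorem tendsto_profile (h : WallResolvent O₁ O₂ (2 * a) (k + 1) H R C) {s : ℝ} (hs : s ≠ 0)
    (g : L1Phase a) :
    Tendsto (fun z => profile a k H R z g) (𝓝[{z : ℂ | 0 < z.re}] (s * Complex.I))
      (𝓝 (profile a k H R (s * Complex.I) g)) := by
  have hl : 𝓝[{z : ℂ | 0 < z.re}] (s * Complex.I) ≤ 𝓝 (s * Complex.I) := nhdsWithin_le_nhds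
  have hl' : ∀ᶠ z in 𝓝[{z : ℂ | 0 < z.re}] (s * Complex.I), 0 ≤ z.re :=
    eventually_mem_nhdsWithin.mono fun z hz => le_of_lt hz
  have t1 := ((proj (phase_eq a)).continuous.tendsto _).comp (tendsto_damp_apply
    (measurable_distOut a) measurable_snd hl (tendsto_const_nhds (x := g)))
  have t2 := h.tendsto_apply le_rfl (by simp) (by simpa using hs) hl hl'
    (((H (k + 1)).continuous.tendsto _).comp t1)
  have t3 := tendsto_damp_apply (measurable_distIn a) measurable_snd hl
    (((wcomp (wcomp_lift a)).continuous.tendsto _).comp t2)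
  have t4 := ((proj (P := (slabMeasure a).prod (phase a)) rfl).continuous.tendsto _).comp
    (tendsto_damp_apply measurable_distFlight measurable_flightVel hl
      (tendsto_const_nhds (x := wcomp (wcomp_spread a) g)))
  exact t3.add t4

theorem exists_phaseSpeed_pow_eq {g : L1Phase a} (hg : MemZ k g) :
    ∃ g' : L1Phase a, (phaseSpeed a ^ (k + 1)) g' = g ∧ ‖g'‖ = normZ k g := by
  have hm : AEStronglyMeasurable (fun y : ℝ × ℝ => (((|y.2| ^ (k + 1))⁻¹ : ℝ) : ℂ) * g y)
      (phase a) := by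
    refine AEStronglyMeasurable.mul ?_ (Lp.aestronglyMeasurable g)
    exact (by fun_prop : Measurable fun y : ℝ × ℝ =>
      (((|y.2| ^ (k + 1))⁻¹ : ℝ) : ℂ)).aestronglyMeasurable
  have hn : ∀ y : ℝ × ℝ, ‖(((|y.2| ^ (k + 1))⁻¹ : ℝ) : ℂ) * g y‖ = ‖g y‖ / |y.2| ^ (k + 1) :=
    fun y => by
      rw [norm_mul, Complex.norm_real, Real.norm_of_nonneg (by positivity), div_eq_inv_mul]
  have hi : Integrable (fun y : ℝ × ℝ => (((|y.2| ^ (k + 1))⁻¹ : ℝ) : ℂ) * g y) (phase a) := by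
    rw [← integrable_norm_iff hm]
    simp only [hn]
    exact hg
  refine ⟨hi.toL1 _, Lp.ext ?_, ?_⟩
  · filter_upwards [clip_pow_coe measurable_snd ((ae_phase_speed a).mono fun _ h => h.2) (k + 1)
      (hi.toL1 _), hi.coeFn_toL1, ae_phase_speed a] with y h1 h2 h3
    refine h1.trans ?_
    have h0 : ((|y.2| : ℝ) : ℂ) ^ (k + 1) ≠ 0 := pow_ne_zero _ (by exact_mod_cast h3.1.ne')
    rw [h2]
    push_cast
    rw [mul_inv_cancel_left₀ h0]
  · rw [norm_L1, normZ]
    refine integral_congr_ae ?_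
    filter_upwards [hi.coeFn_toL1] with y hy
    rw [hy, hn]

end Limit

/-! ### Limits, smoothness and bounds of the extended resolvent. -/

section Extension

variable {a : ℝ} {O₁ : L1Neg →L[ℂ] L1Pos} {O₂ : L1Pos →L[ℂ] L1Neg} {k : ℕ}
  {H : ℕ → L1Vel →L[ℂ] L1Vel} {R : ℕ → ℂ → L1Vel →L[ℂ] L1Vel} {C : ℝ}

theorem omega_of_one_le {s : ℝ} (hs : 1 ≤ |s|) : omega s = 1 := by
  refine max_eq_left (inv_le_one_of_one_le₀ ?_)
  rw [← sq_abs]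
  exact one_le_pow₀ hs

theorem omega_of_le_one {s : ℝ} (hs0 : 0 < |s|) (hs : |s| ≤ 1) : omega s = (s ^ 2)⁻¹ := by
  refine max_eq_right ((one_le_inv₀ ?_).2 ?_)
  · rw [← sq_abs]; positivity
  · rw [← sq_abs]; exact pow_le_one₀ hs0.le hs

theorem exists_resolvent_extension (ha : 0 < a)
    (h : WallResolvent O₁ O₂ (2 * a) (k + 1) H R C) :
    ∃ M : ℝ, 0 < M ∧ ∀ g : L1Phase a, MemZ k g →
      ∃ F : ℝ → L1Phase a,
        (∀ s : ℝ, s ≠ 0 → Tendsto (fun z : ℂ => transportResolvent a O₁ O₂ z g)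
          (𝓝[{z : ℂ | 0 < z.re}] ((s : ℂ) * Complex.I)) (𝓝 (F s))) ∧
        ContDiffOn ℝ k F {0}ᶜ ∧
        (∀ j : ℕ, j ≤ k → ∃ M : ℝ, ∀ s : ℝ, 1 ≤ |s| → ‖iteratedDeriv j F s‖ ≤ M) ∧
        (∀ j : ℕ, j ≤ k → ∀ s : ℝ, 0 < |s| → |s| ≤ 1 →
          ‖iteratedDeriv j F s‖ ≤ M / s ^ (2 * (j + 1)) * normZ k g) := by
  obtain ⟨D, hD0, hD, hDb⟩ := (graded_profile ha h).exists_derivs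
  choose! hDc B hB0 hB using hDb
  -- One constant for all orders `j ≤ k`; the summand 1 makes it positive.
  set M := 1 + ∑ j ∈ Finset.range (k + 1), B j with hM
  have hBM : ∀ j, j ≤ k → B j ≤ M := fun j hj => by
    have := Finset.single_le_sum (f := B) (s := Finset.range (k + 1))
      (fun i hi => hB0 i (Nat.lt_succ_iff.1 (Finset.mem_range.1 hi)))
      (Finset.mem_range.2 (Nat.lt_succ_of_le hj))
    linarith
  have hM0 : 0 < M := by
    have := Finset.sum_nonneg fun i (hi : i ∈ Finset.range (k + 1)) =>
      hB0 i (Nat.lt_succ_iff.1 (Finset.mem_range.1 hi))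
    linarith
  refine ⟨M, hM0, fun g hg => ?_⟩
  obtain ⟨g', rfl, hg'⟩ := exists_phaseSpeed_pow_eq hg
  have hopen : IsOpen ({0}ᶜ : Set ℝ) := isOpen_compl_singleton
  have hDg : ∀ j, j < k → ∀ s ∈ ({0}ᶜ : Set ℝ), HasDerivAt (D j g') (D (j + 1) g' s) s :=
    fun j hj s hs => hD j hj g' s hs
  have hit := iteratedDeriv_eq_of_hasDerivAt hopen (D := fun j => D j g') hDg
  refine ⟨D 0 g', fun s hs => ?_, contDiffOn_of_hasDerivAt hopen (D := fun j => D j g') hDg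
    (hDc k le_rfl g'), fun j hj => ⟨B j * ‖g'‖, fun s hs => ?_⟩, fun j hj s hs0 hs => ?_⟩
  · rw [hD0]
    refine (((phaseSpeed a ^ k).continuous.tendsto _).comp (tendsto_profile h hs g')).congr' ?_
    have him : ∀ᶠ z : ℂ in 𝓝[{z : ℂ | 0 < z.re}] ((s : ℂ) * Complex.I), z.im ≠ 0 :=
      nhdsWithin_le_nhds
        ((Complex.continuous_im.continuousAt (x := (s : ℂ) * Complex.I)).eventually_ne
        (by simpa using hs))
    filter_upwards [him, eventually_mem_nhdsWithin] with z hz hz'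
    exact (transportResolvent_phaseSpeed_pow h hz' hz g').symm
  · have hs0 : s ≠ 0 := by
      rintro rfl
      rw [abs_zero] at hs
      linarith
    rw [hit j hj s hs0]
    have := hB j hj g' s hs0
    rwa [omega_of_one_le hs, one_pow, mul_one] at this
  · have hs' : s ≠ 0 := abs_pos.1 hs0
    rw [hit j hj s hs', ← hg']
    refine (hB j hj g' s hs').trans ?_
    -- The bound for the j-th derivative carries ω to the power `1 + j`, and ω equals `(s ^ 2)⁻¹`
    -- here.
    rw [omega_of_le_one hs0 hs, inv_pow, ← pow_mul, add_comm 1 j, ← div_eq_mul_inv]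
    have : 0 < s ^ (2 * (j + 1)) := by
      rw [pow_mul]
      positivity
    gcongr
    exact hBM j hj

end Extension

end Slab

end

theorem mainTheorem5
    (a : ℝ) (ha : 0 < a)
    (α₁ β₁ α₂ β₂ : ℝ) (hα₁ : 0 ≤ α₁) (hβ₁ : 0 ≤ β₁) (hα₂ : 0 ≤ α₂) (hβ₂ : 0 ≤ β₂)
    (hsum₁ : α₁ + β₁ = 1) (hsum₂ : α₂ + β₂ = 1)
    (K₁ : Slab.L1Neg →L[ℂ] Slab.L1Pos) (K₂ : Slab.L1Pos →L[ℂ] Slab.L1Neg)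
    (hK₁ : Slab.IsStochastic K₁) (hK₂ : Slab.IsStochastic K₂)
    (k₁ k₂ : ℝ → ℝ → ℝ)
    (hk₁ : Slab.HasKernel K₁ k₁) (hk₂ : Slab.HasKernel K₂ k₂)
    (hcont₁ : ContinuousOn (Function.uncurry k₁) (Icc (0 : ℝ) 1 ×ˢ Icc (-1 : ℝ) 0))
    (hcont₂ : ContinuousOn (Function.uncurry k₂) (Icc (-1 : ℝ) 0 ×ˢ Icc (0 : ℝ) 1))
    (O₁ : Slab.L1Neg →L[ℂ] Slab.L1Pos) (O₂ : Slab.L1Pos →L[ℂ] Slab.L1Neg)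
    (hO₁ : O₁ = (α₁ : ℂ) • Slab.reflect₁ + (β₁ : ℂ) • K₁)
    (hO₂ : O₂ = (α₂ : ℂ) • Slab.reflect₂ + (β₂ : ℂ) • K₂)
    (hdiffuse : O₁ = K₁ ∨ O₂ = K₂)
    (k : ℕ)
    (hO₁O₂ : Slab.IsBoundedWeighted (k + 1) (O₁.comp O₂) 0)
    (hO₁w : Slab.IsBoundedWeighted (k + 1) O₁ (k + 1))
    (hO₂w : ∀ p : ℕ, p ≤ k → Slab.IsBoundedWeighted (k + 1 - p) O₂ (k + 1 - p)) :
    ∃ R : ℂ → (Slab.L1Phase a →L[ℂ] Slab.L1Phase a),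
      (∀ z : ℂ, 0 < z.re → Slab.IsResolventAt a O₁ O₂ z (R z)) ∧
      ∃ C : ℝ, 0 < C ∧ ∀ g : Slab.L1Phase a, Slab.MemZ k g →
        ∃ F : ℝ → Slab.L1Phase a,
          (∀ s : ℝ, s ≠ 0 →
            Tendsto (fun z : ℂ => R z g) (𝓝[{z : ℂ | 0 < z.re}] ((s : ℂ) * Complex.I))
              (𝓝 (F s))) ∧
          ContDiffOn ℝ k F {0}ᶜ ∧
          (∀ j : ℕ, j ≤ k → ∃ M : ℝ, ∀ s : ℝ, 1 ≤ |s| → ‖iteratedDeriv j F s‖ ≤ M) ∧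
          (∀ j : ℕ, j ≤ k → ∀ s : ℝ, 0 < |s| → |s| ≤ 1 →
            ‖iteratedDeriv j F s‖ ≤ C / s ^ (2 * (j + 1)) * Slab.normZ k g) := by
  obtain ⟨n₁, n₂, H, R, C, h⟩ := Slab.exists_wallResolvent_of_maxwell (c := 2 * a) (by positivity)
    hα₁ hβ₁ hα₂ hβ₂ hsum₁ hsum₂ hK₁ hK₂ hk₁ hk₂ hcont₁ hcont₂ hO₁ hO₂ hdiffuse hO₁O₂ hO₁w hO₂w
  exact ⟨Slab.transportResolvent a O₁ O₂,
    fun z hz => Slab.isResolventAt_transportResolvent ha n₁ n₂ hz,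
    Slab.exists_resolvent_extension ha h⟩
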